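/- **Theorem (A cofibration category for bigraded path homology).** Let $R$ be a principal ideal domain. A directed graph $G$ is a set $V(G)$ with a set of edges $E(G)\subseteq V(G)\times V(G)$ (loops allowed); a map $G\to H$ is a function $f\colon V(G)\to V(H)$ such that for each edge $x\to y$ of $G$ either $f(x)=f(y)$ or $f(x)\to f(y)$ is an edge of $H$. This gives the category $\mathrm{DiGraph}$. Let $d(x,y)\in\mathbb N\cup\{\infty\}$ be the least number of edges in a directed path from $x$ to $y$. *Cofibrations.* A map is a cofibration if it is, up to isomorphism in $\mathrm{DiGraph}$ (so loops are disregarded), the inclusion of an induced subgraph $A\hookrightarrow X$ such that (1) no edge of $X$ goes from a vertex outside $A$ to a vertex of $A$, and (2) for each vertex $x$ of $X$ admitting a directed path from some vertex of $A$ there is a vertex $\pi(x)\in A$ with $d(a,x)=d(a,\pi(x))+d(\pi(x),x)$ for all $a\in A$. *Bigraded path homology.* Let $\mathrm{RC}_k(G)$ be the free $R$-module on tuples $(x_0,\dots,x_k)$ of vertices with consecutive entries distinct and with a directed path from each entry to the next. Its differential is $\partial(x_0,\dots,x_k)=\sum_{i=0}^k(-1)^i(x_0,\dots,\widehat{x_i},\dots,x_k)$,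 omitting terms with repeated consecutive entries (and $\partial=0$ in degree $0$). Let $F_\ell\mathrm{RC}_*(G)$ be the span of the generators with $\sum_i d(x_{i-1},x_i)\le \ell$. With $E^r_{p,q}(G)$ the spectral sequence of this filtered complex, $\mathrm{PH}_{k,\ell}(G)=E^2_{\ell,k-\ell}(G)$; it is functorial in $G$. Then $\mathrm{DiGraph}$, with these cofibrations and with weak equivalences the maps inducing isomorphisms on $\mathrm{PH}_{k,\ell}$ for all $k,\ell$, is a cofibration category in the following sense (an acyclic cofibration is a cofibration that is a weak equivalence): - (C1) Cofibrations and weak equivalences are each closed under composition, and identities are acyclic cofibrations. - (C2) If $g f$ and $h g$ are weak equivalences, then so are $f$, $g$, $h$ and $hgf$. - (C3) There is an initial object, and the map from it to any object is a cofibration. - (C4) Pushouts along cofibrations exist, and pushouts of (acyclic) cofibrations are (acyclic) cofibrations. - (C5) For every object $X$ the codiagonal $X\sqcup X\to X$ factors as a cofibration followed by a weak equivalence. - (C6) All small coproducts exist. - (C7) Transfinite composites of (acyclic) cofibrations are (acyclic) cofibrations. Moreover, every such weak equivalence induces isomorphisms on ordinary path homology: the homology of the complex $\Omega_*(G)$,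 where $\Omega_k(G)$ consists of the $R$-linear combinations $c$ of tuples $(x_0,\dots,x_k)$ with each $x_{i-1}\to x_i$ an edge and $x_{i-1}\ne x_i$ such that $\partial c$ is again a combination of such tuples. Thus the structure refines the one with the same cofibrations whose weak equivalences are the path homology isomorphisms. -/

import Mathlib

open CategoryTheory CategoryTheory.Limits

universe w v u

/-! ### Cofibration categories -/

/-- The classes `W` (weak equivalences) and `Cof` (cofibrations) make `C` a cofibration category.
An acyclic cofibration is a morphism in `Cof ⊓ W`. "Small" refers to the universe `v` of the
hom-sets of `C`. -/
structure IsCofibrationCategory (C : Type u) [Category.{v} C] (W Cof : MorphismProperty C) :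
    Prop where
  /-- (C1) -/
  cof_comp : ∀ ⦃X Y Z : C⦄ (f : X ⟶ Y) (g : Y ⟶ Z), Cof f → Cof g → Cof (f ≫ g)
  /-- (C1) -/
  weq_comp : ∀ ⦃X Y Z : C⦄ (f : X ⟶ Y) (g : Y ⟶ Z), W f → W g → W (f ≫ g)
  /-- (C1) -/
  id_mem : ∀ X : C, (Cof ⊓ W) (𝟙 X)
  /-- (C2) the two-out-of-six property -/
  two_of_six : ∀ ⦃X Y Z T : C⦄ (f : X ⟶ Y) (g : Y ⟶ Z) (h : Z ⟶ T),
    W (f ≫ g) → W (g ≫ h) → W f ∧ W g ∧ W h ∧ W (f ≫ g ≫ h)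
  /-- (C3) -/
  hasInitial : HasInitial C
  /-- (C3) every object is cofibrant -/
  cofibrant : ∀ ⦃I : C⦄ (hI : IsInitial I) (X : C), Cof (hI.to X)
  /-- (C4) -/
  hasPushout : ∀ ⦃A X Y : C⦄ (i : A ⟶ X) (f : A ⟶ Y), Cof i → HasPushout i f
  /-- (C4) -/
  cof_pushout : ∀ ⦃A X Y P : C⦄ (i : A ⟶ X) (f : A ⟶ Y) (g : X ⟶ P) (j : Y ⟶ P),
    IsPushout i f g j → Cof i → Cof j
  /-- (C4) -/
  acyclic_pushout : ∀ ⦃A X Y P : C⦄ (i : A ⟶ X) (f : A ⟶ Y) (g : X ⟶ P) (j : Y ⟶ P),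
    IsPushout i f g j → (Cof ⊓ W) i → (Cof ⊓ W) j
  /-- (C5) the codiagonal of any object factors as a cofibration followed by a weak equivalence -/
  codiagonal : ∀ (X : C) (c : BinaryCofan X X) (hc : IsColimit c),
    ∃ (Z : C) (i : c.pt ⟶ Z) (p : Z ⟶ X), Cof i ∧ W p ∧
      i ≫ p = hc.desc (BinaryCofan.mk (𝟙 X) (𝟙 X))
  /-- (C6) -/
  hasCoproducts : HasCoproducts.{v} C
  /-- (C7) -/
  cof_transfinite : MorphismProperty.IsStableUnderTransfiniteComposition.{v} Cof
  /-- (C7) -/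
  acyclic_transfinite : MorphismProperty.IsStableUnderTransfiniteComposition.{v} (Cof ⊓ W)

/-! ### The category of directed graphs -/

/-- A directed graph: a set of vertices with a set of ordered pairs of vertices
(loops are allowed). -/
structure DirGraph : Type (u + 1) where
  /-- the vertices -/
  V : Type u
  /-- the edges -/
  graph : Digraph V

namespace DirGraph

/-- There is an edge `x → y`. -/
def Adj (G : DirGraph.{u}) (x y : G.V) : Prop := G.graph.Adj x y

/-- A map of directed graphs sends each edge to an edge or collapses it to a vertex. -/
@[ext]
structure Hom (G H : DirGraph.{u}) where
  /-- the function on vertices -/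
  toFun : G.V → H.V
  map_adj : ∀ x y, G.Adj x y → toFun x = toFun y ∨ H.Adj (toFun x) (toFun y)

instance : Category.{u} DirGraph.{u} where
  Hom := Hom
  id G := ⟨fun x => x, fun _ _ h => Or.inr h⟩
  comp f g := ⟨fun x => g.toFun (f.toFun x), fun x y h => by
    rcases f.map_adj x y h with h | h
    · exact Or.inl (congrArg g.toFun h)
    · exact g.map_adj _ _ h⟩

/-- There is a directed path with `n` edges from the first vertex to the second. -/
def HasPath (G : DirGraph.{u}) : ℕ → G.V → G.V → Prop
  | 0, x, y => x = y
  | n + 1, x, y => ∃ z, G.Adj x z ∧ G.HasPath n z y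

/-- There is a directed path from `x` to `y`. -/
def Reaches (G : DirGraph.{u}) (x y : G.V) : Prop := ∃ n, G.HasPath n x y

/-- The shortest path metric. -/
noncomputable def dist (G : DirGraph.{u}) (x y : G.V) : ℕ∞ :=
  ⨅ (n : ℕ) (_ : G.HasPath n x y), (n : ℕ∞)

/-! ### Cofibrations of directed graphs -/

/-- `f` is, up to isomorphism of directed graphs, the inclusion of an induced subgraph. Loops are
disregarded, since adding or removing loops does not change the isomorphism type of an object of
the category of directed graphs. -/
def IsInducedInclusion {A X : DirGraph.{u}} (f : A ⟶ X) : Prop :=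
  Function.Injective f.toFun ∧
    ∀ a b : A.V, a ≠ b → X.Adj (f.toFun a) (f.toFun b) → A.Adj a b

/-- The vertices of the reach of a set of vertices. -/
def reach (X : DirGraph.{u}) (A : Set X.V) : Set X.V := {x | ∃ a ∈ A, X.Reaches a x}

/-- Cofibrations of directed graphs. -/
def cofibrations : MorphismProperty DirGraph.{u} := fun _ X f =>
  IsInducedInclusion f ∧
  (∀ x y : X.V, x ∉ Set.range f.toFun → y ∈ Set.range f.toFun → ¬ X.Adj x y) ∧
  (∀ x ∈ X.reach (Set.range f.toFun), ∃ p ∈ Set.range f.toFun,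
    ∀ a ∈ Set.range f.toFun, X.dist a x = X.dist a p + X.dist p x)

/-! ### Chains -/

/-- Consecutive entries are distinct. -/
def IsRegular {V : Type u} {k : ℕ} (x : Fin (k + 1) → V) : Prop :=
  ∀ i : Fin k, x i.castSucc ≠ x i.succ

/-- The free `R`-module on all `(k+1)`-tuples of elements of `V`; the chain modules below are
submodules of it spanned by suitable regular tuples. -/
abbrev Chains (R : Type w) [CommRing R] (V : Type u) (k : ℕ) : Type (max u w) :=
  (Fin (k + 1) → V) →₀ R

open Classical in
/-- The generator `x` if `x` is regular, and `0` otherwise. -/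
noncomputable def gen (R : Type w) [CommRing R] {V : Type u} {k : ℕ} (x : Fin (k + 1) → V) :
    Chains R V k :=
  if IsRegular x then Finsupp.single x 1 else 0

/-- The differential: `(x₀, …, xₖ)` goes to the alternating sum of the tuples obtained by deleting
one entry, where any term with repeated consecutive entries is omitted. It vanishes in
degree `0`. -/
noncomputable def boundary (R : Type w) [CommRing R] (V : Type u) :
    (k : ℕ) → Chains R V k →ₗ[R] Chains R V (k - 1)
  | 0 => 0
  | k + 1 => Finsupp.linearCombination R fun x : Fin (k + 2) → V =>
      ∑ j : Fin (k + 2), (-1 : R) ^ (j : ℕ) • gen R (fun i => x (j.succAbove i))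

/-- The map on chains induced by a function: `(x₀, …, xₖ)` goes to `(f x₀, …, f xₖ)`, or to `0` if
that tuple has repeated consecutive entries. -/
noncomputable def chainMap (R : Type w) [CommRing R] {V V' : Type u} (f : V → V') (k : ℕ) :
    Chains R V k →ₗ[R] Chains R V' k :=
  Finsupp.linearCombination R fun x => gen R (fun i => f (x i))

/-! ### Subquotients -/

section SubQuot

variable {R : Type w} [CommRing R] {M : Type u} [AddCommGroup M] [Module R M]
  {N : Type u} [AddCommGroup N] [Module R N]

/-- The subquotient `Z / (B ∩ Z)` of a module; it is used for `B ⊆ Z`. -/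
abbrev SubQuot (Z B : Submodule R M) : Type u := Z ⧸ B.submoduleOf Z

/-- The map of subquotients induced by a linear map. -/
def subQuotMap (g : M →ₗ[R] N) {Z B : Submodule R M} {Z' B' : Submodule R N}
    (hZ : Z ≤ Z'.comap g) (hB : B ≤ B'.comap g) : SubQuot Z B →ₗ[R] SubQuot Z' B' :=
  Submodule.mapQ _ _ (g.restrict hZ) fun _ hc => hB hc

end SubQuot

/-! ### Reachability chains and the magnitude-path spectral sequence -/

/-- The generators of the reachability chains in degree `k`. -/
def reachTuples (G : DirGraph.{u}) (k : ℕ) : Set (Fin (k + 1) → G.V) :=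
  {x | IsRegular x ∧ ∀ i : Fin k, G.Reaches (x i.castSucc) (x i.succ)}

/-- The length of a tuple. -/
noncomputable def length (G : DirGraph.{u}) {k : ℕ} (x : Fin (k + 1) → G.V) : ℕ∞ :=
  ∑ i : Fin k, G.dist (x i.castSucc) (x i.succ)

/-- `F_p RC_k(G)`: the span of the generators of the reachability chains of length at most `p`
(it is zero for `p < 0`). -/
noncomputable def filt (R : Type w) [CommRing R] (G : DirGraph.{u}) (p : ℤ) (k : ℕ) :
    Submodule R (Chains R G.V k) :=
  Finsupp.supported R R {x | x ∈ G.reachTuples k ∧ ∃ n : ℕ, G.length x = n ∧ (n : ℤ) ≤ p}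

/-- `Z^r_p` in degree `k`: the chains in `F_p RC_k(G)` whose boundary lies in
`F_{p-r} RC_{k-1}(G)`. -/
noncomputable def pageZ (R : Type w) [CommRing R] (G : DirGraph.{u}) (r p : ℤ) (k : ℕ) :
    Submodule R (Chains R G.V k) :=
  G.filt R p k ⊓ (G.filt R (p - r) (k - 1)).comap (boundary R G.V k)

/-- `Z^{r-1}_{p-1} + ∂ Z^{r-1}_{p+r-1}` in degree `k`. -/
noncomputable def pageB (R : Type w) [CommRing R] (G : DirGraph.{u}) (r p : ℤ) (k : ℕ) :
    Submodule R (Chains R G.V k) :=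
  G.pageZ R (r - 1) (p - 1) k ⊔
    (G.pageZ R (r - 1) (p + r - 1) (k + 1)).map (boundary R G.V (k + 1))

/-- The term `E^r_{p,k-p}(G)` of the magnitude-path spectral sequence, i.e. of the spectral
sequence of the filtered complex `F_* RC_*(G)`; it is indexed by the page `r`, the
filtration degree `p` and the total degree `k`. -/
abbrev Page (R : Type w) [CommRing R] (G : DirGraph.{u}) (r p : ℤ) (k : ℕ) : Type (max u w) :=
  SubQuot (G.pageZ R r p k) (G.pageB R r p k)

/-- Bigraded path homology `PH_{k,ℓ}(G) = E²_{ℓ,k-ℓ}(G)`. -/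
abbrev BigradedPathHomology (R : Type w) [CommRing R] (G : DirGraph.{u}) (k : ℕ) (l : ℤ) :
    Type (max u w) :=
  G.Page R 2 l k

/-! ### Ordinary path homology -/

/-- The span of the regular allowed `k`-paths, i.e. tuples with consecutive entries distinct and
joined by an edge. -/
noncomputable def allowed (R : Type w) [CommRing R] (G : DirGraph.{u}) (k : ℕ) :
    Submodule R (Chains R G.V k) :=
  Finsupp.supported R R {x | IsRegular x ∧ ∀ i : Fin k, G.Adj (x i.castSucc) (x i.succ)}

/-- The `∂`-invariant chains: allowed chains with allowed boundary. -/
noncomputable def invariantChains (R : Type w) [CommRing R] (G : DirGraph.{u}) (k : ℕ) :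
    Submodule R (Chains R G.V k) :=
  G.allowed R k ⊓ (G.allowed R (k - 1)).comap (boundary R G.V k)

/-- The cycles of the complex of `∂`-invariant chains. -/
noncomputable def pathCycles (R : Type w) [CommRing R] (G : DirGraph.{u}) (k : ℕ) :
    Submodule R (Chains R G.V k) :=
  G.invariantChains R k ⊓ LinearMap.ker (boundary R G.V k)

/-- The boundaries of the complex of `∂`-invariant chains. -/
noncomputable def pathBoundaries (R : Type w) [CommRing R] (G : DirGraph.{u}) (k : ℕ) :
    Submodule R (Chains R G.V k) :=
  (G.invariantChains R (k + 1)).map (boundary R G.V (k + 1))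

/-- Path homology `PH_k(G)`. -/
abbrev PathHomology (R : Type w) [CommRing R] (G : DirGraph.{u}) (k : ℕ) : Type (max u w) :=
  SubQuot (G.pathCycles R k) (G.pathBoundaries R k)

/-! ### Functoriality -/

section Functoriality

theorem hasPath_map {G H : DirGraph.{u}} (f : G ⟶ H) {n : ℕ} {x y : G.V} (h : G.HasPath n x y) :
    ∃ m ≤ n, H.HasPath m (f.toFun x) (f.toFun y) := by
  induction n generalizing x with
  | zero =>
    have : x = y := h
    subst this
    exact ⟨0, le_rfl, rfl⟩
  | succ n ih =>
    obtain ⟨t, ht, hp⟩ := h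
    obtain ⟨m, hm, hq⟩ := ih hp
    rcases f.map_adj x t ht with h | h
    · exact ⟨m, by omega, h ▸ hq⟩
    · exact ⟨m + 1, by omega, _, h, hq⟩

theorem dist_map_le {G H : DirGraph.{u}} (f : G ⟶ H) (x y : G.V) :
    H.dist (f.toFun x) (f.toFun y) ≤ G.dist x y := by
  refine le_iInf₂ fun n hn => ?_
  obtain ⟨m, hm, hq⟩ := hasPath_map f hn
  exact (iInf₂_le m hq).trans (by exact_mod_cast hm)

variable (R : Type w) [CommRing R]

theorem gen_of_not {V : Type u} {k : ℕ} {x : Fin (k + 1) → V} (h : ¬ IsRegular x) :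
    gen R x = 0 := by
  simp [gen, h]

theorem gen_of {V : Type u} {k : ℕ} {x : Fin (k + 1) → V} (h : IsRegular x) :
    gen R x = Finsupp.single x 1 := by
  simp [gen, h]

theorem succAbove_val {n : ℕ} (j : Fin (n + 1)) (i : Fin n) :
    (j.succAbove i : ℕ) = if (i : ℕ) < j then (i : ℕ) else i + 1 := by
  by_cases h : i.castSucc < j
  · have h' : (i : ℕ) < j := h
    rw [Fin.succAbove_of_castSucc_lt _ _ h, if_pos h', Fin.val_castSucc]
  · have h' : ¬ (i : ℕ) < j := h
    rw [Fin.succAbove_of_le_castSucc _ _ (not_lt.mp h), if_neg h', Fin.val_succ]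

/-- The boundary of a degenerate tuple vanishes. -/
theorem sum_faces_eq_zero {V : Type u} {k : ℕ} {x : Fin (k + 2) → V} (h : ¬ IsRegular x) :
    ∑ j : Fin (k + 2), (-1 : R) ^ (j : ℕ) • gen R (fun i => x (j.succAbove i)) = 0 := by
  simp only [IsRegular, not_forall, not_not] at h
  obtain ⟨i, hi⟩ := h
  have hne : i.castSucc ≠ i.succ := Fin.castSucc_lt_succ.ne
  rw [Fintype.sum_eq_add i.castSucc i.succ hne]
  · have hface : (fun t => x (i.castSucc.succAbove t)) = fun t => x (i.succ.succAbove t) := by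
      funext t
      by_cases ht : t = i
      · subst ht
        rw [Fin.succAbove_castSucc_self, Fin.succAbove_succ_self, hi]
      · congr 1
        rw [Fin.ext_iff] at ht
        rw [Fin.ext_iff, succAbove_val, succAbove_val, Fin.val_castSucc, Fin.val_succ]
        split_ifs <;> omega
    rw [hface]
    simp [pow_succ]
  · rintro j ⟨hj1, hj2⟩
    rw [gen_of_not, smul_zero]
    intro hreg
    simp only [ne_eq, Fin.ext_iff, Fin.val_castSucc, Fin.val_succ] at hj1 hj2
    obtain ⟨k, rfl⟩ : ∃ k', k = k' + 1 := by
      refine ⟨k - 1, ?_⟩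
      have := i.isLt
      have := j.isLt
      omega
    rcases lt_or_gt_of_ne hj1 with hlt | hgt
    · refine hreg ⟨i - 1, by omega⟩ ?_
      convert hi using 2 <;>
        (simp only [Fin.ext_iff, succAbove_val, Fin.val_castSucc, Fin.val_succ]
         split_ifs <;> omega)
    · refine hreg ⟨i, by omega⟩ ?_
      convert hi using 2 <;>
        (simp only [Fin.ext_iff, succAbove_val, Fin.val_castSucc, Fin.val_succ]
         split_ifs <;> omega)

theorem boundary_gen {V : Type u} {k : ℕ} (x : Fin (k + 2) → V) :
    boundary R V (k + 1) (gen R x) =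
      ∑ j : Fin (k + 2), (-1 : R) ^ (j : ℕ) • gen R (fun i => x (j.succAbove i)) := by
  by_cases h : IsRegular x
  · rw [gen_of R h]
    simp [boundary]
  · rw [gen_of_not R h, map_zero, sum_faces_eq_zero R h]

theorem chainMap_gen {V V' : Type u} (f : V → V') {k : ℕ} (x : Fin (k + 1) → V) :
    chainMap R f k (gen R x) = gen R (fun i => f (x i)) := by
  by_cases h : IsRegular x
  · rw [gen_of R h]
    simp [chainMap]
  · rw [gen_of_not R h, map_zero, gen_of_not]
    exact fun h' => h fun i hi => h' i (congrArg f hi)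

theorem boundary_chainMap {V V' : Type u} (f : V → V') (k : ℕ) (c : Chains R V k) :
    boundary R V' k (chainMap R f k c) = chainMap R f (k - 1) (boundary R V k c) := by
  cases k with
  | zero => simp [boundary]
  | succ k =>
    induction c using Finsupp.induction_linear with
    | zero => simp
    | add a b ha hb => simp only [map_add, ha, hb]
    | single x r =>
      have e1 : chainMap R f (k + 1) (Finsupp.single x r) = r • gen R (fun i => f (x i)) := by
        simp [chainMap]
      have e2 : boundary R V (k + 1) (Finsupp.single x r) =
          r • ∑ j : Fin (k + 2), (-1 : R) ^ (j : ℕ) • gen R (fun i => x (j.succAbove i)) := by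
        simp [boundary]
      rw [e1, e2, map_smul, boundary_gen, map_smul]
      congr 1
      refine Eq.trans ?_ (map_sum (chainMap R f k) _ _).symm
      refine Finset.sum_congr rfl fun j _ => ?_
      rw [map_smul, chainMap_gen]

/-- A map of tuples that sends generators in `S` to generators in `T` or to degenerate tuples
sends chains supported on `S` to chains supported on `T`. -/
theorem chainMap_supported {V V' : Type u} (f : V → V') {k : ℕ} {S : Set (Fin (k + 1) → V)}
    {T : Set (Fin (k + 1) → V')}
    (h : ∀ x ∈ S, IsRegular (fun i => f (x i)) → (fun i => f (x i)) ∈ T) :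
    Finsupp.supported R R S ≤ (Finsupp.supported R R T).comap (chainMap R f k) := by
  rw [Finsupp.supported_eq_span_single, Submodule.span_le]
  rintro _ ⟨x, hx, rfl⟩
  have e : chainMap R f k (Finsupp.single x 1) = gen R (fun i => f (x i)) := by simp [chainMap]
  change chainMap R f k (Finsupp.single x 1) ∈ Finsupp.supported R R T
  rw [e]
  by_cases hr : IsRegular (fun i => f (x i))
  · rw [gen_of R hr]
    exact Finsupp.single_mem_supported R _ (h x hx hr)
  · rw [gen_of_not R hr]
    exact zero_mem _

variable {G H : DirGraph.{u}} (f : G ⟶ H)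

theorem filt_le_comap (p : ℤ) (k : ℕ) :
    G.filt R p k ≤ (H.filt R p k).comap (chainMap R f.toFun k) := by
  refine chainMap_supported R f.toFun ?_
  rintro x ⟨⟨-, hx⟩, n, hn, hnp⟩ hreg
  refine ⟨⟨hreg, fun i => ?_⟩, ?_⟩
  · obtain ⟨m, hm⟩ := hx i
    obtain ⟨m', -, hm'⟩ := hasPath_map f hm
    exact ⟨m', hm'⟩
  · have hle : H.length (fun i => f.toFun (x i)) ≤ n := by
      rw [← hn]
      exact Finset.sum_le_sum fun i _ => dist_map_le f _ _
    obtain ⟨m, hm⟩ := ENat.ne_top_iff_exists.mp (ne_top_of_le_ne_top (ENat.natCast_ne_top n) hle)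
    refine ⟨m, hm.symm, ?_⟩
    rw [← hm] at hle
    have : m ≤ n := by exact_mod_cast hle
    omega

theorem pageZ_le_comap (r p : ℤ) (k : ℕ) :
    G.pageZ R r p k ≤ (H.pageZ R r p k).comap (chainMap R f.toFun k) := by
  rintro c ⟨h1, h2⟩
  refine ⟨filt_le_comap R f p k h1, ?_⟩
  change boundary R H.V k (chainMap R f.toFun k c) ∈ H.filt R (p - r) (k - 1)
  rw [boundary_chainMap]
  exact filt_le_comap R f (p - r) (k - 1) h2

theorem pageB_le_comap (r p : ℤ) (k : ℕ) :
    G.pageB R r p k ≤ (H.pageB R r p k).comap (chainMap R f.toFun k) := by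
  refine sup_le ((pageZ_le_comap R f _ _ k).trans (Submodule.comap_mono le_sup_left)) ?_
  rintro _ ⟨c, hc, rfl⟩
  refine Submodule.mem_sup_right ⟨chainMap R f.toFun (k + 1) c, pageZ_le_comap R f _ _ _ hc, ?_⟩
  exact boundary_chainMap R f.toFun (k + 1) c

/-- The map on `E^r_{p,k-p}` induced by a map of directed graphs. -/
noncomputable def pageMap (r p : ℤ) (k : ℕ) : G.Page R r p k →ₗ[R] H.Page R r p k :=
  subQuotMap (chainMap R f.toFun k) (pageZ_le_comap R f r p k) (pageB_le_comap R f r p k)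

/-- The map on bigraded path homology induced by a map of directed graphs. -/
noncomputable def bigradedPathHomologyMap (k : ℕ) (l : ℤ) :
    G.BigradedPathHomology R k l →ₗ[R] H.BigradedPathHomology R k l :=
  pageMap R f 2 l k

theorem allowed_le_comap (k : ℕ) :
    G.allowed R k ≤ (H.allowed R k).comap (chainMap R f.toFun k) := by
  refine chainMap_supported R f.toFun ?_
  rintro x ⟨-, hx⟩ hreg
  exact ⟨hreg, fun i => (f.map_adj _ _ (hx i)).resolve_left (hreg i)⟩

theorem invariantChains_le_comap (k : ℕ) :
    G.invariantChains R k ≤ (H.invariantChains R k).comap (chainMap R f.toFun k) := by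
  rintro c ⟨h1, h2⟩
  refine ⟨allowed_le_comap R f k h1, ?_⟩
  change boundary R H.V k (chainMap R f.toFun k c) ∈ H.allowed R (k - 1)
  rw [boundary_chainMap]
  exact allowed_le_comap R f (k - 1) h2

theorem pathCycles_le_comap (k : ℕ) :
    G.pathCycles R k ≤ (H.pathCycles R k).comap (chainMap R f.toFun k) := by
  rintro c ⟨h1, h2⟩
  refine ⟨invariantChains_le_comap R f k h1, ?_⟩
  change boundary R H.V k (chainMap R f.toFun k c) = 0
  rw [boundary_chainMap, LinearMap.mem_ker.mp h2, map_zero]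

theorem pathBoundaries_le_comap (k : ℕ) :
    G.pathBoundaries R k ≤ (H.pathBoundaries R k).comap (chainMap R f.toFun k) := by
  rintro _ ⟨c, hc, rfl⟩
  exact ⟨chainMap R f.toFun (k + 1) c, invariantChains_le_comap R f _ hc,
    boundary_chainMap R f.toFun (k + 1) c⟩

/-- The map on path homology induced by a map of directed graphs. -/
noncomputable def pathHomologyMap (k : ℕ) : G.PathHomology R k →ₗ[R] H.PathHomology R k :=
  subQuotMap (chainMap R f.toFun k) (pathCycles_le_comap R f k) (pathBoundaries_le_comap R f k)

end Functoriality

/-- The maps of directed graphs inducing isomorphisms on bigraded path homology. -/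
def bigradedPathHomologyIsos (R : Type w) [CommRing R] : MorphismProperty DirGraph.{u} :=
  fun _ _ f => ∀ (k : ℕ) (l : ℤ), Function.Bijective (bigradedPathHomologyMap R f k l)

/-- The maps of directed graphs inducing isomorphisms on path homology. -/
def pathHomologyIsos (R : Type w) [CommRing R] : MorphismProperty DirGraph.{u} :=
  fun _ _ f => ∀ k : ℕ, Function.Bijective (pathHomologyMap R f k)

end DirGraph

-- Tuples are replaced by lists, where the differential obeys ∂(x :: l) = l - x·∂l and identities
-- follow by induction. For a set `A` of vertices that no outside vertex can reach, a list of finite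
-- length either lies in `A` or ends outside `A`; the lists ending outside `A` therefore form a
-- basis of the relative complex, and `A = ∅` gives the full complex. The second page is handled
-- through elements (`E2Iso`, `E2Acyclic`), which avoids constructing spectral sequences.
--
-- Relative criterion. In a list ending outside `A`, only the deletion of the last entry can give a
-- list inside `A`, and this lowers the length. Hence on the associated graded complex the relative
-- part splits off, the first pages form a short exact sequence, and a cofibration is a weak
-- equivalence exactly when the second page of its relative complex vanishes
-- (`IsFilteredExtension.e2Iso_iff`, `cofibrations.e2Iso_iff`).
--
-- Excision. The projection π makes inserting π x before the first outside entry x free of length,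
-- as soon as some entry of `A` precedes it. Modulo lower filtration this insertion contracts the
-- "matched" lists (`matchedFilt_contractible`). What remains are the lists outside `A` and the
-- lists (π x, x, ...) continuing outside `A`, and a pushout changes neither these nor their
-- lengths. Vanishing of the relative second page thus passes to the pushout
-- (`E2Acyclic.of_contractible`, `IsRelativeIso.e2Acyclic`), so acyclic cofibrations are stable
-- under pushout.
--
-- Cylinder. If two maps differ vertexwise by at most an edge, the prism operator is a homotopy
-- raising the filtration by one, which is invisible on the second page. The cylinder is the box
-- product with the zigzag 0 → 2 ← 3 → 4 ← 1: its ends are sources, level 2 is reached only from 0,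
-- level 4 only from 1, and level 3 from neither, so the ends form a cofibration; the zigzag
-- contracts onto level 3.
--
-- The remaining axioms. Colimits are computed on vertices. A chain involves finitely many vertices,
-- so cycles and primitives over the colimit of a chain of isometric inclusions already live at some
-- stage; this gives the transfinite axioms. Two-out-of-six is formal.
--
-- Path homology. A regular k-tuple has length at least k, with equality exactly for edge paths, so
-- path homology is the diagonal of bigraded path homology.

universe v' u'

/-! ### Chains on lists -/

namespace DirGraph

section ListChains

variable (R : Type w) [CommRing R] {V V' V'' : Type u}

/-- Consecutive entries of the list are distinct. -/
def RegList (l : List V) : Prop := l.IsChain (· ≠ ·)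

open Classical in
/-- The generator given by a list, or zero if the list is not regular. -/
noncomputable def lgen (l : List V) : List V →₀ R :=
  if RegList l then Finsupp.single l 1 else 0

theorem lgen_of {l : List V} (h : RegList l) : lgen R l = Finsupp.single l 1 := by
  simp [lgen, h]

theorem lgen_of_not {l : List V} (h : ¬ RegList l) : lgen R l = 0 := by
  simp [lgen, h]

theorem regList_cons_cons {x y : V} {l : List V} :
    RegList (x :: y :: l) ↔ x ≠ y ∧ RegList (y :: l) := List.isChain_cons_cons

theorem RegList.tail {x : V} {l : List V} (h : RegList (x :: l)) : RegList l :=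
  List.IsChain.tail h

theorem RegList.of_map {f : V → V'} {l : List V} (h : RegList (l.map f)) : RegList l := by
  induction l with
  | nil => exact List.isChain_nil
  | cons x l ih =>
    cases l with
    | nil => exact List.isChain_singleton _
    | cons y l =>
      rw [List.map_cons, List.map_cons, regList_cons_cons] at h
      exact regList_cons_cons.2 ⟨fun e => h.1 (congrArg f e), ih h.2⟩

/-- A list that is not regular but whose tail is regular starts with a repetition. -/
theorem not_regList_cons {x : V} {l : List V} (h : ¬ RegList (x :: l)) :
    ¬ RegList l ∨ ∃ l', l = x :: l' := by
  cases l with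
  | nil => exact absurd (List.isChain_singleton _) h
  | cons y l =>
    rw [regList_cons_cons] at h
    by_cases e : x = y
    · exact Or.inr ⟨l, by rw [e]⟩
    · exact Or.inl fun h' => h ⟨e, h'⟩

variable {R} in
/-- Linear extension of a function on lists. -/
noncomputable def lext {M : Type*} [AddCommGroup M] [Module R M] (L : List V → M) :
    (List V →₀ R) →ₗ[R] M := Finsupp.linearCombination R L

section

variable {R} {M : Type*} [AddCommGroup M] [Module R M]

@[simp]
theorem lext_single (L : List V → M) (l : List V) (r : R) :
    lext L (Finsupp.single l r) = r • L l := by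
  simp [lext]

/-- This lets operators defined by recursion on all lists be evaluated on `lgen` without asking
whether the list is regular; each operator below only needs a check that it kills non-regular lists.
-/
theorem lext_lgen {L : List V → M} (hL : ∀ l, ¬ RegList l → L l = 0) (l : List V) :
    lext L (lgen R l) = L l := by
  by_cases h : RegList l
  · rw [lgen_of R h, lext_single, one_smul]
  · rw [lgen_of_not R h, map_zero, hL l h]

theorem lext_mem {L : List V → M} {T : Set (List V)} {U : Submodule R M} (h : ∀ l ∈ T, L l ∈ U)
    {c : List V →₀ R} (hc : c ∈ Finsupp.supported R R T) : lext L c ∈ U := by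
  rw [lext, Finsupp.linearCombination_apply]
  exact Submodule.sum_mem _ fun l hl => U.smul_mem _ (h l (hc hl))

/-- Two linear maps that agree on single lists are equal. -/
theorem list_hom_ext {f g : (List V →₀ R) →ₗ[R] M}
    (h : ∀ l, f (Finsupp.single l 1) = g (Finsupp.single l 1)) : f = g := by
  ext l
  exact h l

theorem mem_of_single_mem {f : (List V →₀ R) →ₗ[R] M} {T : Set (List V)} {U : Submodule R M}
    (h : ∀ l ∈ T, f (Finsupp.single l 1) ∈ U)
    {c : List V →₀ R} (hc : c ∈ Finsupp.supported R R T) : f c ∈ U := by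
  have e : f = lext fun l => f (Finsupp.single l 1) := list_hom_ext fun l => by simp
  rw [e]
  exact lext_mem h hc

end

variable {R} in
theorem lgen_mem {T : Set (List V)} {l : List V} (h : RegList l → l ∈ T) :
    lgen R l ∈ Finsupp.supported R R T := by
  by_cases h' : RegList l
  · rw [lgen_of R h']
    exact Finsupp.single_mem_supported R _ (h h')
  · rw [lgen_of_not R h']
    exact zero_mem _

/-- Replace non-regular lists by zero. -/
noncomputable def normalize : (List V →₀ R) →ₗ[R] (List V →₀ R) := lext (lgen R)

/-- Add a vertex at the front. -/
noncomputable def consMap (x : V) : (List V →₀ R) →ₗ[R] (List V →₀ R) :=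
  lext fun l => lgen R (x :: l)

theorem normalize_lgen (l : List V) : normalize R (lgen R l) = lgen R l :=
  lext_lgen (fun _ h => lgen_of_not R h) l

theorem consMap_lgen (x : V) (l : List V) : consMap R x (lgen R l) = lgen R (x :: l) :=
  lext_lgen (fun _ h => lgen_of_not R fun h' => h h'.tail) l

@[simp]
theorem consMap_single (x : V) (l : List V) :
    consMap R x (Finsupp.single l 1) = lgen R (x :: l) := by
  simp [consMap]

@[simp]
theorem normalize_single (l : List V) :
    normalize R (Finsupp.single l 1) = lgen R l := by
  simp [normalize]

theorem consMap_consMap_self (x : V) (c : List V →₀ R) : consMap R x (consMap R x c) = 0 := by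
  have : consMap R x ∘ₗ consMap R x = 0 := list_hom_ext fun l => by
    rw [LinearMap.comp_apply, consMap_single, consMap_lgen, lgen_of_not]
    · rfl
    · exact fun h => (regList_cons_cons.1 h).1 rfl
  exact LinearMap.congr_fun this c

theorem normalize_consMap (x : V) (c : List V →₀ R) :
    normalize R (consMap R x c) = consMap R x c := by
  have : normalize R ∘ₗ consMap R x = consMap R x := list_hom_ext fun l => by
    rw [LinearMap.comp_apply, consMap_single, normalize_lgen]
  exact LinearMap.congr_fun this c

variable {R} in
theorem consMap_mem {x : V} {T : Set (List V)} {c : List V →₀ R}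
    (hc : c ∈ Finsupp.supported R R {l | RegList (x :: l) → x :: l ∈ T}) :
    consMap R x c ∈ Finsupp.supported R R T :=
  lext_mem (fun _ hl => lgen_mem hl) hc

/-- The alternating sum of the faces of a list, including the empty list as a face of lists of
length one. -/
noncomputable def faces : List V → (List V →₀ R)
  | [] => 0
  | x :: l => lgen R l - consMap R x (faces l)

/-- Deleting either of two equal neighbours gives the same list with opposite signs, and every other
face still contains the repetition. -/
theorem faces_of_not {l : List V} (h : ¬ RegList l) : faces R l = 0 := by
  induction l with
  | nil => rfl
  | cons x l ih =>
    rcases not_regList_cons h with h' | ⟨l', rfl⟩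
    · rw [faces, ih h', lgen_of_not R h', map_zero, sub_zero]
    · rw [faces, faces, map_sub, consMap_consMap_self, consMap_lgen, sub_zero, sub_self]

/-- The augmented differential on list chains. -/
noncomputable def dd : (List V →₀ R) →ₗ[R] (List V →₀ R) := lext (faces R)

@[simp]
theorem dd_single (l : List V) : dd R (Finsupp.single l 1) = faces R l := by
  simp [dd]

theorem dd_lgen (l : List V) : dd R (lgen R l) = faces R l :=
  lext_lgen (fun _ h => faces_of_not R h) l

/-- Prefixing a vertex is a contraction of the augmented complex. `normalize` appears because `c`
may contain non-regular lists, which prefixing discards. -/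
theorem dd_consMap (x : V) (c : List V →₀ R) :
    dd R (consMap R x c) = normalize R c - consMap R x (dd R c) := by
  have : dd R ∘ₗ consMap R x = normalize R - consMap R x ∘ₗ dd R := list_hom_ext fun l => by
    simp [dd_lgen, faces]
  exact LinearMap.congr_fun this c

theorem normalize_faces (l : List V) : normalize R (faces R l) = faces R l := by
  cases l with
  | nil => simp [faces]
  | cons x l => rw [faces, map_sub, normalize_lgen, normalize_consMap]

theorem dd_faces (l : List V) : dd R (faces R l) = 0 := by
  induction l with
  | nil => simp [faces]
  | cons x l ih =>
    rw [faces, map_sub, dd_lgen, dd_consMap, normalize_faces, ih]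
    simp

theorem dd_dd (c : List V →₀ R) : dd R (dd R c) = 0 := by
  have : dd R ∘ₗ dd R = (0 : (List V →₀ R) →ₗ[R] (List V →₀ R)) := list_hom_ext fun l => by
    simp [dd_faces]
  exact LinearMap.congr_fun this c

/-- The map on list chains induced by a function. -/
noncomputable def lmap (f : V → V') : (List V →₀ R) →ₗ[R] (List V' →₀ R) :=
  lext fun l => lgen R (l.map f)

@[simp]
theorem lmap_single (f : V → V') (l : List V) :
    lmap R f (Finsupp.single l 1) = lgen R (l.map f) := by
  simp [lmap]

theorem lmap_lgen (f : V → V') (l : List V) : lmap R f (lgen R l) = lgen R (l.map f) :=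
  lext_lgen (fun _ h => lgen_of_not R fun h' => h h'.of_map) l

theorem lmap_consMap (f : V → V') (x : V) (c : List V →₀ R) :
    lmap R f (consMap R x c) = consMap R (f x) (lmap R f c) := by
  have : lmap R f ∘ₗ consMap R x = consMap R (f x) ∘ₗ lmap R f := list_hom_ext fun l => by
    simp [lmap_lgen, consMap_lgen]
  exact LinearMap.congr_fun this c

theorem lmap_faces (f : V → V') (l : List V) : lmap R f (faces R l) = faces R (l.map f) := by
  induction l with
  | nil => simp [faces]
  | cons x l ih => rw [List.map_cons, faces, faces, map_sub, lmap_lgen, lmap_consMap, ih]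

theorem dd_lmap (f : V → V') (c : List V →₀ R) : dd R (lmap R f c) = lmap R f (dd R c) := by
  have : dd R ∘ₗ lmap R f = lmap R f ∘ₗ dd R := list_hom_ext fun l => by
    simp [lmap_faces, dd_lgen]
  exact LinearMap.congr_fun this c

theorem lmap_lmap (f : V → V') (g : V' → V'') (c : List V →₀ R) :
    lmap R g (lmap R f c) = lmap R (fun x => g (f x)) c := by
  have : lmap R g ∘ₗ lmap R f = lmap R (fun x => g (f x)) := list_hom_ext fun l => by
    simp [lmap_lgen, Function.comp_def]
  exact LinearMap.congr_fun this c

/-- The list is nonempty and its last entry is not in `A`. -/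
def EndsOutside (A : Set V) : List V → Prop
  | [] => False
  | [x] => x ∉ A
  | _ :: y :: l => EndsOutside A (y :: l)

theorem endsOutside_cons {A : Set V} {x : V} {l : List V} (hl : l ≠ []) :
    EndsOutside A (x :: l) ↔ EndsOutside A l := by
  cases l with
  | nil => exact absurd rfl hl
  | cons y l => rfl

theorem endsOutside_empty {l : List V} : EndsOutside ∅ l ↔ l ≠ [] := by
  induction l with
  | nil => simp [EndsOutside]
  | cons x l ih =>
    cases l with
    | nil => simp [EndsOutside]
    | cons y l => simpa [EndsOutside] using ih

theorem EndsOutside.ne_nil {A : Set V} {l : List V} (h : EndsOutside A l) : l ≠ [] := by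
  rintro rfl
  exact h

theorem EndsOutside.exists_notMem {A : Set V} {l : List V} (h : EndsOutside A l) :
    ∃ x ∈ l, x ∉ A := by
  induction l with
  | nil => exact h.elim
  | cons x l ih =>
    cases l with
    | nil => exact ⟨x, by simp, h⟩
    | cons y l =>
      obtain ⟨z, hz, hz'⟩ := ih h
      exact ⟨z, List.mem_cons_of_mem _ hz, hz'⟩

theorem endsOutside_of_forall {A : Set V} {l : List V} (hl : l ≠ []) (h : ∀ x ∈ l, x ∉ A) :
    EndsOutside A l := by
  induction l with
  | nil => exact hl rfl
  | cons x l ih =>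
    cases l with
    | nil => exact h x (by simp)
    | cons y l => exact ih (by simp) fun z hz => h z (List.mem_cons_of_mem _ hz)

theorem endsOutside_map {f : V → V'} {A : Set V} {A' : Set V'} (h : ∀ x, f x ∈ A' ↔ x ∈ A)
    (l : List V) : EndsOutside A' (l.map f) ↔ EndsOutside A l := by
  induction l with
  | nil => simp [EndsOutside]
  | cons x l ih =>
    cases l with
    | nil => simp [EndsOutside, h]
    | cons y l => simpa [EndsOutside] using ih

open Classical in
/-- The projection onto the lists that end outside `A`. -/
noncomputable def outPart (A : Set V) : (List V →₀ R) →ₗ[R] (List V →₀ R) :=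
  lext fun l => if EndsOutside A l then Finsupp.single l 1 else 0

theorem outPart_single_of {A : Set V} {l : List V} (h : EndsOutside A l) :
    outPart R A (Finsupp.single l 1) = Finsupp.single l 1 := by
  simp [outPart, h]

theorem outPart_single_of_not {A : Set V} {l : List V} (h : ¬ EndsOutside A l) :
    outPart R A (Finsupp.single l 1) = 0 := by
  simp [outPart, h]

variable {R} in
theorem outPart_mem {A : Set V} {T T' : Set (List V)} {c : List V →₀ R}
    (hc : c ∈ Finsupp.supported R R T) (h : ∀ l ∈ T, EndsOutside A l → l ∈ T') :
    outPart R A c ∈ Finsupp.supported R R T' := by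
  refine mem_of_single_mem (fun l hl => ?_) hc
  by_cases h' : EndsOutside A l
  · rw [outPart_single_of R h']
    exact Finsupp.single_mem_supported R _ (h l hl h')
  · rw [outPart_single_of_not R h']
    exact zero_mem _

variable {R} in
theorem outPart_of_mem {A : Set V} {T : Set (List V)} {c : List V →₀ R}
    (hc : c ∈ Finsupp.supported R R T) (h : ∀ l ∈ T, EndsOutside A l) :
    outPart R A c = c := by
  rw [← sub_eq_zero]
  have : (outPart R A - LinearMap.id : (List V →₀ R) →ₗ[R] (List V →₀ R)) c ∈ (⊥ : Submodule R (List V →₀ R)) :=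
    mem_of_single_mem (fun l hl => by simp [outPart_single_of R (h l hl)]) hc
  simpa using this

variable {R} in
theorem sub_outPart_mem {A : Set V} {T T' : Set (List V)} {c : List V →₀ R}
    (hc : c ∈ Finsupp.supported R R T) (h : ∀ l ∈ T, ¬ EndsOutside A l → l ∈ T') :
    c - outPart R A c ∈ Finsupp.supported R R T' := by
  have : (LinearMap.id - outPart R A : (List V →₀ R) →ₗ[R] (List V →₀ R)) c ∈ Finsupp.supported R R T' := by
    refine mem_of_single_mem (fun l hl => ?_) hc
    by_cases h' : EndsOutside A l
    · simp [outPart_single_of R h']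
    · simpa [outPart_single_of_not R h'] using Finsupp.single_mem_supported R (1 : R) (h l hl h')
  simpa using this

variable {R} in
theorem outPart_eq_zero {A : Set V} {T : Set (List V)} {c : List V →₀ R}
    (hc : c ∈ Finsupp.supported R R T) (h : ∀ l ∈ T, ¬ EndsOutside A l) :
    outPart R A c = 0 := by
  have : outPart R A c ∈ (⊥ : Submodule R (List V →₀ R)) :=
    mem_of_single_mem (fun l hl => by simp [outPart_single_of_not R (h l hl)]) hc
  simpa using this

theorem lmap_outPart {f : V → V'} {A : Set V} {A' : Set V'} (h : ∀ x, f x ∈ A' ↔ x ∈ A)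
    (c : List V →₀ R) : lmap R f (outPart R A c) = outPart R A' (lmap R f c) := by
  have : lmap R f ∘ₗ outPart R A = outPart R A' ∘ₗ lmap R f := list_hom_ext fun l => by
    by_cases h' : EndsOutside A l
    · rw [LinearMap.comp_apply, LinearMap.comp_apply, outPart_single_of R h', lmap_single]
      refine (outPart_of_mem (T := {l.map f}) (lgen_mem fun _ => rfl) ?_).symm
      rintro _ rfl
      exact (endsOutside_map h l).2 h'
    · rw [LinearMap.comp_apply, LinearMap.comp_apply, outPart_single_of_not R h', lmap_single,
        map_zero]
      refine (outPart_eq_zero (T := {l.map f}) (lgen_mem fun _ => rfl) ?_).symm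
      rintro _ rfl
      exact fun h'' => h' ((endsOutside_map h l).1 h'')
  exact LinearMap.congr_fun this c

/-- The differential of the complex of lists ending outside `A`. -/
noncomputable def bdry (A : Set V) : (List V →₀ R) →ₗ[R] (List V →₀ R) := outPart R A ∘ₗ dd R

theorem bdry_apply (A : Set V) (c : List V →₀ R) : bdry R A c = outPart R A (dd R c) := rfl

theorem bdry_lmap {f : V → V'} {A : Set V} {A' : Set V'} (h : ∀ x, f x ∈ A' ↔ x ∈ A)
    (c : List V →₀ R) : bdry R A' (lmap R f c) = lmap R f (bdry R A c) := by
  rw [bdry_apply, bdry_apply, dd_lmap, lmap_outPart R h]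

end ListChains

end DirGraph

/-! ### Distances and lengths -/

namespace DirGraph

section Dist

variable {G H : DirGraph.{u}}

theorem dist_le {n : ℕ} {x y : G.V} (h : G.HasPath n x y) : G.dist x y ≤ n :=
  iInf₂_le n h

theorem exists_path_of_dist_ne_top {x y : G.V} (h : G.dist x y ≠ ⊤) :
    ∃ n : ℕ, G.HasPath n x y ∧ G.dist x y = n := by
  by_cases hr : ∃ n, G.HasPath n x y
  · classical
    refine ⟨Nat.find hr, Nat.find_spec hr, le_antisymm (dist_le (Nat.find_spec hr)) ?_⟩
    refine le_iInf₂ fun n hn => ?_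
    exact_mod_cast Nat.find_min' hr hn
  · exfalso
    apply h
    simp only [dist, iInf_eq_top]
    exact fun n hn => absurd ⟨n, hn⟩ hr

theorem reaches_iff {x y : G.V} : G.Reaches x y ↔ G.dist x y ≠ ⊤ := by
  constructor
  · rintro ⟨n, hn⟩
    exact ne_top_of_le_ne_top (ENat.natCast_ne_top n) (dist_le hn)
  · intro h
    obtain ⟨n, hn, -⟩ := exists_path_of_dist_ne_top h
    exact ⟨n, hn⟩

/-- To bound the distance from below it suffices to bound the number of edges in paths. -/
theorem le_dist {x y : G.V} {c : ℕ∞} (h : ∀ n : ℕ, G.HasPath n x y → c ≤ n) : c ≤ G.dist x y :=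
  le_iInf₂ h

@[simp]
theorem dist_self (x : G.V) : G.dist x x = 0 :=
  le_antisymm (dist_le (n := 0) rfl) bot_le

theorem HasPath.trans {m n : ℕ} {x y z : G.V} (h : G.HasPath m x y) (h' : G.HasPath n y z) :
    G.HasPath (m + n) x z := by
  induction m generalizing x with
  | zero =>
    have : x = y := h
    subst this
    simpa using h'
  | succ m ih =>
    obtain ⟨t, ht, hp⟩ := h
    rw [Nat.add_right_comm]
    exact ⟨t, ht, ih hp⟩

theorem dist_triangle (x y z : G.V) : G.dist x z ≤ G.dist x y + G.dist y z := by
  by_cases h1 : G.dist x y = ⊤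
  · simp [h1]
  by_cases h2 : G.dist y z = ⊤
  · simp [h2]
  obtain ⟨m, hm, em⟩ := exists_path_of_dist_ne_top h1
  obtain ⟨n, hn, en⟩ := exists_path_of_dist_ne_top h2
  rw [em, en]
  exact_mod_cast dist_le (hm.trans hn)

theorem one_le_dist {x y : G.V} (h : x ≠ y) : 1 ≤ G.dist x y := by
  refine le_dist fun n hn => ?_
  cases n with
  | zero => exact absurd hn h
  | succ n => exact_mod_cast Nat.succ_pos n

theorem dist_le_one_of_adj {x y : G.V} (h : G.Adj x y) : G.dist x y ≤ 1 := by
  exact_mod_cast dist_le (n := 1) ⟨y, h, rfl⟩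

theorem dist_le_one {x y : G.V} (h : x = y ∨ G.Adj x y) : G.dist x y ≤ 1 := by
  rcases h with rfl | h
  · simp
  · exact dist_le_one_of_adj h

/-- The sum of the distances between consecutive entries of a list. -/
noncomputable def len (G : DirGraph.{u}) : List G.V → ℕ∞
  | [] => 0
  | [_] => 0
  | x :: y :: l => G.dist x y + G.len (y :: l)

theorem len_cons_cons (x y : G.V) (l : List G.V) :
    G.len (x :: y :: l) = G.dist x y + G.len (y :: l) := rfl

theorem len_le_len_cons (x : G.V) (l : List G.V) : G.len l ≤ G.len (x :: l) := by
  cases l with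
  | nil => exact le_rfl
  | cons y l => exact le_add_self

theorem len_cons_le (x y : G.V) (l : List G.V) :
    G.len (x :: l) ≤ G.dist x y + G.len (y :: l) := by
  cases l with
  | nil => exact bot_le
  | cons z l =>
    rw [len_cons_cons, len_cons_cons, ← add_assoc]
    gcongr
    exact dist_triangle x y z

theorem len_map_le (f : G ⟶ H) (l : List G.V) : H.len (l.map f.toFun) ≤ G.len l := by
  induction l with
  | nil => exact le_rfl
  | cons x l ih =>
    cases l with
    | nil => exact le_rfl
    | cons y l => exact add_le_add (dist_map_le f x y) ih

/-- The list has length at most `p`. -/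
def LenLE (G : DirGraph.{u}) (l : List G.V) (p : ℤ) : Prop :=
  ∃ n : ℕ, G.len l ≤ n ∧ (n : ℤ) ≤ p

theorem LenLE.of_le {l : List G.V} {l' : List H.V} {p : ℤ} (h : G.LenLE l p)
    (hle : H.len l' ≤ G.len l) : H.LenLE l' p := by
  obtain ⟨n, hn, hp⟩ := h
  exact ⟨n, hle.trans hn, hp⟩

theorem LenLE.of_add_one_le {l : List G.V} {l' : List H.V} {p : ℤ} (h : G.LenLE l p)
    (hle : H.len l' + 1 ≤ G.len l) : H.LenLE l' (p - 1) := by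
  obtain ⟨n, hn, hp⟩ := h
  have h1 : H.len l' + 1 ≤ n := hle.trans hn
  cases n with
  | zero =>
    have : (1 : ℕ∞) ≤ 0 := le_add_self.trans h1
    simp at this
  | succ n =>
    refine ⟨n, ?_, by push_cast at hp; omega⟩
    push_cast at h1
    exact (ENat.add_le_add_iff_right ENat.one_ne_top).1 h1

theorem LenLE.add_one {l : List G.V} {l' : List H.V} {p : ℤ} (h : G.LenLE l p)
    (hle : H.len l' ≤ G.len l + 1) : H.LenLE l' (p + 1) := by
  obtain ⟨n, hn, hp⟩ := h
  exact ⟨n + 1, hle.trans (by push_cast; gcongr), by push_cast; omega⟩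

theorem LenLE.mono {l : List G.V} {p q : ℤ} (h : G.LenLE l p) (hpq : p ≤ q) : G.LenLE l q := by
  obtain ⟨n, hn, hp⟩ := h
  exact ⟨n, hn, hp.trans hpq⟩

theorem LenLE.ne_top {l : List G.V} {p : ℤ} (h : G.LenLE l p) : G.len l ≠ ⊤ := by
  obtain ⟨n, hn, -⟩ := h
  exact ne_top_of_le_ne_top (ENat.natCast_ne_top n) hn

/-- Vertices outside `A` do not reach vertices of `A`. -/
def IsClosedBackwards (G : DirGraph.{u}) (A : Set G.V) : Prop :=
  ∀ x y, x ∉ A → y ∈ A → G.dist x y = ⊤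

theorem IsClosedBackwards.forall_notMem {A : Set G.V} (hA : G.IsClosedBackwards A) {x : G.V}
    {l : List G.V} (hl : G.len (x :: l) ≠ ⊤) (hx : x ∉ A) : ∀ y ∈ x :: l, y ∉ A := by
  induction l generalizing x with
  | nil => simpa using hx
  | cons z l ih =>
    rw [len_cons_cons] at hl
    have hz : z ∉ A := fun hz => hl (by rw [hA x z hx hz, top_add])
    intro y hy
    rcases List.mem_cons.1 hy with rfl | hy
    · exact hx
    · exact ih (fun h => hl (by rw [h, add_top])) hz y hy

/-- A list of finite length cannot return to `A` after leaving it. Hence the lists that do not end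
outside `A` span the chains of `A`, and those that do represent the quotient. -/
theorem IsClosedBackwards.forall_mem {A : Set G.V} (hA : G.IsClosedBackwards A)
    {l : List G.V} (hl : G.len l ≠ ⊤) (h : ¬ EndsOutside A l) : ∀ y ∈ l, y ∈ A := by
  induction l with
  | nil => simp
  | cons x l ih =>
    have hx : x ∈ A := by
      by_contra hx
      exact h (endsOutside_of_forall (by simp) (hA.forall_notMem hl hx))
    intro y hy
    rcases List.mem_cons.1 hy with rfl | hy
    · exact hx
    · refine ih (ne_top_of_le_ne_top hl (len_le_len_cons x l)) (fun h' => h ?_) y hy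
      exact (endsOutside_cons h'.ne_nil).2 h'

end Dist

/-! ### The filtered complex of lists ending outside a set -/

section Rel

variable (R : Type w) [CommRing R] (G : DirGraph.{u})

/-- Generators of filtration degree `p`: regular lists with `n` entries that end outside `A` and
have length at most `p`. -/
def relTuples (A : Set G.V) (p n : ℤ) : Set (List G.V) :=
  {l | RegList l ∧ (l.length : ℤ) = n ∧ EndsOutside A l ∧ G.LenLE l p}

/-- The span of the generators in `relTuples`. -/
noncomputable def relFilt (A : Set G.V) (p n : ℤ) : Submodule R (List G.V →₀ R) :=
  Finsupp.supported R R (G.relTuples A p n)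

variable {R G} {A : Set G.V}

theorem relFilt_mono {p q n : ℤ} (h : p ≤ q) : G.relFilt R A p n ≤ G.relFilt R A q n :=
  Finsupp.supported_mono fun _ hl => ⟨hl.1, hl.2.1, hl.2.2.1, hl.2.2.2.mono h⟩

theorem outPart_relFilt {p n : ℤ} {c : List G.V →₀ R} (hc : c ∈ G.relFilt R A p n) :
    outPart R A c = c :=
  outPart_of_mem hc fun _ hl => hl.2.2.1

/-- The faces of a list, after adding a vertex at the front, do not have a bigger length. -/
theorem faces_mem_prefix (y : G.V) (l : List G.V) :
    faces R l ∈ Finsupp.supported R R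
      {m | m.length + 1 = l.length ∧ G.len (y :: m) ≤ G.len (y :: l)} := by
  induction l generalizing y with
  | nil => exact zero_mem _
  | cons x l ih =>
    refine sub_mem (lgen_mem fun _ => ⟨rfl, len_cons_le y x l⟩) (consMap_mem ?_)
    refine Finsupp.supported_mono (fun m hm _ => ?_) (ih x)
    refine ⟨by simpa using hm.1, ?_⟩
    rw [len_cons_cons, len_cons_cons]
    gcongr
    exact hm.2

theorem faces_mem (l : List G.V) :
    faces R l ∈ Finsupp.supported R R
      {m | RegList m ∧ m.length + 1 = l.length ∧ G.len m ≤ G.len l} := by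
  cases l with
  | nil => exact zero_mem _
  | cons x l =>
    refine sub_mem (lgen_mem fun h => ⟨h, rfl, len_le_len_cons x l⟩) (consMap_mem ?_)
    exact Finsupp.supported_mono (fun m hm hreg => ⟨hreg, by simpa using hm.1, hm.2⟩)
      (faces_mem_prefix x l)

theorem bdry_mem {p n : ℤ} {c : List G.V →₀ R} (hc : c ∈ G.relFilt R A p n) :
    bdry R A c ∈ G.relFilt R A p (n - 1) := by
  refine outPart_mem (T := {m | RegList m ∧ (m.length : ℤ) = n - 1 ∧ G.LenLE m p}) ?_
    fun m hm h => ⟨hm.1, hm.2.1, h, hm.2.2⟩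
  refine mem_of_single_mem (fun l hl => ?_) hc
  rw [dd_single]
  refine Finsupp.supported_mono (fun m hm => ?_) (faces_mem l)
  refine ⟨hm.1, ?_, hl.2.2.2.of_le hm.2.2⟩
  have := hm.2.1
  have := hl.2.1
  omega

/-- The faces of a list ending outside `A` that do not end outside `A` have smaller length. -/
theorem faces_mem_prefix_drop (y : G.V) (l : List G.V) (hreg : RegList (y :: l))
    (hl : EndsOutside A l) :
    faces R l ∈ Finsupp.supported R R
      {m | EndsOutside A m ∨ G.len (y :: m) + 1 ≤ G.len (y :: l)} := by
  induction l generalizing y with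
  | nil => exact zero_mem _
  | cons x l ih =>
    have hyx : y ≠ x := (regList_cons_cons.1 hreg).1
    cases l with
    -- Here the last entry is deleted, the only deletion that can leave a list not ending outside
    -- `A`. The length drops by `G.dist y x`, which is at least one.
    | nil =>
      simp only [faces, map_zero, sub_zero]
      refine lgen_mem fun _ => Or.inr ?_
      rw [len_cons_cons]
      simpa [len] using one_le_dist hyx
    | cons z l =>
      refine sub_mem (lgen_mem fun _ => Or.inl hl) (consMap_mem ?_)
      refine Finsupp.supported_mono (fun m hm _ => ?_) (ih x hreg.tail hl)
      rcases hm with hm | hm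
      · exact Or.inl ((endsOutside_cons hm.ne_nil).2 hm)
      · refine Or.inr ?_
        rw [len_cons_cons, len_cons_cons y, add_assoc]
        gcongr

/-- The source of the splitting on the associated graded complex. The empty list is listed
separately: it is a face of a one-entry list, which has no length to lose. -/
theorem dd_mem_drop {p n : ℤ} {c : List G.V →₀ R} (hc : c ∈ G.relFilt R A p n) :
    dd R c ∈ Finsupp.supported R R {m | RegList m ∧ (m.length : ℤ) = n - 1 ∧ G.LenLE m p ∧
      (EndsOutside A m ∨ m = [] ∨ G.LenLE m (p - 1))} := by
  refine mem_of_single_mem (fun l hl => ?_) hc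
  rw [dd_single]
  have h1 := faces_mem (R := R) l
  have h2 : faces R l ∈ Finsupp.supported R R
      {m | EndsOutside A m ∨ m = [] ∨ G.len m + 1 ≤ G.len l} := by
    obtain ⟨hreg, -, hout, -⟩ := hl
    cases l with
    | nil => exact zero_mem _
    | cons x l =>
      rcases eq_or_ne l [] with rfl | hne
      · exact sub_mem (lgen_mem fun _ => Or.inr (Or.inl rfl)) (by simp [faces])
      · have hout' := (endsOutside_cons hne).1 hout
        refine sub_mem (lgen_mem fun _ => Or.inl hout') (consMap_mem ?_)
        refine Finsupp.supported_mono (fun m hm _ => ?_) (faces_mem_prefix_drop x l hreg hout')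
        rcases hm with hm | hm
        · exact Or.inl ((endsOutside_cons hm.ne_nil).2 hm)
        · exact Or.inr (Or.inr hm)
  intro m hm
  obtain ⟨h3, h4, h5⟩ := h1 hm
  refine ⟨h3, ?_, hl.2.2.2.of_le h5, (h2 hm).imp_right (Or.imp_right hl.2.2.2.of_add_one_le)⟩
  have := hl.2.1
  omega

/-- The differential squares to zero. -/
theorem bdry_bdry (hA : G.IsClosedBackwards A) {p n : ℤ} {c : List G.V →₀ R}
    (hc : c ∈ G.relFilt R A p n) : bdry R A (bdry R A c) = 0 := by
  -- The discarded part of `dd c` consists of lists inside `A`; all their faces stay inside `A` and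
  -- are discarded again, so `dd ∘ dd = 0` descends.
  have h1 : dd R c - outPart R A (dd R c) ∈ Finsupp.supported R R {m | ∀ x ∈ m, x ∈ A} :=
    sub_outPart_mem (dd_mem_drop hc) fun m hm h => hA.forall_mem hm.2.2.1.ne_top h
  have h2 : dd R (dd R c - outPart R A (dd R c)) ∈
      Finsupp.supported R R {m | ∀ x ∈ m, x ∈ A} := by
    refine mem_of_single_mem (fun l hl => ?_) h1
    rw [dd_single]
    clear h1
    induction l with
    | nil => exact zero_mem _
    | cons x l ih =>
      have hl' : ∀ y ∈ l, y ∈ A := fun y hy => hl y (List.mem_cons_of_mem _ hy)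
      refine sub_mem (lgen_mem fun _ => hl') (consMap_mem ?_)
      refine Finsupp.supported_mono (fun m hm _ y hy => ?_) (ih hl')
      rcases List.mem_cons.1 hy with rfl | hy
      · exact hl _ (by simp)
      · exact hm y hy
  have h3 := outPart_eq_zero (A := A) h2 fun l hl h => by
    obtain ⟨x, hx, hx'⟩ := h.exists_notMem
    exact hx' (hl x hx)
  rw [map_sub, dd_dd, zero_sub, map_neg, neg_eq_zero] at h3
  exact h3

theorem lmap_mem {H : DirGraph.{u}} (f : G ⟶ H) {A' : Set H.V} (h : ∀ x, f.toFun x ∈ A' ↔ x ∈ A)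
    {p n : ℤ} {c : List G.V →₀ R} (hc : c ∈ G.relFilt R A p n) :
    lmap R f.toFun c ∈ H.relFilt R A' p n := by
  refine lext_mem (fun l hl => lgen_mem fun hreg => ?_) hc
  exact ⟨hreg, by simpa using hl.2.1, (endsOutside_map h l).2 hl.2.2.1,
    hl.2.2.2.of_le (len_map_le f l)⟩

end Rel

end DirGraph

/-! ### The second page of the spectral sequence of a filtered complex, in terms of elements -/

section FilteredComplexes

variable {R : Type w} [CommRing R] {M N : Type*} [AddCommGroup M] [Module R M]
  [AddCommGroup N] [Module R N]

/-- The second page of the spectral sequence of a filtered complex vanishes. -/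
def E2Acyclic (d : M →ₗ[R] M) (F : ℤ → ℤ → Submodule R M) : Prop :=
  ∀ p n, ∀ s ∈ F p n, d s ∈ F (p - 2) (n - 1) →
    ∃ v ∈ F (p + 1) (n + 1), s - d v ∈ F (p - 1) n

/-- A map of filtered complexes is injective on the second page in total degree `n`. -/
def E2Injective (d : M →ₗ[R] M) (F : ℤ → ℤ → Submodule R M) (d' : N →ₗ[R] N)
    (F' : ℤ → ℤ → Submodule R N) (f : M →ₗ[R] N) (p n : ℤ) : Prop :=
  ∀ a ∈ F p n, d a ∈ F (p - 2) (n - 1) →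
    ∀ v ∈ F' (p + 1) (n + 1), f a - d' v ∈ F' (p - 1) n →
      ∃ b ∈ F (p + 1) (n + 1), a - d b ∈ F (p - 1) n

/-- A map of filtered complexes is surjective on the second page in total degree `n`. -/
def E2Surjective (d : M →ₗ[R] M) (F : ℤ → ℤ → Submodule R M) (d' : N →ₗ[R] N)
    (F' : ℤ → ℤ → Submodule R N) (f : M →ₗ[R] N) (p n : ℤ) : Prop :=
  ∀ x ∈ F' p n, d' x ∈ F' (p - 2) (n - 1) →
    ∃ a ∈ F p n, d a ∈ F (p - 2) (n - 1) ∧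
      ∃ v ∈ F' (p + 1) (n + 1), x - f a - d' v ∈ F' (p - 1) n

/-- A map of filtered complexes is bijective on the second page. -/
def E2Iso (d : M →ₗ[R] M) (F : ℤ → ℤ → Submodule R M) (d' : N →ₗ[R] N)
    (F' : ℤ → ℤ → Submodule R N) (f : M →ₗ[R] N) : Prop :=
  ∀ p n, E2Injective d F d' F' f p n ∧ E2Surjective d F d' F' f p n

/-- An inclusion of filtered complexes with a complement `S`, such that the component of the
differential that leads from `S` to the subcomplex lowers the filtration. -/
structure IsFilteredExtension (d : M →ₗ[R] M) (F : ℤ → ℤ → Submodule R M) (d' : N →ₗ[R] N)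
    (F' S : ℤ → ℤ → Submodule R N) (f : M →ₗ[R] N) (q : N →ₗ[R] N) : Prop where
  d_mem : ∀ p n, ∀ a ∈ F p n, d a ∈ F p (n - 1)
  f_mem : ∀ p n, ∀ a ∈ F p n, f a ∈ F' p n
  f_refl : ∀ p p' n, ∀ a ∈ F p n, f a ∈ F' p' n → a ∈ F p' n
  f_d : ∀ a, f (d a) = d' (f a)
  d_d : ∀ x, d' (d' x) = 0
  le : ∀ p n, S p n ≤ F' p n
  mono : ∀ p p' n, p ≤ p' → F p n ≤ F p' n
  q_f : ∀ p n, ∀ a ∈ F p n, q (f a) = 0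
  q_eq : ∀ p n, ∀ s ∈ S p n, q s = s
  q_mem : ∀ p n, ∀ x ∈ F' p n, q x ∈ S p n
  decomp : ∀ p n, ∀ x ∈ F' p n, ∃ a ∈ F p n, x = f a + q x
  drop : ∀ p n, ∀ s ∈ S p n, ∃ a ∈ F (p - 1) (n - 1), d' s = f a + q (d' s)

namespace IsFilteredExtension

variable {d : M →ₗ[R] M} {F : ℤ → ℤ → Submodule R M} {d' : N →ₗ[R] N}
    {F' S : ℤ → ℤ → Submodule R N} {f : M →ₗ[R] N} {q : N →ₗ[R] N}

/-- The image of `f` is a subcomplex killed by `q`, so `q ∘ d'` only sees the component in the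
complement. -/
theorem q_d_q (h : IsFilteredExtension d F d' F' S f q) {p n : ℤ} {x : N} (hx : x ∈ F' p n) :
    q (d' (q x)) = q (d' x) := by
  obtain ⟨a, ha, e⟩ := h.decomp p n x hx
  conv_rhs => rw [e, map_add, map_add, ← h.f_d, h.q_f _ _ _ (h.d_mem _ _ _ ha), zero_add]

theorem q_d_d (h : IsFilteredExtension d F d' F' S f q) {p n : ℤ} {s : N} (hs : s ∈ S p n) :
    q (d' (q (d' s))) = 0 := by
  obtain ⟨a, ha, e⟩ := h.drop p n s hs
  have e' : q (d' s) = d' s - f a := by rw [eq_sub_iff_add_eq, add_comm]; exact e.symm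
  rw [e', map_sub, h.d_d, zero_sub, map_neg, ← h.f_d, h.q_f _ _ _ (h.d_mem _ _ _ ha), neg_zero]

/-- A primitive `v` of the relative part `q x` turns `x` into `f (a - b)` up to filtration `p - 1`,
where `f b` is the component of `d' v` in the subcomplex; by `drop`, `b` still has filtration `p`.
-/
theorem surjective_of_acyclic (h : IsFilteredExtension d F d' F' S f q)
    (hS : E2Acyclic (q ∘ₗ d') S) (p n : ℤ) : E2Surjective d F d' F' f p n := by
  intro x hx hdx
  obtain ⟨a, ha, ea⟩ := h.decomp p n x hx
  have hs := h.q_mem p n x hx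
  have hds : q (d' (q x)) ∈ S (p - 2) (n - 1) := by
    rw [h.q_d_q hx]
    exact h.q_mem _ _ _ hdx
  obtain ⟨v, hv, hsv⟩ := hS p n _ hs hds
  rw [LinearMap.comp_apply] at hsv
  obtain ⟨b, hb, eb⟩ := h.drop _ _ v hv
  rw [add_sub_cancel_right, add_sub_cancel_right] at hb
  obtain ⟨c, hc, ec⟩ := h.drop _ _ _ hsv
  rw [show p - 1 - 1 = p - 2 by ring] at hc
  obtain ⟨g, hg, eg⟩ := h.decomp _ _ _ hdx
  have hab := sub_mem ha hb
  have e1 : x - d' v = f (a - b) + (q x - q (d' v)) := by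
    rw [map_sub]
    nth_rewrite 1 [ea]
    nth_rewrite 1 [eb]
    abel
  have e2 : q (d' (q x - q (d' v))) = q (d' x) := by
    rw [map_sub, map_sub, h.q_d_d hv, h.q_d_q hx, sub_zero]
  -- Comparison of two decompositions of `d' x`: the relative components agree by `e2`, so the
  -- components in the subcomplex do. This bounds the filtration of `d (a - b)`, since `g` and `c`
  -- lie in filtration `p - 2`.
  have e3 : f (d (a - b) + c) = f g := by
    have e4 := congrArg d' e1
    rw [map_sub, h.d_d, sub_zero, map_add, ec, e2, ← add_assoc] at e4
    rw [map_add, h.f_d]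
    exact add_right_cancel (e4.symm.trans eg)
  have hdc : d (a - b) + c ∈ F (p - 2) (n - 1) := by
    refine h.f_refl p _ _ _ (add_mem (h.d_mem _ _ _ hab) ?_) ?_
    · exact h.mono _ _ _ (by omega) hc
    · rw [e3]
      exact h.f_mem _ _ _ hg
  refine ⟨a - b, hab, ?_, v, h.le _ _ hv, ?_⟩
  · simpa using sub_mem hdc hc
  · have : x - f (a - b) - d' v = q x - q (d' v) := by
      rw [sub_right_comm, e1]
      abel
    rw [this]
    exact h.le _ _ hsv

/-- The relative part of `v` is a class one filtration step higher. If `w` is a primitive of it and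
`f c` the component of `d' w` in the subcomplex, then `b - c` bounds `a` up to filtration `p - 1`.
-/
theorem injective_of_acyclic (h : IsFilteredExtension d F d' F' S f q)
    (hS : E2Acyclic (q ∘ₗ d') S) (p n : ℤ) : E2Injective d F d' F' f p n := by
  intro a ha _ v hv hav
  obtain ⟨b, hb, eb⟩ := h.decomp _ _ v hv
  have ht := h.q_mem _ _ v hv
  have hdt : q (d' (q v)) ∈ S (p - 1) n := by
    rw [h.q_d_q hv]
    have := neg_mem (h.q_mem _ _ _ hav)
    rwa [map_sub, h.q_f _ _ _ ha, zero_sub, neg_neg] at this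
  obtain ⟨w, hw, htw⟩ := hS (p + 1) (n + 1) _ ht
    (by rw [add_sub_cancel_right, show p + 1 - 2 = p - 1 by ring]; exact hdt)
  rw [LinearMap.comp_apply, add_sub_cancel_right] at htw
  obtain ⟨c, hc, ec⟩ := h.drop _ _ w hw
  rw [add_sub_cancel_right, add_sub_cancel_right] at hc
  obtain ⟨e, he, ee⟩ := h.drop _ _ _ htw
  rw [add_sub_cancel_right] at he
  have e1 : q (d' (q v - q (d' w))) = q (d' (q v)) := by
    rw [map_sub, map_sub, h.q_d_d hw, sub_zero]
  have e2 : d' (q v) = f e + q (d' (q v)) - f (d c) := by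
    rw [e1, map_sub] at ee
    have e3 := congrArg d' ec
    rw [h.d_d, map_add, ← h.f_d] at e3
    rw [← ee, ← sub_eq_zero]
    rw [add_comm] at e3
    simpa [sub_sub, sub_add] using e3.symm
  have e4 : f (a - d (b - c) - e) = (f a - d' v) + q (d' (q v)) := by
    have : d' v = f (d b) + d' (q v) := by
      nth_rewrite 1 [eb]
      rw [map_add, h.f_d]
    rw [this]
    nth_rewrite 1 [e2]
    simp only [map_sub]
    abel
  have hbc := sub_mem hb hc
  refine ⟨b - c, hbc, ?_⟩
  have hd := h.d_mem _ _ _ hbc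
  rw [add_sub_cancel_right] at hd
  have : a - d (b - c) - e ∈ F (p - 1) n := by
    refine h.f_refl (p + 1) _ _ _ ?_ ?_
    · exact sub_mem (sub_mem (h.mono _ _ _ (by omega) ha) hd) (h.mono _ _ _ (by omega) he)
    · rw [e4]
      exact add_mem hav (h.le _ _ hdt)
  simpa using add_mem this he

/-- The connecting homomorphism in elements: the component `a` of `d' s` in the subcomplex is
bounded by `s` in the big complex, hence by some `b` in the subcomplex by injectivity. Then `s - f
b` is a class of the big complex, surjectivity makes it come from the subcomplex, and applying `q`
leaves a primitive of `s`. -/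
theorem acyclic_of_iso (h : IsFilteredExtension d F d' F' S f q)
    (hf : E2Iso d F d' F' f) : E2Acyclic (q ∘ₗ d') S := by
  intro p n s hs hds
  rw [LinearMap.comp_apply] at hds
  obtain ⟨a, ha, ea⟩ := h.drop _ _ s hs
  obtain ⟨e, he, ee⟩ := h.drop _ _ _ hds
  have hda : d a ∈ F (p - 1 - 2) (n - 1 - 1) := by
    refine h.f_refl _ _ _ _ (h.d_mem _ _ _ ha) ?_
    have e1 := congrArg d' ea
    rw [h.d_d, map_add, ee, h.q_d_d hs, add_zero, ← h.f_d] at e1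
    rw [eq_neg_of_add_eq_zero_left e1.symm]
    rw [show p - 1 - 2 = p - 2 - 1 by ring]
    exact neg_mem (h.f_mem _ _ _ he)
  have hs' := h.le _ _ hs
  obtain ⟨b, hb, hab⟩ := (hf (p - 1) (n - 1)).1 a ha hda s
    (by rw [sub_add_cancel, sub_add_cancel]; exact hs')
    (by
      rw [ea, show p - 1 - 1 = p - 2 by ring, sub_add_cancel_left]
      exact neg_mem (h.le _ _ hds))
  rw [sub_add_cancel, sub_add_cancel] at hb
  rw [show p - 1 - 1 = p - 2 by ring] at hab
  have hx : s - f b ∈ F' p n := sub_mem hs' (h.f_mem _ _ _ hb)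
  obtain ⟨a', ha', -, v, hv, hav⟩ := (hf p n).2 _ hx (by
    rw [map_sub, ea, ← h.f_d, add_sub_right_comm, ← map_sub]
    exact add_mem (h.f_mem _ _ _ hab) (h.le _ _ hds))
  refine ⟨q v, h.q_mem _ _ _ hv, ?_⟩
  have := h.q_mem _ _ _ hav
  rwa [map_sub, map_sub, map_sub, h.q_f _ _ _ ha', h.q_f _ _ _ hb, sub_zero, sub_zero,
    h.q_eq _ _ _ hs, ← h.q_d_q hv] at this

/-- By `drop` the extension splits on the associated graded complex, so the first pages form a short
exact sequence of complexes; this is the consequence of its long exact sequence that is needed. -/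
theorem e2Iso_iff (h : IsFilteredExtension d F d' F' S f q) :
    E2Iso d F d' F' f ↔ E2Acyclic (q ∘ₗ d') S :=
  ⟨h.acyclic_of_iso, fun hS p n => ⟨h.injective_of_acyclic hS p n, h.surjective_of_acyclic hS p n⟩⟩

end IsFilteredExtension

/-- Given a map of filtered complexes and submodules `K`, `K'` that are contractible modulo lower
filtration, such that the map is bijective modulo `K` and `K'`, vanishing of the second page of the
source implies vanishing of the second page of the target. -/
theorem E2Acyclic.of_contractible {d : M →ₗ[R] M} {F K : ℤ → ℤ → Submodule R M}
    {d' : N →ₗ[R] N} {F' K' : ℤ → ℤ → Submodule R N} {f : M →ₗ[R] N}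
    (hd : ∀ p n, ∀ x ∈ F p n, d x ∈ F p (n - 1))
    (hdd : ∀ p n, ∀ x ∈ F p n, d (d x) = 0)
    (hdd' : ∀ p n, ∀ x ∈ F' p n, d' (d' x) = 0)
    (hf : ∀ p n, ∀ x ∈ F p n, f x ∈ F' p n) (hfd : ∀ x, d' (f x) = f (d x))
    (hmono : ∀ p p' n, p ≤ p' → F p n ≤ F p' n)
    (hmono' : ∀ p p' n, p ≤ p' → F' p n ≤ F' p' n)
    (hK : ∀ p n, K p n ≤ F p n) (hK' : ∀ p n, F' (p - 1) n ≤ K' p n)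
    (hdK : ∀ p n, ∀ x ∈ K' p n, d' x ∈ K' p (n - 1))
    (hc : ∀ p n, ∀ x ∈ K p n, d x ∈ F (p - 1) (n - 1) →
      ∃ e ∈ K p (n + 1), x - d e ∈ F (p - 1) n)
    (hc' : ∀ p n, ∀ x ∈ K' p n, d' x ∈ F' (p - 1) (n - 1) →
      ∃ e ∈ F' p (n + 1), x - d' e ∈ F' (p - 1) n)
    (hfK : ∀ p n, ∀ x ∈ K p n, f x ∈ K' p n)
    (hlift : ∀ p n, ∀ t ∈ F' p n, ∃ s ∈ F p n, t - f s ∈ K' p n)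
    (hrefl : ∀ p n, ∀ u ∈ F p n, f u ∈ K' p n → u ∈ K p n)
    (h : E2Acyclic d F) : E2Acyclic d' F' := by
  intro p n t ht hdt
  obtain ⟨x, hx, htx⟩ := hlift p n t ht
  have hdx : d x ∈ K p (n - 1) := by
    refine hrefl _ _ _ (hd _ _ _ hx) ?_
    have h1 : f (d x) = d' t - d' (t - f x) := by rw [map_sub, hfd]; abel
    rw [h1]
    exact sub_mem (hK' _ _ (hmono' _ _ _ (by omega) hdt)) (hdK _ _ _ htx)
  -- The lift `x` of `t` has boundary in `K`; contractibility of `K` corrects it to `x - e`, a cycle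
  -- modulo filtration `p - 1`.
  obtain ⟨e, he, hxe⟩ := hc _ _ _ hdx (by rw [hdd _ _ _ hx]; exact zero_mem _)
  rw [sub_add_cancel] at he
  have hs : x - e ∈ F p n := sub_mem hx (hK _ _ he)
  have hds : d (x - e) ∈ F (p - 1) (n - 1) := by rw [map_sub]; exact hxe
  have htK : t - f (x - e) ∈ K' p n := by
    have : t - f (x - e) = (t - f x) + f e := by rw [map_sub]; abel
    rw [this]
    exact add_mem htx (hfK _ _ _ he)
  obtain ⟨v, hv, htv⟩ := hc' _ _ _ htK (by
    rw [map_sub, hfd]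
    exact sub_mem (hmono' _ _ _ (by omega) hdt) (hf _ _ _ hds))
  generalize x - e = s at hs hds htK htv
  -- The same procedure one filtration step lower: lifting the residual and correcting by `e1`
  -- yields a chain whose boundary lies in filtration `p - 2`, so that vanishing of the source page
  -- applies.
  obtain ⟨y, hy, hty⟩ := hlift _ _ _ htv
  have hd1 : d (s + y) ∈ K (p - 1) (n - 1) := by
    refine hrefl _ _ _ (by rw [map_add]; exact add_mem hds (hd _ _ _ hy)) ?_
    have h1 : f (d (s + y)) = d' t - d' (t - f s - d' v - f y) := by
      simp only [map_sub, map_add, hdd' _ _ _ hv, hfd]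
      abel
    rw [h1]
    refine sub_mem (hK' _ _ ?_) (hdK _ _ _ hty)
    rwa [show p - 1 - 1 = p - 2 by ring]
  have hsy : s + y ∈ F p n := add_mem hs (hmono _ _ _ (by omega) hy)
  obtain ⟨e1, he1, hde1⟩ := hc _ _ _ hd1 (by rw [hdd _ _ _ hsy]; exact zero_mem _)
  rw [sub_add_cancel] at he1
  rw [show p - 1 - 1 = p - 2 by ring] at hde1
  have he1' := hK _ _ he1
  obtain ⟨z, hz, hwz⟩ := h p n (s + y - e1) (sub_mem hsy (hmono _ _ _ (by omega) he1'))
    (by rw [map_sub]; exact hde1)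
  refine ⟨v + f z, add_mem (hmono' _ _ _ (by omega) hv) (hf _ _ _ hz), ?_⟩
  have h2 : t - d' (v + f z) = (t - f s - d' v) + f (s + y - e1 - d z - (y - e1)) := by
    simp only [map_sub, map_add, hfd]
    abel
  rw [h2]
  exact add_mem htv (hf _ _ _ (sub_mem hwz (sub_mem hy he1')))

end FilteredComplexes

/-! ### Contracting the lists that do not enter the complement through the projection -/

namespace DirGraph

section Contraction

variable (R : Type w) [CommRing R] {V : Type u} (A : Set V) (π : V → V)

open Classical in
/-- Insert `π x` in front of the first entry `x` outside `A`, with a sign. -/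
noncomputable def insertList : List V → (List V →₀ R)
  | [] => 0
  | x :: l => if x ∈ A then - consMap R x (insertList l) else lgen R (π x :: x :: l)

variable {A} in
theorem insertList_of_mem {x : V} (hx : x ∈ A) (l : List V) :
    insertList R A π (x :: l) = - consMap R x (insertList R A π l) := by
  simp [insertList, hx]

variable {A} in
theorem insertList_of_notMem {x : V} (hx : x ∉ A) (l : List V) :
    insertList R A π (x :: l) = lgen R (π x :: x :: l) := by
  simp [insertList, hx]

theorem insertList_of_not {l : List V} (h : ¬ RegList l) : insertList R A π l = 0 := by
  induction l with
  | nil => rfl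
  | cons x l ih =>
    by_cases hx : x ∈ A
    · rw [insertList_of_mem R π hx]
      rcases not_regList_cons h with h' | ⟨l', rfl⟩
      · rw [ih h', map_zero, neg_zero]
      · rw [insertList_of_mem R π hx, map_neg, consMap_consMap_self, neg_zero, neg_zero]
    · rw [insertList_of_notMem R π hx]
      exact lgen_of_not R fun h' => h h'.tail

theorem normalize_insertList (l : List V) :
    normalize R (insertList R A π l) = insertList R A π l := by
  cases l with
  | nil => simp [insertList]
  | cons x l =>
    by_cases hx : x ∈ A
    · rw [insertList_of_mem R π hx, map_neg, normalize_consMap]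
    · rw [insertList_of_notMem R π hx, normalize_lgen]

/-- Linear extension of `insertList`. -/
noncomputable def insertMap : (List V →₀ R) →ₗ[R] (List V →₀ R) := lext (insertList R A π)

theorem insertMap_lgen (l : List V) : insertMap R A π (lgen R l) = insertList R A π l :=
  lext_lgen (fun _ h => insertList_of_not R A π h) l

@[simp]
theorem insertMap_single (l : List V) :
    insertMap R A π (Finsupp.single l 1) = insertList R A π l := by
  simp [insertMap]

variable {A} in
theorem insertMap_consMap_of_mem {x : V} (hx : x ∈ A) (c : List V →₀ R) :
    insertMap R A π (consMap R x c) = - consMap R x (insertMap R A π c) := by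
  have : insertMap R A π ∘ₗ consMap R x = - (consMap R x ∘ₗ insertMap R A π) :=
    list_hom_ext fun l => by simp [insertMap_lgen, insertList_of_mem R π hx]
  exact LinearMap.congr_fun this c

variable {A} in
theorem insertMap_consMap_of_notMem {x : V} (hx : x ∉ A) (c : List V →₀ R) :
    insertMap R A π (consMap R x c) = consMap R (π x) (consMap R x c) := by
  have : insertMap R A π ∘ₗ consMap R x = consMap R (π x) ∘ₗ consMap R x :=
    list_hom_ext fun l => by simp [insertMap_lgen, consMap_lgen, insertList_of_notMem R π hx]
  exact LinearMap.congr_fun this c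

open Classical in
/-- The error term of the homotopy `insertMap`. -/
noncomputable def slideList : List V → (List V →₀ R)
  | [] => lgen R []
  | x :: l => if x ∈ A then consMap R x (slideList l) else lgen R (π x :: l) - insertList R A π l

variable {A} in
theorem slideList_of_mem {x : V} (hx : x ∈ A) (l : List V) :
    slideList R A π (x :: l) = consMap R x (slideList R A π l) := by
  simp [slideList, hx]

variable {A} in
theorem slideList_of_notMem {x : V} (hx : x ∉ A) (l : List V) :
    slideList R A π (x :: l) = lgen R (π x :: l) - insertList R A π l := by
  simp [slideList, hx]

/-- For first outside entry x, deleting the inserted π x returns the list, and deletions behind x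
cancel between the two terms. What survives are (π x, l), from deleting x after inserting, and the
insertion into l, from deleting x before inserting; together they form the error term `slideList`.
-/
theorem dd_insertList (l : List V) :
    dd R (insertList R A π l) + insertMap R A π (faces R l) = lgen R l - slideList R A π l := by
  induction l with
  | nil => simp [insertList, faces, slideList]
  | cons x l ih =>
    by_cases hx : x ∈ A
    · rw [insertList_of_mem R π hx, slideList_of_mem R π hx, faces, map_neg, dd_consMap,
        normalize_insertList, map_sub, insertMap_lgen, insertMap_consMap_of_mem R π hx,
        ← consMap_lgen, ← map_sub, ← ih, map_add]
      abel
    · rw [insertList_of_notMem R π hx, slideList_of_notMem R π hx, dd_lgen, faces, faces, map_sub,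
        map_sub, insertMap_consMap_of_notMem R π hx, insertMap_lgen, consMap_lgen]
      abel

open Classical in
/-- Insert `π x` in front of the first entry `x` outside `A`, unless this is the first entry. -/
noncomputable def insertInside : List V → (List V →₀ R)
  | [] => 0
  | x :: l => if x ∈ A then insertList R A π (x :: l) else 0

variable {A} in
theorem insertInside_of_mem {x : V} (hx : x ∈ A) (l : List V) :
    insertInside R A π (x :: l) = - consMap R x (insertList R A π l) := by
  simp [insertInside, hx, insertList_of_mem R π hx]

variable {A} in
theorem insertInside_of_notMem {x : V} (hx : x ∉ A) (l : List V) :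
    insertInside R A π (x :: l) = 0 := by
  simp [insertInside, hx]

theorem insertInside_of_not {l : List V} (h : ¬ RegList l) : insertInside R A π l = 0 := by
  cases l with
  | nil => rfl
  | cons x l =>
    by_cases hx : x ∈ A
    · rw [insertInside_of_mem R π hx, ← insertList_of_mem R π hx, insertList_of_not R A π h]
    · exact insertInside_of_notMem R π hx l

/-- Linear extension of `insertInside`. -/
noncomputable def contraction : (List V →₀ R) →ₗ[R] (List V →₀ R) := lext (insertInside R A π)

theorem contraction_lgen (l : List V) : contraction R A π (lgen R l) = insertInside R A π l :=
  lext_lgen (fun _ h => insertInside_of_not R A π h) l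

@[simp]
theorem contraction_single (l : List V) :
    contraction R A π (Finsupp.single l 1) = insertInside R A π l := by
  simp [contraction]

variable {A} in
theorem contraction_consMap {x : V} (hx : x ∈ A) (c : List V →₀ R) :
    contraction R A π (consMap R x c) = - consMap R x (insertMap R A π c) := by
  have : contraction R A π ∘ₗ consMap R x = - (consMap R x ∘ₗ insertMap R A π) :=
    list_hom_ext fun l => by simp [contraction_lgen, insertInside_of_mem R π hx]
  exact LinearMap.congr_fun this c

variable {A} in
-- The additional error compared with `dd_insertList` comes from the face deleting `a`: if `l`
-- starts outside `A`, nothing precedes the insertion point and `contraction` does not insert.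
theorem dd_insertInside {a : V} (ha : a ∈ A) (l : List V) :
    dd R (insertInside R A π (a :: l)) + contraction R A π (faces R (a :: l)) =
      lgen R (a :: l) - (consMap R a (slideList R A π l) +
        (insertList R A π l - insertInside R A π l)) := by
  have h := dd_insertList R A π (a :: l)
  rw [faces, map_sub, insertMap_consMap_of_mem R π ha, insertMap_lgen,
    insertList_of_mem R π ha, slideList_of_mem R π ha] at h
  rw [faces, map_sub, contraction_consMap R π ha, contraction_lgen, insertInside_of_mem R π ha,
    ← sub_sub, ← h]
  abel

open Classical in
/-- The number of entries outside `A`. -/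
noncomputable def outCount : List V → ℕ
  | [] => 0
  | x :: l => outCount l + if x ∈ A then 0 else 1

theorem outCount_le_length (l : List V) : outCount A l ≤ l.length := by
  induction l with
  | nil => exact le_rfl
  | cons x l ih =>
    rw [outCount, List.length_cons]
    split_ifs <;> omega

variable {A} in
theorem EndsOutside.outCount_pos {l : List V} (h : EndsOutside A l) : 0 < outCount A l := by
  obtain ⟨x, hx, hx'⟩ := h.exists_notMem
  clear h
  induction l with
  | nil => simp at hx
  | cons y l ih =>
    rw [outCount]
    rcases List.mem_cons.1 hx with rfl | hx
    · simp [hx']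
    · exact Nat.add_pos_left (ih hx) _

/-- The list starts in `A`, and does not enter the complement of `A` immediately afterwards, from
the projection of the entry point. -/
def IsMatched : List V → Prop
  | a :: y :: _ => a ∈ A ∧ (y ∈ A ∨ a ≠ π y)
  | _ => False

end Contraction

/-! ### Length estimates for the contraction -/

section

variable {R : Type w} [CommRing R] {G : DirGraph.{u}} {A : Set G.V} {π : G.V → G.V}

/-- For every vertex `x`, all shortest paths from `A` to `x` can be chosen through `π x ∈ A`. -/
def IsProjection (G : DirGraph.{u}) (A : Set G.V) (π : G.V → G.V) : Prop :=
  ∀ x, ∀ a ∈ A, π x ∈ A ∧ G.dist a (π x) + G.dist (π x) x ≤ G.dist a x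

/-- A preceding entry `a` of `A` makes the insertion free, since π x lies on a shortest path from
`a` to x. Without such a prefix the length could grow, which is why `contraction` requires the list
to start in `A`. -/
theorem insertList_mem_prefix (hπ : G.IsProjection A π) {a : G.V} (ha : a ∈ A) (l : List G.V) :
    insertList R A π l ∈ Finsupp.supported R R
      {m | G.len (a :: m) ≤ G.len (a :: l) ∧ m.length = l.length + 1 ∧
        outCount A m = outCount A l ∧ (EndsOutside A m ↔ EndsOutside A l) ∧
        ∃ y m', m = y :: m' ∧ y ∈ A} := by
  induction l generalizing a with
  | nil => exact zero_mem _
  | cons x l ih =>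
    by_cases hx : x ∈ A
    · rw [insertList_of_mem R π hx]
      refine neg_mem (consMap_mem ?_)
      rcases eq_or_ne l [] with rfl | hl
      · exact zero_mem _
      refine Finsupp.supported_mono ?_ (ih hx)
      rintro _ ⟨h1, h2, h3, h4, y, m, rfl, hy⟩ -
      refine ⟨?_, by simpa using h2, by rw [outCount, h3, outCount], ?_, x, _, rfl, hx⟩
      · exact add_le_add le_rfl h1
      · rw [endsOutside_cons (by simp), endsOutside_cons hl, h4]
    · rw [insertList_of_notMem R π hx]
      obtain ⟨h1, h2⟩ := hπ x a ha
      refine lgen_mem fun _ => ⟨?_, rfl, ?_, Iff.rfl, π x, _, rfl, h1⟩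
      · rw [len_cons_cons, len_cons_cons, len_cons_cons, ← add_assoc]
        gcongr
      · rw [outCount]
        simp [h1]

/-- Both parts of the error term lose the first outside entry: one replaces it by its projection,
the other deletes it. This is the measure that makes iterated homotopies terminate. -/
theorem slideList_mem_prefix (hπ : G.IsProjection A π) {a : G.V} (ha : a ∈ A) (l : List G.V)
    (hl : EndsOutside A l) :
    slideList R A π l ∈ Finsupp.supported R R
      {m | G.len (a :: m) ≤ G.len (a :: l) ∧ m.length = l.length ∧
        outCount A m + 1 ≤ outCount A l ∧ ∃ y m', m = y :: m' ∧ y ∈ A} := by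
  induction l generalizing a with
  | nil => exact hl.elim
  | cons x l ih =>
    by_cases hx : x ∈ A
    · rw [slideList_of_mem R π hx]
      have hne : l ≠ [] := by
        rintro rfl
        exact hl hx
      refine consMap_mem (Finsupp.supported_mono ?_ (ih hx ((endsOutside_cons hne).1 hl)))
      rintro _ ⟨h1, h2, h3, y, m, rfl, hy⟩ -
      refine ⟨?_, by simpa using h2, ?_, x, _, rfl, hx⟩
      · exact add_le_add le_rfl h1
      · rw [outCount, outCount.eq_2 A x l, Nat.add_right_comm]
        exact Nat.add_le_add_right h3 _
    · rw [slideList_of_notMem R π hx]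
      obtain ⟨h1, h2⟩ := hπ x a ha
      have hcount : outCount A (x :: l) = outCount A l + 1 := by
        rw [outCount]
        simp [hx]
      refine sub_mem (lgen_mem fun _ => ⟨?_, rfl, ?_, π x, _, rfl, h1⟩) ?_
      · calc G.len (a :: π x :: l) = G.dist a (π x) + G.len (π x :: l) := rfl
          _ ≤ G.dist a (π x) + (G.dist (π x) x + G.len (x :: l)) := by
            gcongr
            exact len_cons_le _ _ _
          _ ≤ G.dist a x + G.len (x :: l) := by
            rw [← add_assoc]
            gcongr
      · rw [hcount, outCount]
        simp [h1]
      · refine Finsupp.supported_mono ?_ (insertList_mem_prefix hπ ha l)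
        rintro m ⟨h3, h4, h5, -, h6⟩
        exact ⟨h3.trans (len_cons_le a x l), h4, by rw [hcount, h5], h6⟩

variable (R G A π) in
/-- The span of the matched lists of filtration degree `p`, and of the lists of lower
filtration. -/
noncomputable def matchedFilt (p n : ℤ) : Submodule R (List G.V →₀ R) :=
  Finsupp.supported R R {l ∈ G.relTuples A p n | IsMatched A π l ∨ G.LenLE l (p - 1)}

theorem matchedFilt_le (p n : ℤ) : G.matchedFilt R A π p n ≤ G.relFilt R A p n :=
  Finsupp.supported_mono fun _ hl => hl.1

theorem relFilt_le_matchedFilt (p n : ℤ) :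
    G.relFilt R A (p - 1) n ≤ G.matchedFilt R A π p n :=
  Finsupp.supported_mono fun _ hl =>
    ⟨⟨hl.1, hl.2.1, hl.2.2.1, hl.2.2.2.mono (by omega)⟩, Or.inr hl.2.2.2⟩

/-- Deleting the first entry shortens the list. Deleting the second can only destroy the matching by
producing (π x, x, ...), and then the deleted `y` was a genuine detour between π x and x, so the
length drops as well. Other faces keep the first two entries. -/
theorem bdry_matchedFilt (hπ : G.IsProjection A π) {p n : ℤ} {c : List G.V →₀ R}
    (hc : c ∈ G.matchedFilt R A π p n) : bdry R A c ∈ G.matchedFilt R A π p (n - 1) := by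
  refine outPart_mem (T := {m | RegList m ∧ (m.length : ℤ) = n - 1 ∧ G.LenLE m p ∧
    (EndsOutside A m → IsMatched A π m ∨ G.LenLE m (p - 1))}) ?_
    fun m hm h => ⟨⟨hm.1, hm.2.1, h, hm.2.2.1⟩, hm.2.2.2 h⟩
  refine mem_of_single_mem (fun l hl => ?_) hc
  rw [dd_single]
  obtain ⟨⟨hreg, hlen, hout, hle⟩, hD⟩ := hl
  have h1 := faces_mem (R := R) l
  suffices h2 : faces R l ∈ Finsupp.supported R R
      {m | EndsOutside A m → IsMatched A π m ∨ G.LenLE m (p - 1)} by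
    intro m hm
    obtain ⟨h3, h4, h5⟩ := h1 hm
    exact ⟨h3, by omega, hle.of_le h5, h2 hm⟩
  rcases hD with hD | hD
  swap
  · refine Finsupp.supported_mono ?_ h1
    exact fun m hm _ => Or.inr (hD.of_le hm.2.2)
  match l, hD, hreg, hout, hle with
  | a :: y :: l, ⟨ha, hy⟩, hreg, hout, hle =>
    have hay := (regList_cons_cons.1 hreg).1
    rw [faces, faces, map_sub, consMap_lgen]
    refine sub_mem (lgen_mem fun _ _ => Or.inr (hle.of_add_one_le ?_)) (sub_mem (lgen_mem ?_) ?_)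
    · rw [len_cons_cons, add_comm]
      gcongr
      exact one_le_dist hay
    · intro _ hout'
      cases l with
      | nil => exact absurd ha hout'
      | cons x l =>
        by_cases h : x ∈ A ∨ a ≠ π x
        · exact Or.inl ⟨ha, h⟩
        · simp only [not_or, not_not] at h
          obtain ⟨hx, rfl⟩ := h
          refine Or.inr (hle.of_add_one_le ?_)
          rw [len_cons_cons, len_cons_cons, len_cons_cons, add_right_comm, ← add_assoc]
          refine add_le_add ?_ le_rfl
          -- If `y ∈ A`, a shortest path from `y` to `x` passes π x again, so the step from π x to
          -- `y` is wasted. If `y ∉ A`, the same holds with π y in place of `y`, since π y ≠ π x by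
          -- the matching condition.
          by_cases hyA : y ∈ A
          · calc G.dist (π x) x + 1 ≤ (G.dist y (π x) + G.dist (π x) x) + G.dist (π x) y := by
                  gcongr
                  · exact le_add_self
                  · exact one_le_dist hay
              _ ≤ G.dist y x + G.dist (π x) y := by
                  gcongr
                  exact (hπ x y hyA).2
              _ = _ := add_comm _ _
          · obtain ⟨h1, h2⟩ := hπ y _ ha
            have hne : π x ≠ π y := hy.resolve_left hyA
            calc G.dist (π x) x + 1 ≤ (G.dist (π y) (π x) + G.dist (π x) x)
                    + G.dist (π x) (π y) := by
                  gcongr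
                  · exact le_add_self
                  · exact one_le_dist hne
              _ ≤ G.dist (π y) x + G.dist (π x) (π y) := by
                  gcongr
                  exact (hπ x _ h1).2
              _ ≤ (G.dist (π y) y + G.dist y x) + G.dist (π x) (π y) := by
                  gcongr
                  exact dist_triangle _ _ _
              _ = (G.dist (π x) (π y) + G.dist (π y) y) + G.dist y x := by abel
              _ ≤ _ := by gcongr
    · refine consMap_mem (consMap_mem ?_)
      rw [Finsupp.mem_supported]
      exact fun _ _ _ _ _ => Or.inl ⟨ha, hy⟩

/-- After an insertion, the first two entries both lie in `A`, so the result is matched whatever the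
input was. -/
theorem contraction_mem_matched (hπ : G.IsProjection A π) {p n : ℤ} {c : List G.V →₀ R}
    (hc : c ∈ G.relFilt R A p n) : contraction R A π c ∈ Finsupp.supported R R
      {l ∈ G.relTuples A p (n + 1) | IsMatched A π l} := by
  refine mem_of_single_mem (fun l hl => ?_) hc
  rw [contraction_single]
  obtain ⟨hreg, hlen, hout, hle⟩ := hl
  cases l with
  | nil => exact zero_mem _
  | cons a l =>
    by_cases ha : a ∈ A
    · rw [insertInside_of_mem R π ha]
      refine neg_mem (consMap_mem ?_)
      have hl : l ≠ [] := by
        rintro rfl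
        exact hout ha
      refine Finsupp.supported_mono ?_ (insertList_mem_prefix hπ ha l)
      rintro _ ⟨h1, h2, -, h4, y, m, rfl, hy⟩ hreg'
      refine ⟨⟨hreg', ?_, ?_, hle.of_le h1⟩, ha, Or.inl hy⟩
      · simp only [List.length_cons] at h2 hlen ⊢
        push_cast at hlen ⊢
        omega
      · exact h4.2 ((endsOutside_cons hl).1 hout)
    · rw [insertInside_of_notMem R π ha]
      exact zero_mem _

/-- Insertion happens before an existing entry and leaves the last entry alone. Hence `contraction`
passes to the relative complex, where `dd` may be replaced by `bdry`. -/
theorem outPart_contraction_eq_zero (hπ : G.IsProjection A π) {c : List G.V →₀ R}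
    (hc : c ∈ Finsupp.supported R R {l | ¬ EndsOutside A l}) :
    outPart R A (contraction R A π c) = 0 := by
  refine outPart_eq_zero (T := {l | ¬ EndsOutside A l}) ?_ fun _ hl => hl
  refine mem_of_single_mem (fun l hl => ?_) hc
  rw [contraction_single]
  cases l with
  | nil => exact zero_mem _
  | cons a l =>
    by_cases ha : a ∈ A
    · rw [insertInside_of_mem R π ha]
      rcases eq_or_ne l [] with rfl | hne
      · simp [insertList]
      refine neg_mem (consMap_mem ?_)
      refine Finsupp.supported_mono ?_ (insertList_mem_prefix hπ ha l)
      rintro _ ⟨-, -, -, h4, y, m, rfl, hy⟩ - h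
      exact hl ((endsOutside_cons hne).2 (h4.1 h))
    · rw [insertInside_of_notMem R π ha]
      exact zero_mem _

/-- On matched lists, the identity is homotopic, up to terms of lower filtration, to a map that
lowers the number of entries outside `A`. -/
theorem matched_homotopy (hπ : G.IsProjection A π) {p n : ℤ} {k : ℕ} {c : List G.V →₀ R}
    (hc : c ∈ Finsupp.supported R R
      {l ∈ G.relTuples A p n | IsMatched A π l ∧ outCount A l ≤ k + 1}) :
    outPart R A (c - dd R (contraction R A π c) - contraction R A π (dd R c)) ∈
      Finsupp.supported R R {l ∈ G.relTuples A p n |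
        (IsMatched A π l ∧ outCount A l ≤ k) ∨ G.LenLE l (p - 1)} := by
  refine outPart_mem (T := {l | RegList l ∧ (l.length : ℤ) = n ∧ G.LenLE l p ∧
    ((IsMatched A π l ∧ outCount A l ≤ k) ∨ G.LenLE l (p - 1))}) ?_
    fun m hm h => ⟨⟨hm.1, hm.2.1, h, hm.2.2.1⟩, hm.2.2.2⟩
  have : (LinearMap.id - dd R ∘ₗ contraction R A π - contraction R A π ∘ₗ dd R :
      (List G.V →₀ R) →ₗ[R] (List G.V →₀ R)) c ∈ Finsupp.supported R R {l | RegList l ∧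
        (l.length : ℤ) = n ∧ G.LenLE l p ∧
          ((IsMatched A π l ∧ outCount A l ≤ k) ∨ G.LenLE l (p - 1))} := by
    refine mem_of_single_mem ?_ hc
    rintro l ⟨⟨hreg, hlen, hout, hle⟩, hD, hcount⟩
    match l, hD, hreg, hout, hle, hlen, hcount with
    | a :: y :: l, ⟨ha, hy⟩, hreg, hout, hle, hlen, hcount =>
      have e := dd_insertInside R π ha (y :: l)
      rw [eq_sub_iff_add_eq, ← eq_sub_iff_add_eq', lgen_of R hreg] at e
      have hay := (regList_cons_cons.1 hreg).1
      simp only [LinearMap.sub_apply, LinearMap.id_apply, LinearMap.comp_apply, dd_single,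
        contraction_single]
      rw [sub_sub, ← e]
      refine add_mem (consMap_mem ?_) ?_
      · refine Finsupp.supported_mono ?_ (slideList_mem_prefix hπ ha _ hout)
        rintro _ ⟨h1, h2, h3, z, m, rfl, hz⟩ hreg'
        refine ⟨hreg', ?_, hle.of_le h1, Or.inl ⟨⟨ha, Or.inl hz⟩, ?_⟩⟩
        · rw [List.length_cons, h2, ← hlen]
          rfl
        · rw [outCount] at hcount ⊢
          simp only [ha, if_true] at hcount ⊢
          omega
      -- The other error term is the list (π y, y, ...) for `y ∉ A`. It is shorter than (a, y, ...)
      -- exactly because matching demands `a ≠ π y`.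
      · by_cases hyA : y ∈ A
        · rw [insertInside_of_mem R π hyA, insertList_of_mem R π hyA, sub_self]
          exact zero_mem _
        · rw [insertInside_of_notMem R π hyA, insertList_of_notMem R π hyA, sub_zero]
          have hle' : G.LenLE (π y :: y :: l) (p - 1) := by
            refine hle.of_add_one_le ?_
            rw [len_cons_cons, len_cons_cons, add_right_comm]
            gcongr
            refine le_trans ?_ (hπ y a ha).2
            rw [add_comm]
            gcongr
            exact one_le_dist (hy.resolve_left hyA)
          exact lgen_mem fun hreg' => ⟨hreg', hlen, hle'.mono (by omega), Or.inr hle'⟩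
  simpa using this

/-- Each application of the homotopy removes an outside entry up to lower filtration. A generator
ends outside `A` and so has at least one outside entry; with none left, only lower filtration
remains. -/
theorem exists_bdry_of_matched (hA : G.IsClosedBackwards A) (hπ : G.IsProjection A π) {p n : ℤ}
    (k : ℕ) {c : List G.V →₀ R}
    (hc : c ∈ Finsupp.supported R R {l ∈ G.relTuples A p n |
      (IsMatched A π l ∧ outCount A l ≤ k) ∨ G.LenLE l (p - 1)})
    (hdc : bdry R A c ∈ G.relFilt R A (p - 1) (n - 1)) :
    ∃ e ∈ G.matchedFilt R A π p (n + 1), c - bdry R A e ∈ G.relFilt R A (p - 1) n := by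
  induction k generalizing c with
  | zero =>
    refine ⟨0, zero_mem _, ?_⟩
    rw [map_zero, sub_zero]
    refine Finsupp.supported_mono ?_ hc
    rintro l ⟨⟨h1, h2, h3, h4⟩, ⟨-, h5⟩ | h5⟩
    · exact absurd h3.outCount_pos (by omega)
    · exact ⟨h1, h2, h3, h5⟩
  | succ k ih =>
    have hc' : c ∈ Finsupp.supported R R
        {l ∈ G.relTuples A p n | IsMatched A π l ∧ outCount A l ≤ k + 1} ⊔
          G.relFilt R A (p - 1) n := by
      rw [relFilt, ← Finsupp.supported_union]
      refine Finsupp.supported_mono ?_ hc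
      rintro l ⟨h1, h2 | h2⟩
      · exact Or.inl ⟨h1, h2⟩
      · exact Or.inr ⟨h1.1, h1.2.1, h1.2.2.1, h2⟩
    obtain ⟨x, hx, y, hy, rfl⟩ := Submodule.mem_sup.1 hc'
    have hxF : x ∈ G.relFilt R A p n := Finsupp.supported_mono (fun l hl => hl.1) hx
    have hdx : bdry R A x ∈ G.relFilt R A (p - 1) (n - 1) := by
      rw [map_add] at hdc
      simpa using sub_mem hdc (bdry_mem hy)
    have h1 := matched_homotopy hπ hx
    have hcx := contraction_mem_matched hπ hxF
    have hcx' : contraction R A π x ∈ G.relFilt R A p (n + 1) :=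
      Finsupp.supported_mono (fun l hl => hl.1) hcx
    -- The second half of the homotopy is negligible: the relative boundary of `x` has lower
    -- filtration, and `contraction` preserves filtration.
    have h2 : outPart R A (contraction R A π (dd R x)) ∈ G.relFilt R A (p - 1) n := by
      have h3 : outPart R A (contraction R A π (dd R x - outPart R A (dd R x))) = 0 :=
        outPart_contraction_eq_zero hπ (sub_outPart_mem (T := Set.univ)
          (by rw [Finsupp.supported_univ]; trivial) fun l _ h => h)
      rw [map_sub, map_sub, sub_eq_zero] at h3
      rw [h3]
      have h4 := contraction_mem_matched hπ hdx
      rw [sub_add_cancel] at h4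
      exact outPart_mem h4 fun l hl _ => hl.1
    have e1 : outPart R A (x - dd R (contraction R A π x) - contraction R A π (dd R x)) =
        x - bdry R A (contraction R A π x) - outPart R A (contraction R A π (dd R x)) := by
      rw [map_sub, map_sub, outPart_relFilt hxF, bdry_apply]
    rw [e1] at h1
    obtain ⟨e, he, hxe⟩ := ih h1 (by
      rw [map_sub, map_sub, bdry_bdry hA hcx', sub_zero]
      exact sub_mem hdx (bdry_mem h2))
    refine ⟨contraction R A π x + e, add_mem ?_ he, ?_⟩
    · refine Finsupp.supported_mono ?_ hcx
      exact fun l hl => ⟨hl.1, Or.inl hl.2⟩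
    · have e2 : x + y - bdry R A (contraction R A π x + e) =
          (x - bdry R A (contraction R A π x) - outPart R A (contraction R A π (dd R x)) -
            bdry R A e) + (outPart R A (contraction R A π (dd R x)) + y) := by
        rw [map_add]
        abel
      rw [e2]
      exact add_mem hxe (add_mem h2 hy)

/-- The matched lists are contractible modulo lower filtration. -/
theorem matchedFilt_contractible (hA : G.IsClosedBackwards A) (hπ : G.IsProjection A π) {p n : ℤ}
    {c : List G.V →₀ R} (hc : c ∈ G.matchedFilt R A π p n)
    (hdc : bdry R A c ∈ G.relFilt R A (p - 1) (n - 1)) :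
    ∃ e ∈ G.matchedFilt R A π p (n + 1), c - bdry R A e ∈ G.relFilt R A (p - 1) n := by
  refine exists_bdry_of_matched hA hπ n.toNat (Finsupp.supported_mono ?_ hc) hdc
  rintro l ⟨h1, h2⟩
  refine ⟨h1, h2.imp_left fun h => ⟨h, ?_⟩⟩
  have := outCount_le_length A l
  have := h1.2.1
  omega

end

end DirGraph

/-! ### Excision -/

namespace DirGraph

section Lifting

variable {R : Type w} [CommRing R] {V V' : Type u} {f : V → V'}

theorem exists_lift_of_supported {T : Set (List V)} {T' K' : Set (List V')}
    (h : ∀ m ∈ T', (∃ l ∈ T, RegList m ∧ l.map f = m) ∨ m ∈ K')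
    {t : List V' →₀ R} (ht : t ∈ Finsupp.supported R R T') :
    ∃ s ∈ Finsupp.supported R R T, t - lmap R f s ∈ Finsupp.supported R R K' := by
  have : t ∈ (Finsupp.supported R R T).map (lmap R f) ⊔ Finsupp.supported R R K' := by
    refine mem_of_single_mem (f := LinearMap.id) (fun m hm => ?_) ht
    rcases h m hm with ⟨l, hl, hreg, rfl⟩ | hK
    · refine Submodule.mem_sup_left ⟨Finsupp.single l 1, Finsupp.single_mem_supported R _ hl, ?_⟩
      rw [lmap_single, lgen_of R hreg]
      rfl
    · exact Submodule.mem_sup_right (Finsupp.single_mem_supported R _ hK)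
  obtain ⟨_, ⟨s, hs, rfl⟩, y, hy, rfl⟩ := Submodule.mem_sup.1 this
  exact ⟨s, hs, by simpa using hy⟩

/-- If the lists in `T` outside `U` are mapped injectively to regular lists outside `U'`, then
chains on `T` that are mapped to chains on `U'` are chains on `U`. -/
theorem mem_supported_of_lmap_mem {T U : Set (List V)} {U' : Set (List V')}
    (h : ∀ l ∈ T, l ∉ U → RegList (l.map f) ∧ l.map f ∉ U' ∧
      ∀ m ∈ T, m.map f = l.map f → m = l)
    {u : List V →₀ R} (hu : u ∈ Finsupp.supported R R T)
    (hfu : lmap R f u ∈ Finsupp.supported R R U') : u ∈ Finsupp.supported R R U := by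
  intro l hl
  by_contra hU
  obtain ⟨hreg, hU', huniq⟩ := h l (hu hl) hU
  have h1 : lmap R f u (l.map f) = u l := by
    rw [lmap, lext, Finsupp.linearCombination_apply, Finsupp.sum, Finsupp.finsetSum_apply,
      Finset.sum_eq_single l]
    · simp [lgen_of R hreg]
    · intro m hm hne
      have : m.map f ≠ l.map f := fun e => hne (huniq m (hu hm) e)
      by_cases hreg' : RegList (m.map f)
      · simp [lgen_of R hreg', this]
      · simp [lgen_of_not R hreg']
    · intro h
      exact absurd hl h
  refine hU' (hfu ?_)
  rw [Finset.mem_coe, Finsupp.mem_support_iff, h1]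
  exact Finsupp.mem_support_iff.1 hl

end Lifting

section Excision

variable {R : Type w} [CommRing R] {X P : DirGraph.{u}} {A : Set X.V} {A' : Set P.V}
  {π : X.V → X.V} {π' : P.V → P.V}

/-- The two shapes that survive the contraction. They involve only outside vertices and their
projections, which is the data a pushout preserves. -/
theorem eq_of_not_isMatched (hA : X.IsClosedBackwards A) {p n : ℤ} {l : List X.V}
    (hl : l ∈ X.relTuples A p n) (h : ¬ IsMatched A π l) :
    (∀ x ∈ l, x ∉ A) ∨ ∃ x l', l = π x :: x :: l' ∧ π x ∈ A ∧ ∀ y ∈ x :: l', y ∉ A := by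
  obtain ⟨-, -, hout, hle⟩ := hl
  match l, h, hout, hle with
  | [x], _, hout, _ => exact Or.inl (by simpa [EndsOutside] using hout)
  | a :: y :: l, h, hout, hle =>
    by_cases ha : a ∈ A
    · right
      simp only [IsMatched, ha, true_and, not_or, not_not] at h
      obtain ⟨hy, rfl⟩ := h
      exact ⟨y, l, rfl, ha, hA.forall_notMem
        (ne_top_of_le_ne_top hle.ne_top (len_le_len_cons _ _)) hy⟩
    · exact Or.inl (hA.forall_notMem hle.ne_top ha)

/-- A map of directed graphs that is an isomorphism relative to the subsets `A`, `A'`, compatible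
with the projections onto them. -/
structure IsRelativeIso (g : X ⟶ P) (A : Set X.V) (A' : Set P.V) (π : X.V → X.V)
    (π' : P.V → P.V) : Prop where
  mem_iff : ∀ x, g.toFun x ∈ A' ↔ x ∈ A
  inj : ∀ x y, x ∉ A → y ∉ A → g.toFun x = g.toFun y → x = y
  surj : ∀ z, z ∉ A' → ∃ x, x ∉ A ∧ g.toFun x = z
  dist_eq : ∀ x y, x ∉ A → y ∉ A → P.dist (g.toFun x) (g.toFun y) = X.dist x y
  -- For empty `A` a projection carries no information, so compatibility is requested only in the
  -- presence of a vertex of `A`.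
  proj_eq : ∀ x, x ∉ A → ∀ a ∈ A, π' (g.toFun x) = g.toFun (π x)
  dist_proj : ∀ x, x ∉ A → ∀ a ∈ A, P.dist (g.toFun (π x)) (g.toFun x) = X.dist (π x) x
  nonempty : ∀ z y, z ∈ A' → y ∉ A' → P.dist z y ≠ ⊤ → A.Nonempty

namespace IsRelativeIso

variable {g : X ⟶ P}

theorem len_map (h : IsRelativeIso g A A' π π') {l : List X.V} (hl : ∀ x ∈ l, x ∉ A) :
    P.len (l.map g.toFun) = X.len l := by
  induction l with
  | nil => rfl
  | cons x l ih =>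
    cases l with
    | nil => rfl
    | cons y l =>
      rw [List.map_cons, List.map_cons, len_cons_cons, len_cons_cons,
        h.dist_eq x y (hl _ (by simp)) (hl _ (by simp)), ← List.map_cons,
        ih fun z hz => hl z (List.mem_cons_of_mem _ hz)]

theorem regList_map (h : IsRelativeIso g A A' π π') {l : List X.V} (hl : ∀ x ∈ l, x ∉ A)
    (hreg : RegList l) : RegList (l.map g.toFun) := by
  induction l with
  | nil => exact List.isChain_nil
  | cons x l ih =>
    cases l with
    | nil => exact List.isChain_singleton _
    | cons y l =>
      obtain ⟨h1, h2⟩ := regList_cons_cons.1 hreg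
      exact regList_cons_cons.2 ⟨fun e => h1 (h.inj x y (hl _ (by simp)) (hl _ (by simp)) e),
        ih (fun z hz => hl z (List.mem_cons_of_mem _ hz)) h2⟩

theorem eq_of_map_eq (h : IsRelativeIso g A A' π π') {l m : List X.V} (hl : ∀ x ∈ l, x ∉ A)
    (e : m.map g.toFun = l.map g.toFun) : m = l := by
  induction l generalizing m with
  | nil => simpa using e
  | cons x l ih =>
    cases m with
    | nil => simp at e
    | cons y m =>
      simp only [List.map_cons, List.cons.injEq] at e
      have hx : x ∉ A := hl x (by simp)
      have hy : y ∉ A := by rwa [← h.mem_iff, e.1, h.mem_iff]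
      rw [h.inj y x hy hx e.1, ih (fun z hz => hl z (List.mem_cons_of_mem _ hz)) e.2]

theorem exists_map_eq (h : IsRelativeIso g A A' π π') {m : List P.V} (hm : ∀ z ∈ m, z ∉ A') :
    ∃ l : List X.V, (∀ x ∈ l, x ∉ A) ∧ l.map g.toFun = m := by
  induction m with
  | nil => exact ⟨[], by simp, rfl⟩
  | cons z m ih =>
    obtain ⟨x, hx, rfl⟩ := h.surj z (hm _ (by simp))
    obtain ⟨l, hl, rfl⟩ := ih fun y hy => hm y (List.mem_cons_of_mem _ hy)
    exact ⟨x :: l, by simpa [hx] using hl, rfl⟩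

theorem len_map_proj (h : IsRelativeIso g A A' π π') {x : X.V} {l : List X.V} (hπ : π x ∈ A)
    (hl : ∀ y ∈ x :: l, y ∉ A) :
    P.len ((π x :: x :: l).map g.toFun) = X.len (π x :: x :: l) := by
  rw [List.map_cons, List.map_cons, len_cons_cons, len_cons_cons, ← List.map_cons, h.len_map hl,
    h.dist_proj x (hl x (by simp)) _ hπ]

/-- Since `g` may identify vertices of `A`, a matched list (a, y, ...) can acquire an unmatched
image when `g a = g (π y)` with `a ≠ π y`. The image is then shorter, because it no longer pays for
the way from `a` to π y. -/
theorem lmap_matchedFilt (h : IsRelativeIso g A A' π π') (hπ : X.IsProjection A π) {p n : ℤ}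
    {c : List X.V →₀ R} (hc : c ∈ X.matchedFilt R A π p n) :
    lmap R g.toFun c ∈ P.matchedFilt R A' π' p n := by
  refine lext_mem ?_ hc
  rintro l ⟨⟨-, hlen, hout, hle⟩, hD⟩
  refine lgen_mem fun hreg => ⟨⟨hreg, by simpa using hlen, (endsOutside_map h.mem_iff l).2 hout,
    hle.of_le (len_map_le g l)⟩, ?_⟩
  rcases hD with hD | hD
  swap
  · exact Or.inr (hD.of_le (len_map_le g l))
  match l, hD, hle with
  | a :: y :: l, ⟨ha, hy⟩, hle =>
    have ha' := (h.mem_iff a).2 ha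
    by_cases hyA : y ∈ A
    · exact Or.inl ⟨ha', Or.inl ((h.mem_iff y).2 hyA)⟩
    by_cases e : g.toFun a = π' (g.toFun y)
    · right
      have e2 := h.proj_eq y hyA a ha
      refine hle.of_add_one_le ?_
      have h1 : P.dist (g.toFun a) (g.toFun y) + 1 ≤ X.dist a y := by
        rw [e, e2, h.dist_proj y hyA a ha, add_comm]
        refine le_trans ?_ (hπ y a ha).2
        gcongr
        exact one_le_dist (hy.resolve_left hyA)
      rw [List.map_cons, List.map_cons, len_cons_cons, len_cons_cons, add_right_comm]
      exact add_le_add h1 (len_map_le g (y :: l))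
    · exact Or.inl ⟨ha', Or.inr e⟩

/-- Unmatched lists have the two shapes of `eq_of_not_isMatched`, and each lifts entry by entry,
with π' of an outside vertex lifting to its π, without changing the length. -/
theorem exists_lift (h : IsRelativeIso g A A' π π') (hA' : P.IsClosedBackwards A')
    {p n : ℤ} (hπ : X.IsProjection A π)
    {t : List P.V →₀ R} (ht : t ∈ P.relFilt R A' p n) :
    ∃ s ∈ X.relFilt R A p n, t - lmap R g.toFun s ∈ P.matchedFilt R A' π' p n := by
  refine exists_lift_of_supported (fun m hm => ?_) ht
  by_cases hD : IsMatched A' π' m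
  · exact Or.inr ⟨hm, Or.inl hD⟩
  left
  have hm' := eq_of_not_isMatched hA' hm hD
  obtain ⟨hreg, hlen, hout, hle⟩ := hm
  rcases hm' with hm' | ⟨z, m', rfl, hz, hm'⟩
  · obtain ⟨l, hl, rfl⟩ := h.exists_map_eq hm'
    exact ⟨l, ⟨hreg.of_map, by simpa using hlen, (endsOutside_map h.mem_iff l).1 hout,
      hle.of_le (h.len_map hl).ge⟩, hreg, rfl⟩
  · obtain ⟨l, hl, e⟩ := h.exists_map_eq hm'
    match l, hl, e with
    | x :: l, hl, e =>
      simp only [List.map_cons, List.cons.injEq] at e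
      obtain ⟨rfl, rfl⟩ := e
      obtain ⟨a, ha⟩ := h.nonempty _ (g.toFun x) hz (hm' _ (by simp)) fun e => hle.ne_top (by
        rw [len_cons_cons, e, top_add])
      have hx : x ∉ A := hl x (by simp)
      have hπx := (hπ x a ha).1
      have e2 : (π x :: x :: l).map g.toFun =
          π' (g.toFun x) :: g.toFun x :: l.map g.toFun := by
        rw [h.proj_eq x hx a ha]
        rfl
      refine ⟨π x :: x :: l, ⟨?_, by simpa using hlen, ?_, ?_⟩, hreg, e2⟩
      · exact RegList.of_map (f := g.toFun) (by rwa [e2])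
      · exact (endsOutside_map h.mem_iff _).1 (by rwa [e2])
      · exact hle.of_le (by rw [← e2, h.len_map_proj hπx hl])

/-- Unmatched lists of exact filtration `p` map to lists of the same kind and have no competing
preimage, so their coefficients cannot cancel under `lmap`. -/
theorem mem_matchedFilt (h : IsRelativeIso g A A' π π') (hA : X.IsClosedBackwards A)
    (hπ : X.IsProjection A π) {p n : ℤ} {u : List X.V →₀ R} (hu : u ∈ X.relFilt R A p n)
    (hgu : lmap R g.toFun u ∈ P.matchedFilt R A' π' p n) : u ∈ X.matchedFilt R A π p n := by
  refine mem_supported_of_lmap_mem (fun l hl hlU => ?_) hu hgu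
  have hD : ¬ IsMatched A π l := fun hD => hlU ⟨hl, Or.inl hD⟩
  have hle : ¬ X.LenLE l (p - 1) := fun hle => hlU ⟨hl, Or.inr hle⟩
  rcases eq_of_not_isMatched hA hl hD with hl' | ⟨x, l', rfl, hπx, hl'⟩
  · refine ⟨h.regList_map hl' hl.1, ?_, fun m _ e => h.eq_of_map_eq hl' e⟩
    rintro ⟨-, hD' | hle'⟩
    · match l, hl', hD' with
      | a :: y :: l, hl', hD' => exact hl' a (by simp) ((h.mem_iff a).1 hD'.1)
    · exact hle (hle'.of_le (h.len_map hl').ge)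
  · have hx : x ∉ A := hl' x (by simp)
    refine ⟨?_, ?_, ?_⟩
    · refine regList_cons_cons.2 ⟨fun e => hx ?_, h.regList_map hl' hl.1.tail⟩
      rw [← h.mem_iff, ← e]
      exact (h.mem_iff _).2 hπx
    · rintro ⟨-, hD' | hle'⟩
      · rcases hD'.2 with h1 | h1
        · exact hx ((h.mem_iff x).1 h1)
        · exact h1 (h.proj_eq x hx _ hπx).symm
      · exact hle (hle'.of_le (h.len_map_proj hπx hl').ge)
    · intro m hm e
      match m, e with
      | a :: m, e =>
        rw [List.map_cons, List.map_cons, List.cons.injEq] at e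
        obtain rfl := h.eq_of_map_eq hl' e.2
        by_contra hne
        have ha : a ∈ A := by
          rw [← h.mem_iff, e.1]
          exact (h.mem_iff _).2 hπx
        -- A second preimage (a, x, ...) with `a ≠ π x` is longer than (π x, x, ...) by at least
        -- one; if it has filtration `p`, the original list has filtration `p - 1`, which was
        -- excluded.
        refine hle (hm.2.2.2.of_add_one_le ?_)
        rw [len_cons_cons, len_cons_cons, add_right_comm]
        refine add_le_add (le_trans ?_ (hπ x a ha).2) le_rfl
        rw [add_comm]
        gcongr
        exact one_le_dist fun e' => hne (by rw [← e'])

/-- Excision for the second page. -/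
theorem e2Acyclic (h : IsRelativeIso g A A' π π') (hA : X.IsClosedBackwards A)
    (hπ : X.IsProjection A π) (hA' : P.IsClosedBackwards A') (hπ' : P.IsProjection A' π')
    (hX : E2Acyclic (bdry R A) (X.relFilt R A)) : E2Acyclic (bdry R A') (P.relFilt R A') :=
  E2Acyclic.of_contractible (f := lmap R g.toFun) (K := X.matchedFilt R A π)
    (K' := P.matchedFilt R A' π')
    (fun _ _ _ => bdry_mem) (fun _ _ _ => bdry_bdry hA) (fun _ _ _ => bdry_bdry hA')
    (fun _ _ _ => lmap_mem g h.mem_iff) (bdry_lmap R h.mem_iff)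
    (fun _ _ _ hp => relFilt_mono hp) (fun _ _ _ hp => relFilt_mono hp)
    matchedFilt_le relFilt_le_matchedFilt (fun _ _ _ => bdry_matchedFilt hπ')
    (fun _ _ _ => matchedFilt_contractible hA hπ)
    (fun _ _ _ hx hdx => by
      obtain ⟨e, he, he'⟩ := matchedFilt_contractible hA' hπ' hx hdx
      exact ⟨e, matchedFilt_le _ _ he, he'⟩)
    (fun _ _ _ => h.lmap_matchedFilt hπ) (fun _ _ _ => h.exists_lift hA' hπ)
    (fun _ _ _ => h.mem_matchedFilt hA hπ) hX

end IsRelativeIso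

end Excision

end DirGraph

/-! ### Cofibrations -/

namespace DirGraph

theorem comp_toFun {X Y Z : DirGraph.{u}} (f : X ⟶ Y) (g : Y ⟶ Z) (x : X.V) :
    (f ≫ g).toFun x = g.toFun (f.toFun x) := rfl

@[ext]
theorem hom_ext {X Y : DirGraph.{u}} {f g : X ⟶ Y} (h : ∀ x, f.toFun x = g.toFun x) : f = g :=
  Hom.ext (funext h)

section Cofibrations

variable {A X : DirGraph.{u}} {f : A ⟶ X}

/-- Tracing a path back from its end in the subgraph, no edge can have entered from outside, so the
whole path lies in the subgraph. Edges collapsed by equality of lifts (loops) are dropped, hence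
only `m ≤ n`. -/
theorem hasPath_lift (hf : IsInducedInclusion f)
    (hc : ∀ x y : X.V, x ∉ Set.range f.toFun → y ∈ Set.range f.toFun → ¬ X.Adj x y)
    {n : ℕ} {x : X.V} {b : A.V} (h : X.HasPath n x (f.toFun b)) :
    ∃ a, f.toFun a = x ∧ ∃ m ≤ n, A.HasPath m a b := by
  induction n generalizing x with
  | zero =>
    have : x = f.toFun b := h
    exact ⟨b, this.symm, 0, le_rfl, rfl⟩
  | succ n ih =>
    obtain ⟨y, hxy, hp⟩ := h
    obtain ⟨a, rfl, m, hm, ha⟩ := ih hp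
    have hx : x ∈ Set.range f.toFun := by
      by_contra hx
      exact hc x _ hx ⟨a, rfl⟩ hxy
    obtain ⟨c, rfl⟩ := hx
    refine ⟨c, rfl, ?_⟩
    by_cases e : c = a
    · subst e
      exact ⟨m, by omega, ha⟩
    · exact ⟨m + 1, by omega, a, hf.2 _ _ e hxy, ha⟩

theorem isClosedBackwards_range (hf : IsInducedInclusion f)
    (hc : ∀ x y : X.V, x ∉ Set.range f.toFun → y ∈ Set.range f.toFun → ¬ X.Adj x y) :
    X.IsClosedBackwards (Set.range f.toFun) := by
  rintro x _ hx ⟨b, rfl⟩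
  by_contra h
  obtain ⟨n, hn, -⟩ := exists_path_of_dist_ne_top h
  obtain ⟨a, rfl, -⟩ := hasPath_lift hf hc hn
  exact hx ⟨a, rfl⟩

theorem dist_eq_of_isInducedInclusion (hf : IsInducedInclusion f)
    (hc : ∀ x y : X.V, x ∉ Set.range f.toFun → y ∈ Set.range f.toFun → ¬ X.Adj x y)
    (a b : A.V) : X.dist (f.toFun a) (f.toFun b) = A.dist a b := by
  refine le_antisymm (dist_map_le f a b) (le_dist fun n hn => ?_)
  obtain ⟨a', e, m, hm, hp⟩ := hasPath_lift hf hc hn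
  obtain rfl := hf.1 e
  exact (dist_le hp).trans (by exact_mod_cast hm)

theorem cofibrations.injective (hf : cofibrations f) : Function.Injective f.toFun := hf.1.1

theorem cofibrations.isClosedBackwards (hf : cofibrations f) :
    X.IsClosedBackwards (Set.range f.toFun) := isClosedBackwards_range hf.1 hf.2.1

theorem cofibrations.dist_eq (hf : cofibrations f) (a b : A.V) :
    X.dist (f.toFun a) (f.toFun b) = A.dist a b := dist_eq_of_isInducedInclusion hf.1 hf.2.1 a b

theorem cofibrations.exists_projection (hf : cofibrations f) :
    ∃ π, X.IsProjection (Set.range f.toFun) π := by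
  have h : ∀ x, ∃ p, ∀ a ∈ Set.range f.toFun, p ∈ Set.range f.toFun ∧
      X.dist a p + X.dist p x ≤ X.dist a x := by
    intro x
    by_cases hx : x ∈ X.reach (Set.range f.toFun)
    · obtain ⟨p, hp, h⟩ := hf.2.2 x hx
      exact ⟨p, fun a ha => ⟨hp, (h a ha).ge⟩⟩
    · by_cases hA : (Set.range f.toFun).Nonempty
      · obtain ⟨p, hp⟩ := hA
        refine ⟨p, fun a ha => ⟨hp, ?_⟩⟩
        -- A vertex outside the reach is at infinite distance from `A`, so any vertex of `A` serves
        -- as its projection.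
        have : X.dist a x = ⊤ := by
          by_contra h
          exact hx ⟨a, ha, reaches_iff.2 h⟩
        rw [this]
        exact le_top
      · exact ⟨x, fun a ha => absurd ⟨a, ha⟩ hA⟩
  exact ⟨fun x => (h x).choose, fun x => (h x).choose_spec⟩

/-- A criterion for cofibrations in terms of distances. -/
theorem cofibrations_of (hf : IsInducedInclusion f)
    (hc : ∀ x y : X.V, x ∉ Set.range f.toFun → y ∈ Set.range f.toFun → ¬ X.Adj x y)
    (hp : ∀ x, x ∉ Set.range f.toFun → ∀ a₀, X.dist (f.toFun a₀) x ≠ ⊤ →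
      ∃ p, ∀ a, X.dist (f.toFun a) (f.toFun p) + X.dist (f.toFun p) x ≤ X.dist (f.toFun a) x) :
    cofibrations f := by
  refine ⟨hf, hc, ?_⟩
  rintro x ⟨_, ⟨a₀, rfl⟩, h⟩
  by_cases hx : x ∈ Set.range f.toFun
  · exact ⟨x, hx, fun a _ => by simp⟩
  · obtain ⟨p, hp⟩ := hp x hx a₀ (reaches_iff.1 h)
    refine ⟨f.toFun p, ⟨p, rfl⟩, ?_⟩
    rintro _ ⟨a, rfl⟩
    exact le_antisymm (dist_triangle _ _ _) (hp a)

variable {R : Type w} [CommRing R]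

/-! ### The filtered extension attached to a cofibration -/

theorem len_map_of_dist_eq (hd : ∀ a b, X.dist (f.toFun a) (f.toFun b) = A.dist a b)
    (l : List A.V) : X.len (l.map f.toFun) = A.len l := by
  induction l with
  | nil => rfl
  | cons x l ih =>
    cases l with
    | nil => rfl
    | cons y l =>
      rw [List.map_cons, List.map_cons, len_cons_cons, len_cons_cons, hd, ← List.map_cons, ih]

theorem regList_map_of_injective {V V' : Type u} {f : V → V'} (hf : Function.Injective f)
    {l : List V} (h : RegList l) : RegList (l.map f) := by
  induction l with
  | nil => exact List.isChain_nil
  | cons x l ih =>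
    cases l with
    | nil => exact List.isChain_singleton _
    | cons y l =>
      obtain ⟨h1, h2⟩ := regList_cons_cons.1 h
      exact regList_cons_cons.2 ⟨fun e => h1 (hf e), ih h2⟩

/-- An isometric embedding reflects the filtration. -/
theorem mem_relFilt_of_lmap_mem (hf : Function.Injective f.toFun)
    (hd : ∀ a b, X.dist (f.toFun a) (f.toFun b) = A.dist a b) {T : Set (List A.V)}
    (hT : ∀ l ∈ T, RegList l) {p n : ℤ} {c : List A.V →₀ R} (hc : c ∈ Finsupp.supported R R T)
    (h : lmap R f.toFun c ∈ X.relFilt R ∅ p n) : c ∈ A.relFilt R ∅ p n := by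
  refine mem_supported_of_lmap_mem (fun l hl hlU => ⟨regList_map_of_injective hf (hT l hl), ?_,
    fun m _ e => List.map_injective_iff.2 hf e⟩) hc h
  rintro ⟨h1, h2, h3, h4⟩
  refine hlU ⟨hT l hl, by simpa using h2, ?_, h4.of_le (len_map_of_dist_eq hd l).ge⟩
  exact (endsOutside_map (by simp) l).1 h3

theorem exists_map_eq_of_forall_mem_range {V V' : Type u} {f : V → V'} {m : List V'}
    (h : ∀ x ∈ m, x ∈ Set.range f) : ∃ l : List V, l.map f = m := by
  induction m with
  | nil => exact ⟨[], rfl⟩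
  | cons x m ih =>
    obtain ⟨a, rfl⟩ := h x (by simp)
    obtain ⟨l, rfl⟩ := ih fun y hy => h y (List.mem_cons_of_mem _ hy)
    exact ⟨a :: l, rfl⟩

/-- Lists in the image of an isometric embedding lift, with the same length. -/
theorem exists_lift_of_forall_mem_range
    (hd : ∀ a b, X.dist (f.toFun a) (f.toFun b) = A.dist a b) {p n : ℤ} {c : List X.V →₀ R}
    (hc : c ∈ Finsupp.supported R R {l | RegList l ∧ (l.length : ℤ) = n ∧ l ≠ [] ∧ X.LenLE l p ∧
      ∀ x ∈ l, x ∈ Set.range f.toFun}) :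
    ∃ a ∈ A.relFilt R ∅ p n, c = lmap R f.toFun a := by
  obtain ⟨a, ha, h⟩ := exists_lift_of_supported (f := f.toFun) (T := A.relTuples ∅ p n) (K' := ∅)
    (fun m hm => by
      obtain ⟨h1, h2, h3, h4, h5⟩ := hm
      obtain ⟨l, rfl⟩ := exists_map_eq_of_forall_mem_range h5
      exact Or.inl ⟨l, ⟨h1.of_map, by simpa using h2, endsOutside_empty.2 (by simpa using h3),
        h4.of_le (len_map_of_dist_eq hd l).ge⟩, h1, rfl⟩) hc
  refine ⟨a, ha, ?_⟩
  rw [Finsupp.supported_empty, Submodule.mem_bot, sub_eq_zero] at h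
  exact h

theorem outPart_outPart_empty {V : Type u} (S : Set V) (c : List V →₀ R) :
    outPart R S (outPart R ∅ c) = outPart R S c := by
  have : outPart R S ∘ₗ outPart R ∅ = outPart R S := list_hom_ext fun l => by
    by_cases h : l = []
    · subst h
      rw [LinearMap.comp_apply, outPart_single_of_not R (A := ∅) (by simp [EndsOutside]), map_zero,
        outPart_single_of_not R (by simp [EndsOutside])]
    · rw [LinearMap.comp_apply, outPart_single_of R (endsOutside_empty.2 h)]
  exact LinearMap.congr_fun this c

/-- For `A = ∅` only multiples of the empty list are discarded, and their boundary is zero; unlike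
`bdry_bdry`, this needs no finiteness of lengths. -/
theorem bdry_empty_bdry_empty {V : Type u} (c : List V →₀ R) :
    bdry R ∅ (bdry R ∅ c) = 0 := by
  have h : dd R (dd R c - outPart R ∅ (dd R c)) = 0 := by
    have h1 : dd R c - outPart R ∅ (dd R c) ∈ Finsupp.supported R R {[]} :=
      sub_outPart_mem (T := Set.univ) (by rw [Finsupp.supported_univ]; trivial) fun l _ h => by
        by_contra h'
        exact h (endsOutside_empty.2 h')
    have : dd R (dd R c - outPart R ∅ (dd R c)) ∈ (⊥ : Submodule R (List V →₀ R)) := by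
      refine mem_of_single_mem (fun l hl => ?_) h1
      obtain rfl : l = [] := hl
      simp [faces]
    simpa using this
  rw [map_sub, dd_dd, zero_sub, neg_eq_zero] at h
  rw [bdry_apply, bdry_apply, h, map_zero]

/-- The complement is spanned by the lists ending outside the image. The other lists of finite
length lie in the image and lift with equal length, because a cofibration is isometric; `drop` is
`dd_mem_drop`. -/
theorem isFilteredExtension (hf : cofibrations f) :
    IsFilteredExtension (bdry R ∅) (A.relFilt R ∅) (bdry R ∅) (X.relFilt R ∅)
      (X.relFilt R (Set.range f.toFun)) (lmap R f.toFun) (outPart R (Set.range f.toFun)) := by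
  have hA := hf.isClosedBackwards
  have hmem : ∀ {p n : ℤ} {x}, x ∈ X.relFilt R ∅ p n →
      x - outPart R (Set.range f.toFun) x ∈ Finsupp.supported R R {l | RegList l ∧
        (l.length : ℤ) = n ∧ l ≠ [] ∧ X.LenLE l p ∧ ∀ x ∈ l, x ∈ Set.range f.toFun} :=
    fun hx => sub_outPart_mem hx fun l hl h =>
      ⟨hl.1, hl.2.1, endsOutside_empty.1 hl.2.2.1, hl.2.2.2, hA.forall_mem hl.2.2.2.ne_top h⟩
  refine ⟨fun _ _ _ => bdry_mem, fun _ _ _ => lmap_mem f (by simp),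
    fun _ _ _ _ ha => mem_relFilt_of_lmap_mem hf.injective hf.dist_eq (fun l hl => hl.1) ha,
    fun a => (bdry_lmap R (by simp) a).symm, bdry_empty_bdry_empty, fun _ _ => ?_,
    fun _ _ _ => relFilt_mono, fun p n a ha => ?_, fun _ _ _ => outPart_relFilt,
    fun _ _ x hx => ?_, fun p n x hx => ?_, fun p n s hs => ?_⟩
  · exact Finsupp.supported_mono fun l hl =>
      ⟨hl.1, hl.2.1, endsOutside_empty.2 hl.2.2.1.ne_nil, hl.2.2.2⟩
  · refine outPart_eq_zero (T := {l | ∀ x ∈ l, x ∈ Set.range f.toFun}) ?_ ?_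
    · refine lext_mem (fun l hl => lgen_mem fun _ => ?_) ha
      intro x hx
      obtain ⟨a, -, rfl⟩ := List.mem_map.1 hx
      exact ⟨a, rfl⟩
    · intro l hl h
      obtain ⟨x, hx, hx'⟩ := h.exists_notMem
      exact hx' (hl x hx)
  · exact outPart_mem hx fun l hl h => ⟨hl.1, hl.2.1, h, hl.2.2.2⟩
  · obtain ⟨a, ha, e⟩ := exists_lift_of_forall_mem_range hf.dist_eq (hmem hx)
    exact ⟨a, ha, by rw [← e]; simp⟩
  · have h1 : bdry R ∅ s - outPart R (Set.range f.toFun) (bdry R ∅ s) ∈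
        Finsupp.supported R R {l | RegList l ∧ (l.length : ℤ) = n - 1 ∧ l ≠ [] ∧
          X.LenLE l (p - 1) ∧ ∀ x ∈ l, x ∈ Set.range f.toFun} := by
      refine sub_outPart_mem (outPart_mem (T' := _ ∩ {l | EndsOutside ∅ l}) (dd_mem_drop hs)
        fun l hl h => ⟨hl, h⟩) ?_
      rintro l ⟨⟨h1, h2, h3, h4⟩, h5⟩ h6
      have h5' := endsOutside_empty.1 h5
      exact ⟨h1, h2, h5', (h4.resolve_left h6).resolve_left h5', hA.forall_mem h3.ne_top h6⟩
    obtain ⟨a, ha, e⟩ := exists_lift_of_forall_mem_range hf.dist_eq h1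
    exact ⟨a, ha, by rw [← e]; simp⟩

/-- A cofibration induces an isomorphism on the second page if and only if the second page of the
relative complex vanishes. -/
theorem cofibrations.e2Iso_iff (hf : cofibrations f) :
    E2Iso (bdry R ∅) (A.relFilt R ∅) (bdry R ∅) (X.relFilt R ∅) (lmap R f.toFun) ↔
      E2Acyclic (bdry R (Set.range f.toFun)) (X.relFilt R (Set.range f.toFun)) := by
  rw [(isFilteredExtension hf).e2Iso_iff]
  have : outPart R (Set.range f.toFun) ∘ₗ bdry R ∅ = bdry R (Set.range f.toFun) :=
    LinearMap.ext fun c => outPart_outPart_empty _ _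
  rw [this]

end Cofibrations

end DirGraph

/-! ### Comparison of tuples and lists -/

namespace DirGraph

section Tuples

variable (R : Type w) [CommRing R] {V V' : Type u}

theorem regList_ofFn {k : ℕ} (x : Fin (k + 1) → V) : RegList (List.ofFn x) ↔ IsRegular x := by
  induction k with
  | zero => simp [IsRegular, RegList]
  | succ k ih =>
    rw [List.ofFn_succ, List.ofFn_succ, regList_cons_cons,
      ← List.ofFn_succ (f := fun i => x i.succ), ih]
    constructor
    · rintro ⟨h1, h2⟩ i
      induction i using Fin.cases with
      | zero => exact h1
      | succ i => exact h2 i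
    · exact fun h => ⟨h 0, fun i => h i.succ⟩

/-- Tuples, considered as lists. -/
noncomputable def toList (k : ℕ) : Chains R V k →ₗ[R] (List V →₀ R) :=
  Finsupp.lmapDomain R R List.ofFn

theorem toList_injective (k : ℕ) : Function.Injective (toList R k : Chains R V k →ₗ[R] _) :=
  Finsupp.mapDomain_injective List.ofFn_injective

@[simp]
theorem toList_single {k : ℕ} (x : Fin (k + 1) → V) (r : R) :
    toList R k (Finsupp.single x r) = Finsupp.single (List.ofFn x) r := by
  simp [toList]

theorem toList_gen {k : ℕ} (x : Fin (k + 1) → V) : toList R k (gen R x) = lgen R (List.ofFn x) := by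
  by_cases h : IsRegular x
  · rw [gen_of R h, toList_single, lgen_of R ((regList_ofFn x).2 h)]
  · rw [gen_of_not R h, map_zero, lgen_of_not R fun h' => h ((regList_ofFn x).1 h')]

theorem faces_ofFn {n : ℕ} (x : Fin (n + 1) → V) :
    faces R (List.ofFn x) =
      ∑ j : Fin (n + 1), (-1 : R) ^ (j : ℕ) • lgen R (List.ofFn fun i => x (j.succAbove i)) := by
  induction n with
  | zero => simp [faces]
  | succ n ih =>
    rw [List.ofFn_succ, faces, ih, map_sum, sub_eq_add_neg, ← Finset.sum_neg_distrib]
    refine Eq.trans ?_ (Fin.sum_univ_succ _).symm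
    congr 1
    · simp
    · refine Finset.sum_congr rfl fun j _ => ?_
      rw [map_smul, consMap_lgen, Fin.val_succ, pow_succ, mul_neg_one, neg_smul]
      congr 3
      rw [List.ofFn_succ]
      simp

variable {R} in
theorem chains_hom_ext {k : ℕ} {M : Type*} [AddCommGroup M] [Module R M]
    {f g : Chains R V k →ₗ[R] M}
    (h : ∀ x, f (Finsupp.single x 1) = g (Finsupp.single x 1)) : f = g := by
  ext x
  exact h x

/-- In degree zero the augmented face of a one-entry list is the empty list, which `outPart R ∅`
removes, in agreement with the convention that `boundary` vanishes there. -/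
theorem toList_boundary (k : ℕ) (c : Chains R V k) :
    toList R (k - 1) (boundary R V k c) = bdry R ∅ (toList R k c) := by
  have : toList R (k - 1) ∘ₗ boundary R V k = bdry R ∅ ∘ₗ toList R k := by
    refine chains_hom_ext fun x => ?_
    simp only [LinearMap.comp_apply, toList_single, bdry_apply, dd_single]
    rw [faces_ofFn]
    cases k with
    | zero =>
      rw [boundary, LinearMap.zero_apply, map_zero]
      refine (outPart_eq_zero (T := {[]}) ?_ fun l hl h => h.ne_nil hl).symm
      refine sum_mem fun j _ => Submodule.smul_mem _ _ (lgen_mem fun _ => ?_)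
      simp
    | succ k =>
      rw [outPart_of_mem (T := {l | l ≠ []}) (A := ∅) ?_ fun l hl => endsOutside_empty.2 hl]
      · simp only [boundary, Finsupp.linearCombination_single, one_smul]
        refine (map_sum (toList R k) _ _).trans ?_
        refine Finset.sum_congr rfl fun j _ => ?_
        rw [map_smul, toList_gen]
      · refine sum_mem fun j _ => Submodule.smul_mem _ _ (lgen_mem fun _ => ?_)
        simp
  exact LinearMap.congr_fun this c

theorem toList_chainMap (f : V → V') (k : ℕ) (c : Chains R V k) :
    toList R k (chainMap R f k c) = lmap R f (toList R k c) := by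
  have : toList R k ∘ₗ chainMap R f k = lmap R f ∘ₗ toList R k := chains_hom_ext fun x => by
    simp [chainMap, toList_gen, List.map_ofFn, Function.comp_def]
  exact LinearMap.congr_fun this c

theorem boundary_boundary (k : ℕ) (c : Chains R V k) :
    boundary R V (k - 1) (boundary R V k c) = 0 := by
  apply toList_injective
  rw [toList_boundary, toList_boundary, bdry_empty_bdry_empty, map_zero]

/-- The differential starting in positive degree. -/
noncomputable def boundarySucc (k : ℕ) : Chains R V (k + 1) →ₗ[R] Chains R V k :=
  boundary R V (k + 1)

theorem boundary_boundarySucc (k : ℕ) (c : Chains R V (k + 1)) :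
    boundary R V k (boundarySucc R k c) = 0 :=
  boundary_boundary R (k + 1) c

theorem toList_boundarySucc (k : ℕ) (c : Chains R V (k + 1)) :
    toList R k (boundarySucc R k c) = bdry R ∅ (toList R (k + 1) c) :=
  toList_boundary R (k + 1) c

variable {G H : DirGraph.{u}}

theorem len_ofFn {k : ℕ} (x : Fin (k + 1) → G.V) : G.len (List.ofFn x) = G.length x := by
  induction k with
  | zero => simp [length, len]
  | succ k ih =>
    rw [List.ofFn_succ, List.ofFn_succ, len_cons_cons,
      ← List.ofFn_succ (f := fun i => x i.succ), ih, length, length, Fin.sum_univ_succ]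
    rfl

theorem ofFn_mem_relTuples_iff {k : ℕ} (x : Fin (k + 1) → G.V) (p : ℤ) :
    List.ofFn x ∈ G.relTuples ∅ p (k + 1) ↔
      x ∈ G.reachTuples k ∧ ∃ n : ℕ, G.length x = n ∧ (n : ℤ) ≤ p := by
  simp only [relTuples, Set.mem_ofPred_eq, regList_ofFn, List.length_ofFn, endsOutside_empty,
    LenLE, len_ofFn, reachTuples]
  constructor
  · rintro ⟨h1, -, -, n, h2, h3⟩
    have hne := ne_top_of_le_ne_top (ENat.natCast_ne_top n) h2
    obtain ⟨m, hm⟩ := ENat.ne_top_iff_exists.mp hne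
    refine ⟨⟨h1, fun i => reaches_iff.2 ?_⟩, m, hm.symm, ?_⟩
    · refine ne_top_of_le_ne_top hne ?_
      exact Finset.single_le_sum (f := fun i : Fin k => G.dist (x i.castSucc) (x i.succ))
        (fun _ _ => bot_le) (Finset.mem_univ i)
    · rw [← hm] at h2
      have : m ≤ n := by exact_mod_cast h2
      omega
  · rintro ⟨⟨h1, -⟩, n, h2, h3⟩
    exact ⟨h1, by push_cast; rfl, by simp, n, h2.le, h3⟩

/-- Lists are graded by their number of entries, so degree `k` corresponds to `k + 1`. -/
theorem toList_mem_relFilt_iff {k : ℕ} {c : Chains R G.V k} {p : ℤ} :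
    toList R k c ∈ G.relFilt R ∅ p (k + 1) ↔ c ∈ G.filt R p k := by
  constructor
  · intro h x hx
    refine (ofFn_mem_relTuples_iff x p).1 (h ?_)
    have : toList R k c (List.ofFn x) = c x := Finsupp.mapDomain_apply List.ofFn_injective c x
    rw [Finset.mem_coe, Finsupp.mem_support_iff, this]
    exact Finsupp.mem_support_iff.1 hx
  · intro h
    rw [relFilt, Finsupp.mem_supported]
    intro l hl
    classical
    obtain ⟨x, hx, rfl⟩ := Finset.mem_image.1 (Finsupp.mapDomain_support hl)
    exact (ofFn_mem_relTuples_iff x p).2 (h hx)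

theorem exists_toList_eq {k : ℕ} {p : ℤ} {c : List G.V →₀ R}
    (hc : c ∈ G.relFilt R ∅ p (k + 1)) : ∃ c' ∈ G.filt R p k, toList R k c' = c := by
  have : c ∈ (G.filt R p k).map (toList R k) := by
    refine mem_of_single_mem (f := LinearMap.id) (fun l hl => ?_) hc
    have hlen : l.length = k + 1 := by exact_mod_cast hl.2.1
    obtain ⟨x, rfl⟩ : ∃ x : Fin (k + 1) → G.V, List.ofFn x = l := by
      rw [← hlen]
      exact ⟨l.get, List.ofFn_get l⟩
    refine ⟨Finsupp.single x 1, ?_, by simp⟩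
    exact Finsupp.single_mem_supported R _ ((ofFn_mem_relTuples_iff x p).1 hl)
  exact this

theorem relFilt_eq_bot {A : Set G.V} {p n : ℤ} (hn : n ≤ 0) : G.relFilt R A p n = ⊥ := by
  rw [relFilt, eq_bot_iff, ← Finsupp.supported_empty]
  refine Finsupp.supported_mono fun l hl => ?_
  have h1 := hl.2.1
  have h2 := List.length_pos_iff.2 hl.2.2.1.ne_nil
  omega

theorem toList_pred_mem_relFilt {k : ℕ} {c : Chains R G.V k} {p : ℤ} :
    toList R (k - 1) (boundary R G.V k c) ∈ G.relFilt R ∅ p k ↔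
      boundary R G.V k c ∈ G.filt R p (k - 1) := by
  cases k with
  | zero => simp [boundary]
  | succ k =>
    rw [← toList_mem_relFilt_iff]
    simp

theorem filt_mono {p q : ℤ} (h : p ≤ q) (k : ℕ) : G.filt R p k ≤ G.filt R q k :=
  Finsupp.supported_mono fun _ ⟨h1, n, h2, h3⟩ => ⟨h1, n, h2, h3.trans h⟩

/-- The boundary conditions built into `pageZ R 1` are automatic: the remainder has the same
boundary as `c`, and the boundary of `v` differs from `c` by a chain of filtration `p - 1`. -/
theorem mem_pageB_two_iff {p : ℤ} {k : ℕ} {c : Chains R G.V k} (hc : c ∈ G.pageZ R 2 p k) :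
    c ∈ G.pageB R 2 p k ↔
      ∃ v ∈ G.filt R (p + 1) (k + 1), c - boundarySucc R k v ∈ G.filt R (p - 1) k := by
  have e1 : p + 2 - 1 = p + 1 := by ring
  have e2 : (2 : ℤ) - 1 = 1 := rfl
  constructor
  · intro h
    obtain ⟨y, hy, _, ⟨v, hv, rfl⟩, e⟩ := Submodule.mem_sup.1 h
    rw [e1] at hv
    refine ⟨v, hv.1, ?_⟩
    have e3 : c - boundarySucc R k v = y := sub_eq_of_eq_add e.symm
    rw [e3]
    exact hy.1
  · rintro ⟨v, hv, h⟩
    refine Submodule.mem_sup.2 ⟨_, ⟨h, ?_⟩, _, ⟨v, ⟨?_, ?_⟩, rfl⟩, sub_add_cancel _ _⟩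
    · change boundary R G.V k (c - boundarySucc R k v) ∈ G.filt R (p - 1 - (2 - 1)) (k - 1)
      rw [map_sub, boundary_boundarySucc, sub_zero, e2, show p - 1 - 1 = p - 2 by ring]
      exact hc.2
    · rw [e1]
      exact hv
    · change boundarySucc R k v ∈ G.filt R _ k
      rw [e1, e2, add_sub_cancel_right]
      have := sub_mem hc.1 (filt_mono R (by omega) k h)
      simpa using this

theorem mem_pageZ_two_iff {p : ℤ} {k : ℕ} {c : Chains R G.V k} :
    c ∈ G.pageZ R 2 p k ↔ toList R k c ∈ G.relFilt R ∅ p (k + 1) ∧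
      bdry R ∅ (toList R k c) ∈ G.relFilt R ∅ (p - 2) ((k + 1 : ℤ) - 1) := by
  rw [toList_mem_relFilt_iff, add_sub_cancel_right, ← toList_boundary, toList_pred_mem_relFilt]
  rfl

theorem mem_pageB_two_iff_list {p : ℤ} {k : ℕ} {c : Chains R G.V k} (hc : c ∈ G.pageZ R 2 p k) :
    c ∈ G.pageB R 2 p k ↔ ∃ v ∈ G.relFilt R ∅ (p + 1) (k + 1 + 1),
      toList R k c - bdry R ∅ v ∈ G.relFilt R ∅ (p - 1) (k + 1) := by
  rw [mem_pageB_two_iff R hc]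
  constructor
  · rintro ⟨v, hv, h⟩
    refine ⟨toList R (k + 1) v, ?_, ?_⟩
    · have := (toList_mem_relFilt_iff R).2 hv
      exact_mod_cast this
    · rw [← toList_boundarySucc, ← map_sub]
      exact (toList_mem_relFilt_iff R).2 h
  · rintro ⟨v, hv, h⟩
    obtain ⟨v, hv', rfl⟩ := exists_toList_eq R (k := k + 1) (p := p + 1) (c := v)
      (by exact_mod_cast hv)
    refine ⟨v, hv', ?_⟩
    rw [← toList_boundarySucc, ← map_sub] at h
    exact (toList_mem_relFilt_iff R).1 h

/-! ### Injectivity and surjectivity on subquotients -/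

section

variable {R} {M N : Type v} [AddCommGroup M] [Module R M] [AddCommGroup N] [Module R N]
  (g : M →ₗ[R] N) {Z B : Submodule R M} {Z' B' : Submodule R N}
  (hZ : Z ≤ Z'.comap g) (hB : B ≤ B'.comap g)

theorem subQuot_mk_eq_zero_iff (z : Z) :
    (Submodule.Quotient.mk z : SubQuot Z B) = 0 ↔ (z : M) ∈ B :=
  Submodule.Quotient.mk_eq_zero _

theorem subQuotMap_mk (z : Z) :
    subQuotMap g hZ hB (Submodule.Quotient.mk z) = Submodule.Quotient.mk ⟨g z, hZ z.2⟩ := rfl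

theorem subQuotMap_injective_iff :
    Function.Injective (subQuotMap g hZ hB) ↔ ∀ a ∈ Z, g a ∈ B' → a ∈ B := by
  rw [injective_iff_map_eq_zero]
  constructor
  · intro h a ha hga
    have := h (Submodule.Quotient.mk ⟨a, ha⟩) (by
      rw [subQuotMap_mk, subQuot_mk_eq_zero_iff]
      exact hga)
    exact (subQuot_mk_eq_zero_iff _).1 this
  · intro h x
    induction x using Submodule.Quotient.induction_on with
    | H x =>
      rw [subQuotMap_mk, subQuot_mk_eq_zero_iff, subQuot_mk_eq_zero_iff]
      exact h x.1 x.2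

theorem subQuotMap_surjective_iff :
    Function.Surjective (subQuotMap g hZ hB) ↔ ∀ x ∈ Z', ∃ a ∈ Z, x - g a ∈ B' := by
  constructor
  · intro h x hx
    obtain ⟨y, hy⟩ := h (Submodule.Quotient.mk ⟨x, hx⟩)
    induction y using Submodule.Quotient.induction_on with
    | H y =>
      rw [subQuotMap_mk, eq_comm, ← sub_eq_zero, ← Submodule.Quotient.mk_sub,
        subQuot_mk_eq_zero_iff] at hy
      exact ⟨y.1, y.2, hy⟩
  · intro h x
    induction x using Submodule.Quotient.induction_on with
    | H x =>
      obtain ⟨a, ha, hxa⟩ := h x.1 x.2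
      refine ⟨Submodule.Quotient.mk ⟨a, ha⟩, ?_⟩
      rw [subQuotMap_mk, eq_comm, ← sub_eq_zero, ← Submodule.Quotient.mk_sub,
        subQuot_mk_eq_zero_iff]
      exact hxa

end

theorem injective_iff_e2Injective (f : G ⟶ H) (k : ℕ) (l : ℤ) :
    Function.Injective (bigradedPathHomologyMap R f k l) ↔
      E2Injective (bdry R ∅) (G.relFilt R ∅) (bdry R ∅) (H.relFilt R ∅) (lmap R f.toFun)
        l (k + 1) := by
  rw [bigradedPathHomologyMap, pageMap, subQuotMap_injective_iff]
  constructor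
  · intro h a ha hda v hv hav
    obtain ⟨a, ha', rfl⟩ := exists_toList_eq R ha
    have hZ := (mem_pageZ_two_iff R).2 ⟨ha, hda⟩
    rw [← mem_pageB_two_iff_list R hZ]
    refine h a hZ ((mem_pageB_two_iff_list R (pageZ_le_comap R f _ _ _ hZ)).2 ⟨v, hv, ?_⟩)
    rwa [toList_chainMap]
  · intro h a hZ hB
    rw [mem_pageB_two_iff_list R (pageZ_le_comap R f _ _ _ hZ), toList_chainMap] at hB
    obtain ⟨v, hv, hav⟩ := hB
    rw [mem_pageB_two_iff_list R hZ]
    obtain ⟨h1, h2⟩ := (mem_pageZ_two_iff R).1 hZ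
    exact h _ h1 h2 v hv hav

theorem surjective_iff_e2Surjective (f : G ⟶ H) (k : ℕ) (l : ℤ) :
    Function.Surjective (bigradedPathHomologyMap R f k l) ↔
      E2Surjective (bdry R ∅) (G.relFilt R ∅) (bdry R ∅) (H.relFilt R ∅) (lmap R f.toFun)
        l (k + 1) := by
  rw [bigradedPathHomologyMap, pageMap, subQuotMap_surjective_iff]
  constructor
  · intro h x hx hdx
    obtain ⟨x, hx', rfl⟩ := exists_toList_eq R hx
    have hZ := (mem_pageZ_two_iff R).2 ⟨hx, hdx⟩
    obtain ⟨a, ha, hxa⟩ := h x hZ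
    rw [mem_pageB_two_iff_list R (sub_mem hZ (pageZ_le_comap R f _ _ _ ha)), map_sub,
      toList_chainMap] at hxa
    obtain ⟨h1, h2⟩ := (mem_pageZ_two_iff R).1 ha
    exact ⟨_, h1, h2, hxa⟩
  · intro h x hZ
    obtain ⟨h1, h2⟩ := (mem_pageZ_two_iff R).1 hZ
    obtain ⟨a, h3, h4, h5⟩ := h _ h1 h2
    obtain ⟨a, -, rfl⟩ := exists_toList_eq R h3
    have ha := (mem_pageZ_two_iff R).2 ⟨h3, h4⟩
    refine ⟨a, ha, ?_⟩
    rw [mem_pageB_two_iff_list R (sub_mem hZ (pageZ_le_comap R f _ _ _ ha)), map_sub,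
      toList_chainMap]
    exact h5

/-- The weak equivalences in terms of elements of the list complexes. -/
theorem bigradedPathHomologyIsos_iff (f : G ⟶ H) :
    bigradedPathHomologyIsos R f ↔
      E2Iso (bdry R ∅) (G.relFilt R ∅) (bdry R ∅) (H.relFilt R ∅) (lmap R f.toFun) := by
  constructor
  · intro h p n
    -- Nonempty lists have at least one entry, so the list complex vanishes for `n ≤ 0`, where no
    -- tuple degree corresponds.
    rcases le_or_gt n 0 with hn | hn
    · refine ⟨fun a ha _ _ _ _ => ⟨0, zero_mem _, ?_⟩, fun x hx _ => ⟨0, zero_mem _, ?_, 0,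
        zero_mem _, ?_⟩⟩
      · rw [relFilt_eq_bot R hn] at ha
        rw [(Submodule.mem_bot R).1 ha]
        simp
      · simp
      · rw [relFilt_eq_bot R hn] at hx
        rw [(Submodule.mem_bot R).1 hx]
        simp
    · obtain ⟨k, rfl⟩ : ∃ k : ℕ, n = k + 1 := ⟨(n - 1).toNat, by omega⟩
      exact ⟨(injective_iff_e2Injective R f k p).1 (h k p).1,
        (surjective_iff_e2Surjective R f k p).1 (h k p).2⟩
  · exact fun h k l => ⟨(injective_iff_e2Injective R f k l).2 (h l _).1,
      (surjective_iff_e2Surjective R f k l).2 (h l _).2⟩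

end Tuples

/-! ### Functoriality of bigraded path homology -/

section Functor

variable (R : Type w) [CommRing R] {G H K : DirGraph.{u}}

theorem lmap_id_of_mem {A : Set G.V} {p n : ℤ} {c : List G.V →₀ R} (hc : c ∈ G.relFilt R A p n) :
    lmap R (fun x => x) c = c := by
  have : (lmap R (fun x => x) - LinearMap.id : (List G.V →₀ R) →ₗ[R] (List G.V →₀ R)) c ∈
      (⊥ : Submodule R (List G.V →₀ R)) :=
    mem_of_single_mem (fun l hl => by simp [lgen_of R hl.1]) hc
  rw [Submodule.mem_bot, LinearMap.sub_apply, sub_eq_zero] at this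
  exact this

theorem bigradedPathHomologyMap_id (k : ℕ) (l : ℤ) :
    bigradedPathHomologyMap R (𝟙 G) k l = LinearMap.id := by
  refine LinearMap.ext fun x => ?_
  induction x using Submodule.Quotient.induction_on with
  | H x =>
    refine congrArg _ (Subtype.ext (toList_injective R k ?_))
    refine (toList_chainMap R _ k _).trans ?_
    exact lmap_id_of_mem R ((mem_pageZ_two_iff R).1 x.2).1

theorem bigradedPathHomologyMap_comp (f : G ⟶ H) (g : H ⟶ K) (k : ℕ) (l : ℤ) :
    bigradedPathHomologyMap R (f ≫ g) k l =
      bigradedPathHomologyMap R g k l ∘ₗ bigradedPathHomologyMap R f k l := by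
  refine LinearMap.ext fun x => ?_
  induction x using Submodule.Quotient.induction_on with
  | H x =>
    refine congrArg _ (Subtype.ext (toList_injective R k ?_))
    refine (toList_chainMap R _ k _).trans ?_
    refine Eq.trans ?_ (toList_chainMap R _ k _).symm
    refine Eq.trans ?_ (congrArg (lmap R g.toFun)
      (toList_chainMap R f.toFun k (x : Chains R G.V k)).symm)
    rw [lmap_lmap]
    rfl

theorem bigradedPathHomologyIsos_comp {f : G ⟶ H} {g : H ⟶ K} (hf : bigradedPathHomologyIsos R f)
    (hg : bigradedPathHomologyIsos R g) : bigradedPathHomologyIsos R (f ≫ g) := fun k l => by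
  rw [bigradedPathHomologyMap_comp]
  exact (hg k l).comp (hf k l)

theorem bigradedPathHomologyIsos_id (G : DirGraph.{u}) : bigradedPathHomologyIsos R (𝟙 G) :=
  fun k l => by
    rw [bigradedPathHomologyMap_id]
    exact Function.bijective_id

/-- The middle map is surjective by the first composite and injective by the second; the outer maps
follow by cancellation. -/
theorem bigradedPathHomologyIsos_two_of_six {L : DirGraph.{u}} {f : G ⟶ H} {g : H ⟶ K} {h : K ⟶ L}
    (hfg : bigradedPathHomologyIsos R (f ≫ g)) (hgh : bigradedPathHomologyIsos R (g ≫ h)) :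
    bigradedPathHomologyIsos R f ∧ bigradedPathHomologyIsos R g ∧
      bigradedPathHomologyIsos R h := by
  have hg : bigradedPathHomologyIsos R g := fun k l => by
    have h1 := hfg k l
    have h2 := hgh k l
    rw [bigradedPathHomologyMap_comp, LinearMap.coe_comp] at h1 h2
    exact ⟨h2.1.of_comp, h1.2.of_comp⟩
  refine ⟨fun k l => ?_, hg, fun k l => ?_⟩
  · have h1 := hfg k l
    rw [bigradedPathHomologyMap_comp, LinearMap.coe_comp] at h1
    exact (Function.Bijective.of_comp_iff' (hg k l) _).1 h1
  · have h2 := hgh k l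
    rw [bigradedPathHomologyMap_comp, LinearMap.coe_comp] at h2
    exact (Function.Bijective.of_comp_iff _ (hg k l)).1 h2

theorem bigradedPathHomologyIsos_of_iso (e : G ≅ H) : bigradedPathHomologyIsos R e.hom := by
  refine (bigradedPathHomologyIsos_two_of_six R (f := e.hom) (g := e.inv) (h := e.hom) ?_ ?_).1
  · rw [e.hom_inv_id]
    exact bigradedPathHomologyIsos_id R G
  · rw [e.inv_hom_id]
    exact bigradedPathHomologyIsos_id R H

end Functor

/-! ### Homotopy invariance -/

section Homotopy

variable (R : Type w) [CommRing R] {V V' : Type u} (f g : V → V')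

/-- The prism operator. -/
noncomputable def prismList : List V → (List V' →₀ R)
  | [] => 0
  | x :: l => lgen R (f x :: g x :: l.map g) - consMap R (f x) (prismList l)

theorem prismList_of_not {l : List V} (h : ¬ RegList l) : prismList R f g l = 0 := by
  induction l with
  | nil => rfl
  | cons x l ih =>
    rcases not_regList_cons h with h' | ⟨l', rfl⟩
    · rw [prismList, ih h', map_zero, sub_zero]
      exact lgen_of_not R fun h'' => h' h''.tail.tail.of_map
    · rw [prismList, prismList, map_sub, consMap_consMap_self, sub_zero, consMap_lgen,
        lgen_of_not, lgen_of_not, sub_zero]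
      · exact fun h => (regList_cons_cons.1 h).1 rfl
      · exact fun h => (regList_cons_cons.1 h.tail).1 rfl

theorem normalize_prismList (l : List V) :
    normalize R (prismList R f g l) = prismList R f g l := by
  cases l with
  | nil => simp [prismList]
  | cons x l => rw [prismList, map_sub, normalize_lgen, normalize_consMap]

/-- Linear extension of the prism operator. -/
noncomputable def prism : (List V →₀ R) →ₗ[R] (List V' →₀ R) := lext (prismList R f g)

@[simp]
theorem prism_single (l : List V) : prism R f g (Finsupp.single l 1) = prismList R f g l := by
  simp [prism]

theorem prism_lgen (l : List V) : prism R f g (lgen R l) = prismList R f g l :=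
  lext_lgen (fun _ h => prismList_of_not R f g h) l

theorem prism_consMap (x : V) (c : List V →₀ R) :
    prism R f g (consMap R x c) =
      consMap R (f x) (consMap R (g x) (lmap R g c)) - consMap R (f x) (prism R f g c) := by
  have : prism R f g ∘ₗ consMap R x = consMap R (f x) ∘ₗ consMap R (g x) ∘ₗ lmap R g -
      consMap R (f x) ∘ₗ prism R f g := list_hom_ext fun l => by
    simp [prism_lgen, consMap_lgen, prismList]
  exact LinearMap.congr_fun this c

theorem dd_prismList (l : List V) :
    dd R (prismList R f g l) + prism R f g (faces R l) =
      lgen R (l.map g) - lgen R (l.map f) := by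
  induction l with
  | nil => simp [prismList, faces]
  | cons x l ih =>
    have e : consMap R (f x) (dd R (prismList R f g l)) +
        consMap R (f x) (prism R f g (faces R l)) =
        lgen R (f x :: l.map g) - lgen R (f x :: l.map f) := by
      rw [← map_add, ih, map_sub, consMap_lgen, consMap_lgen]
    rw [prismList, map_sub, dd_lgen, dd_consMap, normalize_prismList, faces, faces, faces, map_sub,
      map_sub, prism_consMap, prism_lgen, lmap_faces, consMap_lgen, List.map_cons, List.map_cons]
    rw [← eq_sub_iff_add_eq] at e
    rw [e]
    abel

theorem dd_prism (c : List V →₀ R) :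
    dd R (prism R f g c) + prism R f g (dd R c) = lmap R g c - lmap R f c := by
  have : dd R ∘ₗ prism R f g + prism R f g ∘ₗ dd R = lmap R g - lmap R f :=
    list_hom_ext fun l => by simpa using dd_prismList R f g l
  exact LinearMap.congr_fun this c

theorem bdry_prism (c : List V →₀ R) :
    bdry R ∅ (prism R f g c) + outPart R ∅ (prism R f g (bdry R ∅ c)) =
      outPart R ∅ (lmap R g c) - outPart R ∅ (lmap R f c) := by
  have h : prism R f g (dd R c - outPart R ∅ (dd R c)) = 0 := by
    have h1 : dd R c - outPart R ∅ (dd R c) ∈ Finsupp.supported R R {[]} :=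
      sub_outPart_mem (T := Set.univ) (by rw [Finsupp.supported_univ]; trivial) fun l _ h => by
        by_contra h'
        exact h (endsOutside_empty.2 h')
    have : prism R f g (dd R c - outPart R ∅ (dd R c)) ∈ (⊥ : Submodule R (List V' →₀ R)) := by
      refine mem_of_single_mem (fun l hl => ?_) h1
      obtain rfl : l = [] := hl
      simp [prismList]
    simpa using this
  rw [map_sub, sub_eq_zero] at h
  rw [← map_sub, ← dd_prism, h, map_add]
  rfl

variable {R} {G H : DirGraph.{u}} {f g : G ⟶ H}

/-- Each term of the prism crosses from `f` to `g` once, along an edge or a constant step, so it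
costs at most one unit of length. -/
theorem prismList_mem_prefix (h : ∀ x, f.toFun x = g.toFun x ∨ H.Adj (f.toFun x) (g.toFun x))
    (y : G.V) (l : List G.V) : prismList R f.toFun g.toFun l ∈ Finsupp.supported R R
      {m | m.length = l.length + 1 ∧ H.len (f.toFun y :: m) ≤ G.len (y :: l) + 1} := by
  induction l generalizing y with
  | nil => exact zero_mem _
  | cons x l ih =>
    refine sub_mem (lgen_mem fun _ => ⟨by simp, ?_⟩) (consMap_mem ?_)
    · calc H.dist (f.toFun y) (f.toFun x) + (H.dist (f.toFun x) (g.toFun x) +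
            H.len ((x :: l).map g.toFun)) ≤ G.dist y x + (1 + G.len (x :: l)) :=
            add_le_add (dist_map_le f y x) (add_le_add (dist_le_one (h x)) (len_map_le g _))
        _ = G.dist y x + G.len (x :: l) + 1 := by rw [add_comm 1, add_assoc]
    · refine Finsupp.supported_mono (fun m hm _ => ⟨by simpa using hm.1, ?_⟩) (ih x)
      rw [len_cons_cons, len_cons_cons, add_assoc]
      exact add_le_add (dist_map_le f y x) hm.2

theorem prism_mem (h : ∀ x, f.toFun x = g.toFun x ∨ H.Adj (f.toFun x) (g.toFun x)) {p n : ℤ}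
    {c : List G.V →₀ R} (hc : c ∈ G.relFilt R ∅ p n) :
    prism R f.toFun g.toFun c ∈ H.relFilt R ∅ (p + 1) (n + 1) := by
  refine lext_mem (fun l hl => ?_) hc
  suffices h1 : prismList R f.toFun g.toFun l ∈ Finsupp.supported R R
      {m | RegList m ∧ m.length = l.length + 1 ∧ H.len m ≤ G.len l + 1} by
    refine Finsupp.supported_mono ?_ h1
    refine fun m hm => ⟨hm.1, ?_, endsOutside_empty.2 ?_, hl.2.2.2.add_one hm.2.2⟩
    · have := hm.2.1
      have := hl.2.1
      omega
    · rintro rfl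
      exact absurd hm.2.1 (by simp)
  cases l with
  | nil => exact zero_mem _
  | cons x l =>
    refine sub_mem (lgen_mem fun hreg => ⟨hreg, by simp, ?_⟩) (consMap_mem ?_)
    · rw [len_cons_cons, ← List.map_cons, add_comm]
      exact add_le_add (len_map_le g _) (dist_le_one (h x))
    · exact Finsupp.supported_mono (fun m hm hreg => ⟨hreg, by simpa using hm.1, hm.2⟩)
        (prismList_mem_prefix h x l)

/-- Maps that differ by edges induce the same map on bigraded path homology. -/
theorem bigradedPathHomologyMap_eq_of_adj
    (h : ∀ x, f.toFun x = g.toFun x ∨ H.Adj (f.toFun x) (g.toFun x)) (k : ℕ) (l : ℤ) :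
    bigradedPathHomologyMap R f k l = bigradedPathHomologyMap R g k l := by
  refine LinearMap.ext fun x => ?_
  induction x using Submodule.Quotient.induction_on with
  | H x =>
    obtain ⟨h1, h2⟩ := (mem_pageZ_two_iff R).1 x.2
    rw [add_sub_cancel_right] at h2
    rw [bigradedPathHomologyMap, bigradedPathHomologyMap, pageMap, pageMap, subQuotMap_mk,
      subQuotMap_mk, eq_comm, ← sub_eq_zero, ← Submodule.Quotient.mk_sub, subQuot_mk_eq_zero_iff]
    refine (mem_pageB_two_iff_list R (sub_mem (pageZ_le_comap R g _ _ _ x.2)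
      (pageZ_le_comap R f _ _ _ x.2))).2 ⟨_, prism_mem h h1, ?_⟩
    have h3 := bdry_prism R f.toFun g.toFun (toList R k (x : Chains R G.V k))
    have h4 := prism_mem h h2
    rw [outPart_relFilt h4, outPart_relFilt (lmap_mem f (by simp) h1),
      outPart_relFilt (lmap_mem g (by simp) h1)] at h3
    rw [map_sub, toList_chainMap, toList_chainMap, ← h3, add_sub_cancel_left]
    -- The boundary lowers the filtration by two and the prism raises it by one, so the error has
    -- filtration `l - 1` and vanishes on the second page; on the first page it need not vanish.
    rwa [show l - 2 + 1 = l - 1 by ring] at h4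

end Homotopy

/-! ### Ordinary path homology -/

section PathHomology

variable (R : Type w) [CommRing R] {G H : DirGraph.{u}}

theorem adj_of_dist_le_one {x y : G.V} (hne : x ≠ y) (h : G.dist x y ≤ 1) : G.Adj x y := by
  obtain ⟨n, hn, e⟩ := exists_path_of_dist_ne_top (ne_top_of_le_ne_top ENat.one_ne_top h)
  rw [e] at h
  have h' : n ≤ 1 := by exact_mod_cast h
  interval_cases n
  · exact absurd hn hne
  · obtain ⟨z, hz, rfl⟩ := hn
    exact hz

theorem le_length {k : ℕ} {x : Fin (k + 1) → G.V} (hx : IsRegular x) : (k : ℕ∞) ≤ G.length x := by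
  calc (k : ℕ∞) = ∑ _i : Fin k, (1 : ℕ∞) := by simp
    _ ≤ G.length x := Finset.sum_le_sum fun i _ => one_le_dist (hx i)

/-- Each of the `k` steps costs at least one, so a step of length two would already force length `k
+ 1`. -/
theorem adj_of_length_le {k : ℕ} {x : Fin (k + 1) → G.V} (hx : IsRegular x)
    (h : G.length x ≤ k) (i : Fin k) : G.Adj (x i.castSucc) (x i.succ) := by
  refine adj_of_dist_le_one (hx i) ?_
  by_contra hlt
  rw [not_le] at hlt
  classical
  have h1 : G.length x = G.dist (x i.castSucc) (x i.succ) +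
      ∑ j ∈ Finset.univ.erase i, G.dist (x j.castSucc) (x j.succ) :=
    (Finset.add_sum_erase _ _ (Finset.mem_univ i)).symm
  have h2 : ((k - 1 : ℕ) : ℕ∞) ≤ ∑ j ∈ Finset.univ.erase i, G.dist (x j.castSucc) (x j.succ) := by
    calc ((k - 1 : ℕ) : ℕ∞) = ∑ _j ∈ Finset.univ.erase i, (1 : ℕ∞) := by simp
      _ ≤ _ := Finset.sum_le_sum fun j _ => one_le_dist (hx j)
  have h3 : (2 : ℕ∞) + ((k - 1 : ℕ) : ℕ∞) ≤ k := by
    refine le_trans (add_le_add ?_ h2) (h1 ▸ h)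
    rw [← one_add_one_eq_two]
    exact Order.add_one_le_of_lt hlt
  have h4 : 2 + (k - 1) ≤ k := by exact_mod_cast h3
  have := i.pos
  omega

theorem allowed_eq_filt (k : ℕ) : G.allowed R k = G.filt R k k := by
  rw [allowed, filt]
  congr 1
  ext x
  constructor
  · rintro ⟨h1, h2⟩
    have h3 : G.length x ≤ k := by
      calc G.length x ≤ ∑ _i : Fin k, (1 : ℕ∞) :=
            Finset.sum_le_sum fun i _ => dist_le_one_of_adj (h2 i)
        _ = k := by simp
    exact ⟨⟨h1, fun i => ⟨1, _, h2 i, rfl⟩⟩, k, le_antisymm h3 (le_length h1), le_rfl⟩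
  · rintro ⟨⟨h1, -⟩, n, h2, h3⟩
    refine ⟨h1, adj_of_length_le h1 ?_⟩
    rw [h2]
    exact_mod_cast h3

theorem filt_eq_bot {p : ℤ} {k : ℕ} (h : p < k) : G.filt R p k = ⊥ := by
  rw [filt, eq_bot_iff, ← Finsupp.supported_empty]
  refine Finsupp.supported_mono ?_
  rintro x ⟨⟨h1, -⟩, n, h2, h3⟩
  have h4 := le_length h1
  rw [h2] at h4
  have : k ≤ n := by exact_mod_cast h4
  omega

/-- On the diagonal the boundary must lie in a filtration step below the minimal length of a regular
tuple, which is zero; so the condition says that the chain is a cycle. -/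
theorem pathCycles_eq_pageZ (k : ℕ) : G.pathCycles R k = G.pageZ R 2 k k := by
  rw [pathCycles, invariantChains, pageZ, allowed_eq_filt]
  cases k with
  | zero =>
    have : boundary R G.V 0 = 0 := rfl
    rw [this]
    simp
  | succ k =>
    rw [filt_eq_bot (p := ((k + 1 : ℕ) : ℤ) - 2) R (by push_cast; omega)]
    rw [inf_assoc]
    congr 1
    exact inf_eq_right.2 fun c hc => by
      rw [Submodule.mem_comap, LinearMap.mem_ker.1 hc]
      exact zero_mem _

theorem pathBoundaries_eq_pageB (k : ℕ) : G.pathBoundaries R k = G.pageB R 2 k k := by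
  have h1 : G.pageZ R (2 - 1) (k - 1) k = ⊥ :=
    eq_bot_iff.2 (inf_le_left.trans (filt_eq_bot R (by omega)).le)
  have h2 : G.pageZ R (2 - 1) (k + 2 - 1) (k + 1) = G.invariantChains R (k + 1) := by
    rw [invariantChains, pageZ, allowed_eq_filt, allowed_eq_filt]
    have e1 : (k : ℤ) + 2 - 1 = ((k + 1 : ℕ) : ℤ) := by push_cast; ring
    have e2 : (((k + 1 : ℕ) : ℤ)) - (2 - 1) = ((k + 1 - 1 : ℕ) : ℤ) := by
      push_cast
      simp
    rw [e1, e2]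
  rw [pathBoundaries, pageB, h1, h2, bot_sup_eq]

/-- Path homology is the diagonal of bigraded path homology. -/
theorem bigradedPathHomologyIsos_le_pathHomologyIsos :
    bigradedPathHomologyIsos.{w, u} R ≤ pathHomologyIsos R := by
  intro G H f hf k
  have h := hf k k
  rw [bigradedPathHomologyMap, pageMap, Function.Bijective, subQuotMap_injective_iff,
    subQuotMap_surjective_iff] at h
  rw [pathHomologyMap, Function.Bijective, subQuotMap_injective_iff, subQuotMap_surjective_iff]
  simp only [pathCycles_eq_pageZ, pathBoundaries_eq_pageB]
  exact h

end PathHomology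

/-! ### Colimits of directed graphs -/

section Colimits

/-- The set of vertices, as a functor. -/
def verts : DirGraph.{u} ⥤ Type u where
  obj G := G.V
  map f := TypeCat.ofHom f.toFun

variable {J : Type u'} [Category.{v'} J] (F : J ⥤ DirGraph.{u})

variable {F} in
/-- A colimit of the sets of vertices, with the images of all edges as edges. -/
def colimitGraph (t : Cocone (F ⋙ verts)) : DirGraph.{u} where
  V := t.pt
  graph := ⟨fun x y => ∃ (j : J) (a b : (F.obj j).V), (F.obj j).Adj a b ∧
    t.ι.app j a = x ∧ t.ι.app j b = y⟩

variable {F} in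
/-- The cocone with point `colimitGraph`. -/
def colimitGraphCocone (t : Cocone (F ⋙ verts)) : Cocone F where
  pt := colimitGraph t
  ι :=
    { app := fun j => ⟨fun a => t.ι.app j a, fun a b h => Or.inr ⟨j, a, b, h, rfl, rfl⟩⟩
      naturality := fun j j' f => by
        refine hom_ext fun a => ?_
        exact ConcreteCategory.congr_hom (t.w f) a }

variable {F} in
/-- The cocone `colimitGraphCocone` is a colimit. -/
def isColimitColimitGraphCocone {t : Cocone (F ⋙ verts)} (ht : IsColimit t) :
    IsColimit (colimitGraphCocone t) where
  desc s := ⟨fun x => ht.desc (verts.mapCocone s) x, by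
    rintro _ _ ⟨j, a, b, h, rfl, rfl⟩
    have e := fun c => ConcreteCategory.congr_hom (ht.fac (verts.mapCocone s) j) c
    have ea : ht.desc (verts.mapCocone s) (t.ι.app j a) = (s.ι.app j).toFun a := e a
    have eb : ht.desc (verts.mapCocone s) (t.ι.app j b) = (s.ι.app j).toFun b := e b
    rw [ea, eb]
    exact (s.ι.app j).map_adj a b h⟩
  fac s j := hom_ext fun a => ConcreteCategory.congr_hom (ht.fac (verts.mapCocone s) j) a
  uniq s m hm := by
    have : TypeCat.ofHom m.toFun = ht.desc (verts.mapCocone s) :=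
      ht.uniq (verts.mapCocone s) (TypeCat.ofHom m.toFun) fun j => by
        ext a
        exact congrArg (fun f : F.obj j ⟶ s.pt => f.toFun a) (hm j)
    exact hom_ext fun x => ConcreteCategory.congr_hom this x

instance hasColimit_of_verts [HasColimit (F ⋙ verts)] : HasColimit F :=
  ⟨⟨_, isColimitColimitGraphCocone (colimit.isColimit (F ⋙ verts))⟩⟩

instance preservesColimit_verts [HasColimit (F ⋙ verts)] : PreservesColimit F verts :=
  preservesColimit_of_preserves_colimit_cocone
    (isColimitColimitGraphCocone (colimit.isColimit (F ⋙ verts)))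
    (IsColimit.ofIsoColimit (colimit.isColimit (F ⋙ verts)) (Cocone.ext (Iso.refl _)))

instance hasColimitsOfShape [HasColimitsOfShape J (Type u)] :
    HasColimitsOfShape J DirGraph.{u} where

variable {F} [HasColimit (F ⋙ verts)] {c : Cocone F}

theorem exists_vertex_of_isColimit (hc : IsColimit c) (x : c.pt.V) :
    ∃ j a, (c.ι.app j).toFun a = x :=
  Types.jointly_surjective_of_isColimit (isColimitOfPreserves verts hc) x

/-- An arbitrary colimit is compared with the explicit `colimitGraph`, all of whose edges come from
stages. The comparison respects edges only up to collapsing, hence the restriction to distinct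
endpoints. -/
theorem exists_edge_of_isColimit (hc : IsColimit c) {x y : c.pt.V} (hne : x ≠ y)
    (h : c.pt.Adj x y) :
    ∃ j a b, (F.obj j).Adj a b ∧ (c.ι.app j).toFun a = x ∧ (c.ι.app j).toFun b = y := by
  have h0 := isColimitColimitGraphCocone (colimit.isColimit (F ⋙ verts))
  set e := hc.desc (colimitGraphCocone (colimit.cocone (F ⋙ verts)))
  set e' := h0.desc c
  have he : e ≫ e' = 𝟙 c.pt := hc.hom_ext fun j => by simp [e, e']
  have he' : ∀ x, e'.toFun (e.toFun x) = x := fun x =>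
    congrArg (fun f : c.pt ⟶ c.pt => f.toFun x) he
  rcases e.map_adj x y h with h1 | ⟨j, a, b, hab, ha, hb⟩
  · exact absurd (by rw [← he' x, h1, he']) hne
  · have h2 : ∀ a, e'.toFun (((colimitGraphCocone (colimit.cocone (F ⋙ verts))).ι.app j).toFun a) =
        (c.ι.app j).toFun a := fun a =>
      congrArg (fun f : F.obj j ⟶ c.pt => f.toFun a) (h0.fac c j)
    refine ⟨j, a, b, hab, ?_, ?_⟩
    · rw [← h2, ← he' x]
      exact congrArg e'.toFun ha
    · rw [← h2, ← he' y]
      exact congrArg e'.toFun hb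

theorem exists_map_eq_of_isColimit [IsFilteredOrEmpty J] (hc : IsColimit c) {j : J} {a b : (F.obj j).V}
    (h : (c.ι.app j).toFun a = (c.ι.app j).toFun b) :
    ∃ (j' : J) (f : j ⟶ j'), (F.map f).toFun a = (F.map f).toFun b :=
  (Types.FilteredColimit.isColimit_eq_iff' (isColimitOfPreserves verts hc) a b).1 h

end Colimits

/-! ### Closure properties of cofibrations -/

section CofibrationClosure

variable {X Y Z : DirGraph.{u}}

theorem iso_hom_inv_toFun (e : X ≅ Y) (y : Y.V) : e.hom.toFun (e.inv.toFun y) = y :=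
  congrArg (fun f : Y ⟶ Y => f.toFun y) e.inv_hom_id

theorem iso_inv_hom_toFun (e : X ≅ Y) (x : X.V) : e.inv.toFun (e.hom.toFun x) = x :=
  congrArg (fun f : X ⟶ X => f.toFun x) e.hom_inv_id

theorem cofibrations_of_iso (e : X ≅ Y) : cofibrations e.hom := by
  have hr : ∀ y, y ∈ Set.range e.hom.toFun := fun y => ⟨_, iso_hom_inv_toFun e y⟩
  refine cofibrations_of ⟨fun a b h => ?_, fun a b hne h => ?_⟩ (fun x y hx => absurd (hr x) hx)
    (fun x hx => absurd (hr x) hx)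
  · rw [← iso_inv_hom_toFun e a, h, iso_inv_hom_toFun]
  · have := e.inv.map_adj _ _ h
    rw [iso_inv_hom_toFun, iso_inv_hom_toFun] at this
    exact this.resolve_left hne

/-- The projection is the composite: a shortest path from `X` to `z` can be chosen through the
projection `y` of `z` to `Y`, and then through the projection of `y` to `X`. -/
theorem cofibrations_comp {f : X ⟶ Y} {g : Y ⟶ Z} (hf : cofibrations f) (hg : cofibrations g) :
    cofibrations (f ≫ g) := by
  obtain ⟨π, hπ⟩ := hf.exists_projection
  obtain ⟨ρ, hρ⟩ := hg.exists_projection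
  refine cofibrations_of ⟨fun a b h => hf.injective (hg.injective h), fun a b hne h => ?_⟩ ?_ ?_
  · exact hf.1.2 a b hne (hg.1.2 _ _ (fun e => hne (hf.injective e)) h)
  · rintro z _ hz ⟨a, rfl⟩ hadj
    by_cases hz' : z ∈ Set.range g.toFun
    · obtain ⟨y, rfl⟩ := hz'
      have hy : y ∉ Set.range f.toFun := by
        rintro ⟨b, rfl⟩
        exact hz ⟨b, rfl⟩
      refine hf.2.1 y (f.toFun a) hy ⟨a, rfl⟩ (hg.1.2 _ _ ?_ hadj)
      rintro rfl
      exact hy ⟨a, rfl⟩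
    · exact hg.2.1 z _ hz' ⟨_, rfl⟩ hadj
  · intro z _ a₀ _
    obtain ⟨⟨y, hy⟩, -⟩ := hρ z _ ⟨f.toFun a₀, rfl⟩
    obtain ⟨⟨p, hp⟩, -⟩ := hπ y _ ⟨a₀, rfl⟩
    refine ⟨p, fun a => ?_⟩
    have h1 := (hρ z _ ⟨f.toFun a, rfl⟩).2
    have h2 := (hπ y _ ⟨a, rfl⟩).2
    rw [← hy] at h1
    rw [← hp] at h2
    simp only [comp_toFun]
    calc Z.dist (g.toFun (f.toFun a)) (g.toFun (f.toFun p)) + Z.dist (g.toFun (f.toFun p)) z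
        ≤ Y.dist (f.toFun a) (f.toFun p) +
          (Y.dist (f.toFun p) y + Z.dist (g.toFun y) z) := by
          refine add_le_add (dist_map_le g _ _) ((dist_triangle _ (g.toFun y) _).trans ?_)
          exact add_le_add (dist_map_le g _ _) le_rfl
      _ ≤ Y.dist (f.toFun a) y + Z.dist (g.toFun y) z := by
          rw [← add_assoc]
          exact add_le_add h2 le_rfl
      _ = Z.dist (g.toFun (f.toFun a)) (g.toFun y) + Z.dist (g.toFun y) z := by
          rw [hg.dist_eq]
      _ ≤ _ := h1

theorem cofibrations_of_isEmpty (f : X ⟶ Y) [IsEmpty X.V] : cofibrations f :=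
  cofibrations_of ⟨fun a => isEmptyElim a, fun a => isEmptyElim a⟩
    (fun _ y _ hy => by
      obtain ⟨a, -⟩ := hy
      exact isEmptyElim a) fun _ _ a => isEmptyElim a

/-- The complete directed graph on a set. -/
def complete (T : Type u) : DirGraph.{u} := ⟨T, ⟨fun _ _ => True⟩⟩

/-- Any function to the vertices of a complete graph is a map of directed graphs. -/
def toComplete {T : Type u} (φ : X.V → T) : X ⟶ complete T := ⟨φ, fun _ _ _ => Or.inr trivial⟩

theorem isEmpty_of_isInitial {I : DirGraph.{u}} (hI : IsInitial I) : IsEmpty I.V :=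
  ⟨fun x => ((hI.to (complete PEmpty)).toFun x : PEmpty).elim⟩

end CofibrationClosure

/-! ### Pushouts along cofibrations -/

section Pushouts

variable {A X Y P : DirGraph.{u}} {i : A ⟶ X} {f : A ⟶ Y} {g : X ⟶ P} {j : Y ⟶ P}

theorem pushout_w (sq : IsPushout i f g j) (a : A.V) :
    g.toFun (i.toFun a) = j.toFun (f.toFun a) :=
  congrArg (fun h : A ⟶ P => h.toFun a) sq.w

theorem pushout_exists_vertex (sq : IsPushout i f g j) (z : P.V) :
    z ∈ Set.range j.toFun ∨ ∃ x, x ∉ Set.range i.toFun ∧ g.toFun x = z := by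
  obtain ⟨s, a, h⟩ := exists_vertex_of_isColimit sq.isColimit z
  have hX : ∀ x, g.toFun x = z →
      z ∈ Set.range j.toFun ∨ ∃ x, x ∉ Set.range i.toFun ∧ g.toFun x = z := by
    intro x hx
    by_cases h' : x ∈ Set.range i.toFun
    · obtain ⟨a, rfl⟩ := h'
      rw [pushout_w sq] at hx
      exact Or.inl ⟨_, hx⟩
    · exact Or.inr ⟨x, h', hx⟩
  match s, a, h with
  | none, a, h => exact hX (i.toFun a) h
  | some WalkingPair.left, a, h => exact hX a h
  | some WalkingPair.right, a, h => exact Or.inl ⟨a, h⟩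

theorem pushout_exists_edge (sq : IsPushout i f g j) {z z' : P.V} (hne : z ≠ z')
    (h : P.Adj z z') :
    (∃ y y', Y.Adj y y' ∧ j.toFun y = z ∧ j.toFun y' = z') ∨
      ∃ x x', X.Adj x x' ∧ g.toFun x = z ∧ g.toFun x' = z' := by
  obtain ⟨s, a, b, hab, ha, hb⟩ := exists_edge_of_isColimit sq.isColimit hne h
  match s, a, b, hab, ha, hb with
  | none, a, b, hab, ha, hb =>
    have ha' : g.toFun (i.toFun a) = z := ha
    have hb' : g.toFun (i.toFun b) = z' := hb
    refine Or.inr ⟨i.toFun a, i.toFun b, (i.map_adj a b hab).resolve_left fun e => hne ?_, ha', hb'⟩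
    rw [← ha', ← hb', e]
  | some WalkingPair.left, a, b, hab, ha, hb => exact Or.inr ⟨a, b, hab, ha, hb⟩
  | some WalkingPair.right, a, b, hab, ha, hb => exact Or.inl ⟨a, b, hab, ha, hb⟩

/-- A pushout along a cofibration is, as a set, the disjoint union of `Y` and the complement of
`A` in `X`. -/
theorem pushout_exists_separating (sq : IsPushout i f g j) (hi : Function.Injective i.toFun) :
    ∃ φ : P.V → Y.V ⊕ X.V, (∀ y, φ (j.toFun y) = Sum.inl y) ∧
      ∀ x, x ∉ Set.range i.toFun → φ (g.toFun x) = Sum.inr x := by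
  classical
  -- Every function into a complete graph is a map of graphs, so the universal property of `P` also
  -- applies to this purely set-theoretic map.
  let ψ : X.V → Y.V ⊕ X.V := fun x =>
    if h : x ∈ Set.range i.toFun then Sum.inl (f.toFun h.choose) else Sum.inr x
  have hw : i ≫ toComplete ψ = f ≫ toComplete (T := Y.V ⊕ X.V) Sum.inl := by
    refine hom_ext fun a => ?_
    have ha : i.toFun a ∈ Set.range i.toFun := ⟨a, rfl⟩
    change ψ (i.toFun a) = Sum.inl (f.toFun a)
    simp only [ψ, dif_pos ha]
    rw [hi ha.choose_spec]
  refine ⟨(sq.desc _ _ hw).toFun, fun y => ?_, fun x hx => ?_⟩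
  · exact congrArg (fun h : Y ⟶ complete (Y.V ⊕ X.V) => h.toFun y) (sq.inr_desc _ _ hw)
  · refine (congrArg (fun h : X ⟶ complete (Y.V ⊕ X.V) => h.toFun x)
      (sq.inl_desc _ _ hw)).trans ?_
    exact dif_neg hx

theorem pushout_inr_injective (sq : IsPushout i f g j) (hi : cofibrations i) :
    Function.Injective j.toFun := by
  obtain ⟨φ, h1, -⟩ := pushout_exists_separating sq hi.injective
  intro y y' h
  have := congrArg φ h
  rw [h1, h1] at this
  exact Sum.inl_injective this

theorem pushout_inl_inj (sq : IsPushout i f g j) (hi : cofibrations i) {x x' : X.V}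
    (hx : x ∉ Set.range i.toFun) (hx' : x' ∉ Set.range i.toFun) (h : g.toFun x = g.toFun x') :
    x = x' := by
  obtain ⟨φ, -, h2⟩ := pushout_exists_separating sq hi.injective
  have := congrArg φ h
  rw [h2 x hx, h2 x' hx'] at this
  exact Sum.inr_injective this

theorem pushout_inl_mem_iff (sq : IsPushout i f g j) (hi : cofibrations i) (x : X.V) :
    g.toFun x ∈ Set.range j.toFun ↔ x ∈ Set.range i.toFun := by
  constructor
  · rintro ⟨y, hy⟩
    by_contra hx
    obtain ⟨φ, h1, h2⟩ := pushout_exists_separating sq hi.injective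
    have := congrArg φ hy
    rw [h1, h2 x hx] at this
    simp at this
  · rintro ⟨a, rfl⟩
    exact ⟨_, (pushout_w sq a).symm⟩

/-- An edge of `P` between vertices of `Y` that stems from `X` joins vertices of `A`; by inducedness
it is an edge of `A`, and `f` carries it to `Y`. -/
theorem pushout_isInducedInclusion (sq : IsPushout i f g j) (hi : cofibrations i) :
    IsInducedInclusion j := by
  have hj := pushout_inr_injective sq hi
  refine ⟨hj, fun a b hne h => ?_⟩
  rcases pushout_exists_edge sq (fun e => hne (hj e)) h with
    ⟨y, y', hadj, hy, hy'⟩ | ⟨x, x', hadj, hx, hx'⟩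
  · rwa [← hj hy, ← hj hy']
  · obtain ⟨c, rfl⟩ := (pushout_inl_mem_iff sq hi x).1 ⟨a, hx.symm⟩
    obtain ⟨d, rfl⟩ := (pushout_inl_mem_iff sq hi x').1 ⟨b, hx'.symm⟩
    rw [pushout_w sq] at hx hx'
    obtain rfl := hj hx
    obtain rfl := hj hx'
    refine (f.map_adj c d (hi.1.2 c d ?_ hadj)).resolve_left hne
    rintro rfl
    exact hne rfl

theorem pushout_not_adj (sq : IsPushout i f g j) (hi : cofibrations i) (z z' : P.V)
    (hz : z ∉ Set.range j.toFun) (hz' : z' ∈ Set.range j.toFun) : ¬ P.Adj z z' := by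
  intro h
  have hne : z ≠ z' := fun e => hz (by rwa [e])
  rcases pushout_exists_edge sq hne h with
    ⟨y, -, -, rfl, -⟩ | ⟨x, x', hadj, rfl, rfl⟩
  · exact hz ⟨y, rfl⟩
  · rw [pushout_inl_mem_iff sq hi] at hz hz'
    exact hi.2.1 x x' hz hz' hadj

theorem pushout_edge_of_notMem (sq : IsPushout i f g j) (hi : cofibrations i) {z : P.V} {x' : X.V}
    (hx' : x' ∉ Set.range i.toFun) (hne : z ≠ g.toFun x') (h : P.Adj z (g.toFun x')) :
    ∃ x, X.Adj x x' ∧ g.toFun x = z := by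
  rcases pushout_exists_edge sq hne h with ⟨-, y', -, -, hy'⟩ | ⟨x, x'', hadj, hx, hx''⟩
  · exact absurd ((pushout_inl_mem_iff sq hi x').1 ⟨y', hy'⟩) hx'
  · have h1 : x'' ∉ Set.range i.toFun := by
      rwa [← pushout_inl_mem_iff sq hi, hx'', pushout_inl_mem_iff sq hi]
    obtain rfl := pushout_inl_inj sq hi h1 hx' hx''
    exact ⟨x, hadj, hx⟩

/-- No edge of `P` leads back into `Y`, so a path starting outside stays there and consists of edges
of `X`, apart from loops. -/
theorem pushout_hasPath_outside (sq : IsPushout i f g j) (hi : cofibrations i) {n : ℕ}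
    {x x' : X.V} (hx : x ∉ Set.range i.toFun) (hx' : x' ∉ Set.range i.toFun)
    (h : P.HasPath n (g.toFun x) (g.toFun x')) : ∃ m ≤ n, X.HasPath m x x' := by
  induction n generalizing x with
  | zero => exact ⟨0, le_rfl, pushout_inl_inj sq hi hx hx' h⟩
  | succ n ih =>
    obtain ⟨z, hadj, hp⟩ := h
    rcases pushout_exists_vertex sq z with hz | ⟨x₁, hx₁, rfl⟩
    · exact absurd hadj (pushout_not_adj sq hi _ _
        (fun h => hx ((pushout_inl_mem_iff sq hi x).1 h)) hz)
    · obtain ⟨m, hm, hp⟩ := ih hx₁ hp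
      by_cases e : g.toFun x = g.toFun x₁
      · obtain rfl := pushout_inl_inj sq hi hx hx₁ e
        exact ⟨m, by omega, hp⟩
      · obtain ⟨x₀, hadj', hx₀⟩ := pushout_edge_of_notMem sq hi hx₁ e hadj
        have h1 : x₀ ∉ Set.range i.toFun := by
          rwa [← pushout_inl_mem_iff sq hi, hx₀, pushout_inl_mem_iff sq hi]
        obtain rfl := pushout_inl_inj sq hi h1 hx hx₀
        exact ⟨m + 1, by omega, x₁, hadj', hp⟩

theorem pushout_dist_outside (sq : IsPushout i f g j) (hi : cofibrations i)
    {x x' : X.V} (hx : x ∉ Set.range i.toFun) (hx' : x' ∉ Set.range i.toFun) :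
    P.dist (g.toFun x) (g.toFun x') = X.dist x x' := by
  refine le_antisymm (dist_map_le g x x') (le_dist fun n hn => ?_)
  obtain ⟨m, hm, hp⟩ := pushout_hasPath_outside sq hi hx hx' hn
  exact (dist_le hp).trans (by exact_mod_cast hm)

/-- A path leaves `Y` exactly once, and the edge by which it leaves comes from `X`; hence it departs
from a vertex `f a`. -/
theorem pushout_hasPath_inr (sq : IsPushout i f g j) (hi : cofibrations i) {n : ℕ}
    {y : Y.V} {x : X.V} (hx : x ∉ Set.range i.toFun)
    (h : P.HasPath n (j.toFun y) (g.toFun x)) :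
    ∃ a, Y.dist y (f.toFun a) + X.dist (i.toFun a) x ≤ n := by
  induction n generalizing y with
  | zero => exact absurd ((pushout_inl_mem_iff sq hi x).1 ⟨y, h⟩) hx
  | succ n ih =>
    obtain ⟨z, hadj, hp⟩ := h
    rcases pushout_exists_vertex sq z with ⟨y', rfl⟩ | ⟨x₁, hx₁, rfl⟩
    · obtain ⟨a, ha⟩ := ih hp
      refine ⟨a, ?_⟩
      have h1 : Y.dist y y' ≤ 1 := by
        by_cases e : y = y'
        · simp [e]
        · exact dist_le_one_of_adj ((pushout_isInducedInclusion sq hi).2 y y' e hadj)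
      calc Y.dist y (f.toFun a) + X.dist (i.toFun a) x
          ≤ (1 + Y.dist y' (f.toFun a)) + X.dist (i.toFun a) x := by
            refine add_le_add ((dist_triangle _ y' _).trans ?_) le_rfl
            exact add_le_add h1 le_rfl
        _ = 1 + (Y.dist y' (f.toFun a) + X.dist (i.toFun a) x) := add_assoc _ _ _
        _ ≤ 1 + n := add_le_add le_rfl ha
        _ = ((n + 1 : ℕ) : ℕ∞) := by push_cast; rw [add_comm]
    · have hne : j.toFun y ≠ g.toFun x₁ := fun e =>
        hx₁ ((pushout_inl_mem_iff sq hi x₁).1 ⟨y, e⟩)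
      obtain ⟨x₀, hadj', hx₀⟩ := pushout_edge_of_notMem sq hi hx₁ hne hadj
      obtain ⟨a, rfl⟩ := (pushout_inl_mem_iff sq hi x₀).1 ⟨y, hx₀.symm⟩
      rw [pushout_w sq] at hx₀
      obtain rfl := pushout_inr_injective sq hi hx₀
      obtain ⟨m, hm, hp⟩ := pushout_hasPath_outside sq hi hx₁ hx hp
      refine ⟨a, ?_⟩
      rw [dist_self, zero_add]
      refine (dist_le (n := m + 1) ⟨x₁, hadj', hp⟩).trans ?_
      exact_mod_cast Nat.succ_le_succ hm

/-- A path leaving `Y` at `f a` can be rerouted through `f p` at no cost, because `f` does not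
increase distances and `p` lies on a shortest path from `a` to `x`. -/
theorem pushout_dist_inr (sq : IsPushout i f g j) (hi : cofibrations i)
    {x : X.V} (hx : x ∉ Set.range i.toFun) {p : A.V}
    (hp : ∀ a, X.dist (i.toFun a) (i.toFun p) + X.dist (i.toFun p) x ≤ X.dist (i.toFun a) x)
    (y : Y.V) :
    Y.dist y (f.toFun p) + X.dist (i.toFun p) x ≤ P.dist (j.toFun y) (g.toFun x) := by
  refine le_dist fun n hn => ?_
  obtain ⟨a, ha⟩ := pushout_hasPath_inr sq hi hx hn
  calc Y.dist y (f.toFun p) + X.dist (i.toFun p) x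
      ≤ (Y.dist y (f.toFun a) + Y.dist (f.toFun a) (f.toFun p)) + X.dist (i.toFun p) x :=
        add_le_add (dist_triangle _ _ _) le_rfl
    _ ≤ (Y.dist y (f.toFun a) + X.dist (i.toFun a) (i.toFun p)) + X.dist (i.toFun p) x := by
        refine add_le_add (add_le_add le_rfl ?_) le_rfl
        rw [hi.dist_eq]
        exact dist_map_le f a p
    _ ≤ Y.dist y (f.toFun a) + X.dist (i.toFun a) x := by
        rw [add_assoc]
        exact add_le_add le_rfl (hp a)
    _ ≤ n := ha

theorem pushout_exists_projection (sq : IsPushout i f g j) (hi : cofibrations i)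
    {π : X.V → X.V} (hπ : X.IsProjection (Set.range i.toFun) π) :
    ∃ π' : P.V → P.V, P.IsProjection (Set.range j.toFun) π' ∧
      ∀ x, x ∉ Set.range i.toFun → ∀ a ∈ Set.range i.toFun, π' (g.toFun x) = g.toFun (π x) := by
  have h : ∀ z, ∃ p, (∀ b ∈ Set.range j.toFun, p ∈ Set.range j.toFun ∧
      P.dist b p + P.dist p z ≤ P.dist b z) ∧
        ∀ x, x ∉ Set.range i.toFun → g.toFun x = z → ∀ a ∈ Set.range i.toFun,
          p = g.toFun (π x) := by
    intro z
    rcases pushout_exists_vertex sq z with hz | ⟨x, hx, rfl⟩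
    · refine ⟨z, fun b _ => ⟨hz, by simp⟩, ?_⟩
      rintro x hx rfl
      exact absurd ((pushout_inl_mem_iff sq hi x).1 hz) hx
    -- If `A` is empty, nothing outside is reachable from `Y`, so any vertex of `Y` is a projection.
    by_cases hA : (Set.range i.toFun).Nonempty
    · obtain ⟨a₀, ha₀⟩ := hA
      obtain ⟨⟨p, hp⟩, -⟩ := hπ x a₀ ha₀
      refine ⟨g.toFun (π x), ?_, ?_⟩
      · rintro _ ⟨y, rfl⟩
        rw [← hp, pushout_w sq]
        refine ⟨⟨_, rfl⟩, ?_⟩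
        refine le_trans ?_ (pushout_dist_inr sq hi hx (p := p) (fun a => ?_) y)
        · refine add_le_add (dist_map_le j _ _) ?_
          rw [← pushout_w sq]
          exact dist_map_le g _ _
        · rw [hp]
          exact (hπ x _ ⟨a, rfl⟩).2
      · intro x' hx' e _ _
        rw [pushout_inl_inj sq hi hx' hx e]
    · have htop : ∀ y, P.dist (j.toFun y) (g.toFun x) = ⊤ := by
        intro y
        by_contra h
        obtain ⟨n, hn, -⟩ := exists_path_of_dist_ne_top h
        obtain ⟨a, -⟩ := pushout_hasPath_inr sq hi hx hn
        exact hA ⟨_, a, rfl⟩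
      by_cases hY : (Set.range j.toFun).Nonempty
      · obtain ⟨p, hp⟩ := hY
        refine ⟨p, ?_, fun _ _ _ a ha => absurd ⟨a, ha⟩ hA⟩
        rintro _ ⟨y, rfl⟩
        rw [htop]
        exact ⟨hp, le_top⟩
      · exact ⟨g.toFun x, fun b hb => absurd ⟨b, hb⟩ hY, fun _ _ _ a ha => absurd ⟨a, ha⟩ hA⟩
  exact ⟨fun z => (h z).choose, fun z => (h z).choose_spec.1,
    fun x hx a ha => (h (g.toFun x)).choose_spec.2 x hx rfl a ha⟩

theorem cofibrations_pushout (sq : IsPushout i f g j) (hi : cofibrations i) : cofibrations j := by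
  obtain ⟨π, hπ⟩ := hi.exists_projection
  obtain ⟨π', hπ', -⟩ := pushout_exists_projection sq hi hπ
  refine cofibrations_of (pushout_isInducedInclusion sq hi) (pushout_not_adj sq hi)
    fun z _ y₀ _ => ?_
  obtain ⟨⟨p, hp⟩, -⟩ := hπ' z _ ⟨y₀, rfl⟩
  refine ⟨p, fun y => ?_⟩
  rw [hp]
  exact (hπ' z _ ⟨y, rfl⟩).2

/-- Excision for the relative complexes of `i` and `j`; only the vanishing of their second pages is
compared. -/
theorem bigradedPathHomologyIsos_pushout (R : Type w) [CommRing R] (sq : IsPushout i f g j)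
    (hi : cofibrations i) (hW : bigradedPathHomologyIsos R i) : bigradedPathHomologyIsos R j := by
  have hj := cofibrations_pushout sq hi
  obtain ⟨π, hπ⟩ := hi.exists_projection
  obtain ⟨π', hπ', hπ'π⟩ := pushout_exists_projection sq hi hπ
  rw [bigradedPathHomologyIsos_iff, hj.e2Iso_iff]
  rw [bigradedPathHomologyIsos_iff, hi.e2Iso_iff] at hW
  have h : IsRelativeIso g (Set.range i.toFun) (Set.range j.toFun) π π' :=
    { mem_iff := pushout_inl_mem_iff sq hi
      inj := fun x y hx hy => pushout_inl_inj sq hi hx hy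
      surj := fun z hz => (pushout_exists_vertex sq z).resolve_left hz
      dist_eq := fun x y hx hy => pushout_dist_outside sq hi hx hy
      proj_eq := hπ'π
      dist_proj := fun x hx a ha => by
        obtain ⟨⟨p, hp⟩, -⟩ := hπ x a ha
        refine le_antisymm (dist_map_le g _ _) ?_
        have h1 := pushout_dist_inr sq hi hx (p := p)
          (fun a => by rw [hp]; exact (hπ x _ ⟨a, rfl⟩).2) (f.toFun p)
        rwa [dist_self, zero_add, ← pushout_w sq, hp] at h1
      nonempty := by
        rintro _ z ⟨y, rfl⟩ hz hne
        obtain ⟨x, hx, rfl⟩ := (pushout_exists_vertex sq z).resolve_left hz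
        obtain ⟨n, hn, -⟩ := exists_path_of_dist_ne_top hne
        obtain ⟨a, -⟩ := pushout_hasPath_inr sq hi hx hn
        exact ⟨_, a, rfl⟩ }
  exact h.e2Acyclic hi.isClosedBackwards hπ hj.isClosedBackwards hπ' hW

end Pushouts

end DirGraph

/-! ### Transfinite compositions -/

section Transfinite

variable {C : Type u'} [Category.{v'} C] {W : MorphismProperty C}

theorem map_mem_of_wellOrderContinuous [W.IsMultiplicative]
    (hW : ∀ (J : Type w) [LinearOrder J] (F : J ⥤ C) (c : Cocone F), IsColimit c →
      (∀ (i j : J) (f : i ⟶ j), W (F.map f)) → ∀ j, W (c.ι.app j))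
    {J : Type w} [LinearOrder J] [SuccOrder J] [OrderBot J] [WellFoundedLT J] (F : J ⥤ C)
    [F.IsWellOrderContinuous]
    (hF : ∀ j, ¬ IsMax j → W (F.map (homOfLE (Order.le_succ j)))) (j : J) :
    ∀ (i : J) (h : i ≤ j), W (F.map (homOfLE h)) := by
  have hid : ∀ (j : J) (h : j ≤ j), W (F.map (homOfLE h)) := fun j h => by
    have : homOfLE h = 𝟙 j := rfl
    rw [this, F.map_id]
    exact W.id_mem _
  induction j using SuccOrder.limitRecOn with
  | isMin j hj =>
    intro i h
    obtain rfl : i = j := le_antisymm h (hj h)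
    exact hid i h
  | succ j hj ih =>
    intro i h
    rcases h.eq_or_lt with rfl | hlt
    · exact hid _ h
    · have hij := (Order.lt_succ_iff_of_not_isMax hj).1 hlt
      have e : homOfLE h = homOfLE hij ≫ homOfLE (Order.le_succ j) := rfl
      rw [e, F.map_comp]
      exact W.comp_mem _ _ (ih i hij) (hF j hj)
  -- At a limit, continuity exhibits `F.obj j` as the colimit of the earlier stages, to which the
  -- hypothesis on chains applies.
  | isSuccLimit j hj ih =>
    intro i h
    rcases h.eq_or_lt with rfl | hlt
    · exact hid _ h
    · exact hW (Set.Iio j) _ _ (F.isColimitOfIsWellOrderContinuous j hj)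
        (fun a b f => ih b.1 b.2 a.1 (leOfHom f)) ⟨i, hlt⟩

/-- A class of morphisms is stable under transfinite composition if it is closed under composition
and contains the maps to the colimits of all chains of its elements. -/
theorem isStableUnderTransfiniteComposition_of_colimits [W.IsMultiplicative] [W.RespectsIso]
    (hW : ∀ (J : Type w) [LinearOrder J] (F : J ⥤ C) (c : Cocone F), IsColimit c →
      (∀ (i j : J) (f : i ⟶ j), W (F.map f)) → ∀ j, W (c.ι.app j)) :
    MorphismProperty.IsStableUnderTransfiniteComposition.{w} W where
  isStableUnderTransfiniteCompositionOfShape J _ _ _ _ :=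
    { le := by
        rintro X Y f ⟨h⟩
        have := h.isWellOrderContinuous
        rw [← h.fac]
        refine W.comp_mem _ _ (MorphismProperty.of_isIso W _) ?_
        exact hW J h.F _ h.isColimit
          (fun i j f => map_mem_of_wellOrderContinuous hW h.F h.map_mem j i (leOfHom f)) ⊥ }

end Transfinite

namespace DirGraph

/-! ### Colimits of chains of cofibrations -/

section Chains

variable {J : Type u} [LinearOrder J] {F : J ⥤ DirGraph.{u}} {c : Cocone F}

theorem cocone_w_toFun (c : Cocone F) {i k : J} (f : i ⟶ k) (a : (F.obj i).V) :
    (c.ι.app k).toFun ((F.map f).toFun a) = (c.ι.app i).toFun a :=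
  congrArg (fun g : F.obj i ⟶ c.pt => g.toFun a) (c.w f)

variable {R : Type w} [CommRing R]

theorem lmap_chain_ι (c : Cocone F) {j k : J} (f : j ⟶ k) (a : List (F.obj j).V →₀ R) :
    lmap R (c.ι.app k).toFun (lmap R (F.map f).toFun a) = lmap R (c.ι.app j).toFun a := by
  rw [lmap_lmap]
  congr 2
  funext x
  exact cocone_w_toFun c f x

theorem chain_ι_injective (hc : IsColimit c)
    (hF : ∀ (i j : J) (f : i ⟶ j), cofibrations (F.map f)) (j : J) :
    Function.Injective (c.ι.app j).toFun := by
  intro a b h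
  obtain ⟨k, f, h⟩ := exists_map_eq_of_isColimit hc h
  exact (hF _ _ f).injective h

theorem chain_ι_isInducedInclusion (hc : IsColimit c)
    (hF : ∀ (i j : J) (f : i ⟶ j), cofibrations (F.map f)) (j : J) :
    IsInducedInclusion (c.ι.app j) := by
  refine ⟨chain_ι_injective hc hF j, fun a b hne h => ?_⟩
  have hinj := chain_ι_injective hc hF
  obtain ⟨i, a', b', hadj, ha, hb⟩ :=
    exists_edge_of_isColimit hc (fun e => hne (hinj j e)) h
  let f : i ⟶ max i j := homOfLE (le_max_left i j)
  let g : j ⟶ max i j := homOfLE (le_max_right i j)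
  rw [← cocone_w_toFun c f, ← cocone_w_toFun c g] at ha hb
  refine (hF _ _ g).1.2 a b hne ?_
  rw [← hinj _ ha, ← hinj _ hb]
  refine ((F.map f).map_adj a' b' hadj).resolve_left fun e => hne ?_
  rw [hinj _ ha, hinj _ hb] at e
  exact (hF _ _ g).injective e

theorem chain_ι_not_adj (hc : IsColimit c)
    (hF : ∀ (i j : J) (f : i ⟶ j), cofibrations (F.map f)) (j : J)
    (x y : c.pt.V) (hx : x ∉ Set.range (c.ι.app j).toFun)
    (hy : y ∈ Set.range (c.ι.app j).toFun) : ¬ c.pt.Adj x y := by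
  intro h
  have hinj := chain_ι_injective hc hF
  have hne : x ≠ y := fun e => hx (by rwa [e])
  obtain ⟨b, rfl⟩ := hy
  obtain ⟨i, a', b', hadj, rfl, hb⟩ := exists_edge_of_isColimit hc hne h
  let f : i ⟶ max i j := homOfLE (le_max_left i j)
  let g : j ⟶ max i j := homOfLE (le_max_right i j)
  rw [← cocone_w_toFun c f, ← cocone_w_toFun c g] at hb
  have hb' := hinj _ hb
  rcases (F.map f).map_adj a' b' hadj with e | hadj'
  · rw [← cocone_w_toFun c f, ← cocone_w_toFun c g, e, hb'] at hne
    exact hne rfl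
  · refine (hF _ _ g).2.1 _ _ ?_ ⟨b, hb'.symm⟩ hadj'
    rintro ⟨a, ha⟩
    refine hx ⟨a, ?_⟩
    rw [← cocone_w_toFun c f, ← cocone_w_toFun c g, ha]

theorem chain_ι_dist (hc : IsColimit c)
    (hF : ∀ (i j : J) (f : i ⟶ j), cofibrations (F.map f)) (j : J) (a b : (F.obj j).V) :
    c.pt.dist ((c.ι.app j).toFun a) ((c.ι.app j).toFun b) = (F.obj j).dist a b :=
  dist_eq_of_isInducedInclusion (chain_ι_isInducedInclusion hc hF j) (chain_ι_not_adj hc hF j) a b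

/-- A vertex of the colimit and the given stage embed in a common stage; a projection found there
remains one since the maps to the colimit are isometric. -/
theorem cofibrations_chain_ι (hc : IsColimit c)
    (hF : ∀ (i j : J) (f : i ⟶ j), cofibrations (F.map f)) (j : J) : cofibrations (c.ι.app j) := by
  refine cofibrations_of (chain_ι_isInducedInclusion hc hF j) (chain_ι_not_adj hc hF j) ?_
  intro x _ a₀ _
  obtain ⟨i, x, rfl⟩ := exists_vertex_of_isColimit hc x
  let f : i ⟶ max i j := homOfLE (le_max_left i j)
  let g : j ⟶ max i j := homOfLE (le_max_right i j)
  obtain ⟨π, hπ⟩ := (hF _ _ g).exists_projection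
  obtain ⟨⟨p, hp⟩, -⟩ := hπ ((F.map f).toFun x) _ ⟨a₀, rfl⟩
  refine ⟨p, fun a => ?_⟩
  have h := (hπ ((F.map f).toFun x) _ ⟨a, rfl⟩).2
  rw [← hp] at h
  rw [← cocone_w_toFun c f, ← cocone_w_toFun c g, ← cocone_w_toFun c g]
  change c.pt.dist _ _ + c.pt.dist _ _ ≤ c.pt.dist _ _
  rw [chain_ι_dist hc hF, chain_ι_dist hc hF, chain_ι_dist hc hF]
  exact h

/-- A chain involves finitely many vertices, so one stage contains them all. -/
theorem chain_exists_lift (hc : IsColimit c)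
    (hF : ∀ (i j : J) (f : i ⟶ j), cofibrations (F.map f)) (j : J)
    {p n : ℤ} {x : List c.pt.V →₀ R} (hx : x ∈ c.pt.relFilt R ∅ p n) :
    ∃ (k : J) (_ : j ⟶ k), ∃ y ∈ (F.obj k).relFilt R ∅ p n,
      x = lmap R (c.ι.app k).toFun y := by
  classical
  choose s hs using exists_vertex_of_isColimit hc
  have : Nonempty J := ⟨j⟩
  obtain ⟨k, hk⟩ := Finset.exists_le (insert j ((x.support.biUnion List.toFinset).image s))
  refine ⟨k, homOfLE (hk j (Finset.mem_insert_self _ _)), ?_⟩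
  refine exists_lift_of_forall_mem_range (chain_ι_dist hc hF k) ?_
  intro l hl
  obtain ⟨h1, h2, h3, h4⟩ := hx hl
  refine ⟨h1, h2, h3.ne_nil, h4, fun y hy => ?_⟩
  have hle : s y ≤ k := hk _ (Finset.mem_insert_of_mem (Finset.mem_image_of_mem _
    (Finset.mem_biUnion.2 ⟨l, hl, List.mem_toFinset.2 hy⟩)))
  obtain ⟨a, ha⟩ := hs y
  exact ⟨(F.map (homOfLE hle)).toFun a, by rw [cocone_w_toFun, ha]⟩

/-- Cycles and primitives in the colimit descend to a stage, where the assumption on `F.map f`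
applies; isometric embeddings reflect all filtration conditions. -/
theorem bigradedPathHomologyIsos_chain_ι (hc : IsColimit c)
    (hF : ∀ (i j : J) (f : i ⟶ j), cofibrations (F.map f))
    (hW : ∀ (i j : J) (f : i ⟶ j), bigradedPathHomologyIsos R (F.map f)) (j : J) :
    bigradedPathHomologyIsos R (c.ι.app j) := by
  rw [bigradedPathHomologyIsos_iff]
  have hrefl : ∀ k {p p' n : ℤ} {y : List (F.obj k).V →₀ R}, y ∈ (F.obj k).relFilt R ∅ p n →
      lmap R (c.ι.app k).toFun y ∈ c.pt.relFilt R ∅ p' n → y ∈ (F.obj k).relFilt R ∅ p' n :=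
    fun k _ _ _ _ hy h => mem_relFilt_of_lmap_mem (chain_ι_injective hc hF k)
      (chain_ι_dist hc hF k) (fun l hl => hl.1) hy h
  intro p n
  constructor
  · intro a ha hda v hv hav
    obtain ⟨k, f, v, hv', rfl⟩ := chain_exists_lift hc hF j hv
    refine ((bigradedPathHomologyIsos_iff R _).1 (hW j k f) p n).1 a ha hda v hv' ?_
    rw [← lmap_chain_ι c f, bdry_lmap R (A := ∅) (by simp), ← map_sub] at hav
    refine hrefl k (p := p + 1) (sub_mem ?_ ?_) hav
    · exact relFilt_mono (by omega) (lmap_mem _ (by simp) ha)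
    · simpa using bdry_mem hv'
  · intro x hx hdx
    obtain ⟨k, f, x, hx', rfl⟩ := chain_exists_lift hc hF j hx
    rw [bdry_lmap R (A := ∅) (by simp)] at hdx
    obtain ⟨a, ha, hda, v, hv, h⟩ := ((bigradedPathHomologyIsos_iff R _).1 (hW j k f) p n).2 x hx'
      (hrefl k (bdry_mem hx') hdx)
    refine ⟨a, ha, hda, lmap R (c.ι.app k).toFun v, lmap_mem _ (by simp) hv, ?_⟩
    rw [← lmap_chain_ι c f, bdry_lmap R (A := ∅) (by simp), ← map_sub, ← map_sub]
    exact lmap_mem _ (by simp) h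

end Chains

/-! ### Cylinders -/

section Cylinder

/-- The edges `0 → 2 ← 3 → 4 ← 1` of the interval. -/
def intervalAdj (s t : Fin 5) : Prop :=
  (s = 0 ∧ t = 2) ∨ (s = 3 ∧ t = 2) ∨ (s = 3 ∧ t = 4) ∨ (s = 1 ∧ t = 4)

instance (s t : Fin 5) : Decidable (intervalAdj s t) := by
  unfold intervalAdj
  infer_instance

/-- The box product of a directed graph with the interval `0 → 2 ← 3 → 4 ← 1`. -/
def cylinder (X : DirGraph.{u}) : DirGraph.{u} where
  V := X.V × Fin 5
  graph := ⟨fun x y => (X.Adj x.1 y.1 ∧ x.2 = y.2) ∨ (x.1 = y.1 ∧ intervalAdj x.2 y.2)⟩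

variable {X : DirGraph.{u}}

theorem cylinder_adj_iff {x y : X.V} {s t : Fin 5} :
    (cylinder X).Adj (x, s) (y, t) ↔ (X.Adj x y ∧ s = t) ∨ (x = y ∧ intervalAdj s t) := Iff.rfl

/-- The projection of the cylinder. -/
def cylinderProj (X : DirGraph.{u}) : cylinder X ⟶ X :=
  ⟨fun x => x.1, by
    rintro ⟨x, s⟩ ⟨y, t⟩ h
    rcases cylinder_adj_iff.1 h with h | h
    · exact Or.inr h.1
    · exact Or.inl h.1⟩

/-- The inclusion of `X` at a vertex of the interval. -/
def cylinderIncl (X : DirGraph.{u}) (s : Fin 5) : X ⟶ cylinder X :=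
  ⟨fun x => (x, s), fun _ _ h => Or.inr (cylinder_adj_iff.2 (Or.inl ⟨h, rfl⟩))⟩

theorem cylinderIncl_proj (s : Fin 5) : cylinderIncl X s ≫ cylinderProj X = 𝟙 X := rfl

/-- Each level is a retract, and maps do not increase distances. -/
theorem cylinder_dist_level (x y : X.V) (s : Fin 5) :
    (cylinder X).dist (x, s) (y, s) = X.dist x y :=
  le_antisymm (dist_map_le (cylinderIncl X s) x y) (dist_map_le (cylinderProj X) (x, s) (y, s))

/-- Sinks of the interval are sinks for the levels of the cylinder. -/
theorem cylinder_hasPath_sink {n : ℕ} {x y : X.V} {s t : Fin 5} (hs : ∀ t, ¬ intervalAdj s t)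
    (h : (cylinder X).HasPath n (x, s) (y, t)) : s = t := by
  induction n generalizing x with
  | zero => exact congrArg Prod.snd h
  | succ n ih =>
    obtain ⟨⟨z, r⟩, hadj, hp⟩ := h
    rcases cylinder_adj_iff.1 hadj with ⟨-, rfl⟩ | ⟨-, h⟩
    · exact ih hp
    · exact absurd h (hs r)

/-- A path from level `s` to level `t ≠ s`, where the only edge from `s` in the interval leads to
a sink `r`, ends in level `r` and uses that edge. -/
theorem cylinder_hasPath {n : ℕ} {x y : X.V} {s t r : Fin 5} (hst : s ≠ t)
    (hs : ∀ t, intervalAdj s t → t = r) (hr : ∀ t, ¬ intervalAdj r t)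
    (h : (cylinder X).HasPath n (x, s) (y, t)) : t = r ∧ X.dist x y + 1 ≤ n := by
  induction n generalizing x with
  | zero => exact absurd (congrArg Prod.snd h) hst
  | succ n ih =>
    obtain ⟨⟨z, q⟩, hadj, hp⟩ := h
    rcases cylinder_adj_iff.1 hadj with ⟨hxz, rfl⟩ | ⟨e, h⟩
    · obtain ⟨h1, h2⟩ := ih hp
      refine ⟨h1, ?_⟩
      calc X.dist x y + 1 ≤ (X.dist x z + X.dist z y) + 1 := by
            gcongr
            exact dist_triangle _ _ _
        _ = X.dist x z + (X.dist z y + 1) := add_assoc _ _ _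
        _ ≤ 1 + n := add_le_add (dist_le_one_of_adj hxz) h2
        _ = ((n + 1 : ℕ) : ℕ∞) := by push_cast; rw [add_comm]
    · have e : x = z := e
      subst e
      obtain rfl := hs q h
      obtain rfl := cylinder_hasPath_sink hr hp
      refine ⟨rfl, ?_⟩
      push_cast
      gcongr
      rw [← cylinder_dist_level x y q]
      exact dist_le hp

theorem cylinder_dist_le {x y : X.V} {s t r : Fin 5} (hst : s ≠ t)
    (hs : ∀ t, intervalAdj s t → t = r) (hr : ∀ t, ¬ intervalAdj r t) (h : intervalAdj s t) :
    (cylinder X).dist (x, s) (y, s) + (cylinder X).dist (y, s) (y, t) ≤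
      (cylinder X).dist (x, s) (y, t) := by
  refine le_dist fun n hn => le_trans ?_ (cylinder_hasPath hst hs hr hn).2
  rw [cylinder_dist_level]
  gcongr
  exact dist_le_one_of_adj (cylinder_adj_iff.2 (Or.inr ⟨rfl, h⟩))

theorem cylinder_dist_eq_top {x y : X.V} {s t r : Fin 5} (hst : s ≠ t)
    (hs : ∀ t, intervalAdj s t → t = r) (hr : ∀ t, ¬ intervalAdj r t) (h : t ≠ r) :
    (cylinder X).dist (x, s) (y, t) = ⊤ := by
  by_contra hne
  obtain ⟨n, hn, -⟩ := exists_path_of_dist_ne_top hne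
  exact h (cylinder_hasPath hst hs hr hn).1

/-- A map to the cylinder that restricts to the two ends is a cofibration. -/
theorem cofibrations_of_ends {D : DirGraph.{u}} (i : D ⟶ cylinder X) (a b : X ⟶ D)
    (ha : ∀ x, i.toFun (a.toFun x) = (x, 0)) (hb : ∀ x, i.toFun (b.toFun x) = (x, 1))
    (hsurj : ∀ d, (∃ x, a.toFun x = d) ∨ ∃ x, b.toFun x = d) : cofibrations i := by
  have hrange : ∀ x s, ((x, s) : X.V × Fin 5) ∈ Set.range i.toFun ↔ s = 0 ∨ s = 1 := by
    intro x s
    constructor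
    · rintro ⟨d, hd⟩
      rcases hsurj d with ⟨y, rfl⟩ | ⟨y, rfl⟩
      · rw [ha] at hd
        exact Or.inl (congrArg Prod.snd hd).symm
      · rw [hb] at hd
        exact Or.inr (congrArg Prod.snd hd).symm
    · rintro (rfl | rfl)
      · exact ⟨_, ha x⟩
      · exact ⟨_, hb x⟩
  have h0 : ∀ t, intervalAdj 0 t → t = 2 := by decide
  have h1 : ∀ t, intervalAdj 1 t → t = 4 := by decide
  have h2 : ∀ t, ¬ intervalAdj 2 t := by decide
  have h4 : ∀ t, ¬ intervalAdj 4 t := by decide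
  refine cofibrations_of ⟨fun d d' h => ?_, fun d d' hne h => ?_⟩ ?_ ?_
  · rcases hsurj d with ⟨x, rfl⟩ | ⟨x, rfl⟩ <;> rcases hsurj d' with ⟨y, rfl⟩ | ⟨y, rfl⟩ <;>
      simp only [ha, hb] at h
    · exact congrArg a.toFun (congrArg Prod.fst h)
    · exact absurd (congrArg Prod.snd h : (_ : Fin 5) = _) (by simp)
    · exact absurd (congrArg Prod.snd h : (_ : Fin 5) = _) (by simp)
    · exact congrArg b.toFun (congrArg Prod.fst h)
  · rcases hsurj d with ⟨x, rfl⟩ | ⟨x, rfl⟩ <;> rcases hsurj d' with ⟨y, rfl⟩ | ⟨y, rfl⟩ <;>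
      simp only [ha, hb, cylinder_adj_iff] at h
    · rcases h with ⟨h, -⟩ | ⟨-, h⟩
      · exact (a.map_adj x y h).resolve_left hne
      · exact absurd h (by decide)
    · rcases h with ⟨-, h⟩ | ⟨-, h⟩
      · exact absurd h (by decide)
      · exact absurd h (by decide)
    · rcases h with ⟨-, h⟩ | ⟨-, h⟩
      · exact absurd h (by decide)
      · exact absurd h (by decide)
    · rcases h with ⟨h, -⟩ | ⟨-, h⟩
      · exact (b.map_adj x y h).resolve_left hne
      · exact absurd h (by decide)
  · rintro ⟨x, s⟩ ⟨y, t⟩ hx hy h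
    replace hx := mt (hrange x s).2 hx
    replace hy := (hrange y t).1 hy
    rcases cylinder_adj_iff.1 h with ⟨-, rfl⟩ | ⟨-, h'⟩
    · exact hx hy
    · clear h
      revert s t
      decide
  · rintro ⟨x, s⟩ hx d₀ hd₀
    replace hx := not_or.1 (mt (hrange x s).2 hx)
    -- Level 3 has no incoming edges from other levels. Each of the levels 2 and 4 is reached from
    -- one end only; this provides the projection, which a shorter interval 0 → 2 ← 1 would not.
    have hs : s = 2 ∨ s = 4 := by
      rcases hsurj d₀ with ⟨y, rfl⟩ | ⟨y, rfl⟩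
      · by_contra h
        rw [ha] at hd₀
        exact hd₀ (cylinder_dist_eq_top (Ne.symm hx.1) h0 h2 fun e => h (Or.inl e))
      · by_contra h
        rw [hb] at hd₀
        exact hd₀ (cylinder_dist_eq_top (Ne.symm hx.2) h1 h4 fun e => h (Or.inr e))
    rcases hs with rfl | rfl
    · refine ⟨a.toFun x, fun d => ?_⟩
      rcases hsurj d with ⟨y, rfl⟩ | ⟨y, rfl⟩
      · rw [ha, ha]
        exact cylinder_dist_le (by decide) h0 h2 (by decide)
      · rw [hb, cylinder_dist_eq_top (t := 2) (by decide) h1 h4 (by decide)]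
        exact le_top
    · refine ⟨b.toFun x, fun d => ?_⟩
      rcases hsurj d with ⟨y, rfl⟩ | ⟨y, rfl⟩
      · rw [ha, cylinder_dist_eq_top (t := 4) (by decide) h0 h2 (by decide)]
        exact le_top
      · rw [hb, hb]
        exact cylinder_dist_le (by decide) h1 h4 (by decide)

/-- A self-map of the interval, applied to the cylinder. -/
def cylinderMap (X : DirGraph.{u}) (φ : Fin 5 → Fin 5)
    (hφ : ∀ s t, intervalAdj s t → φ s = φ t ∨ intervalAdj (φ s) (φ t)) :
    cylinder X ⟶ cylinder X :=
  ⟨fun x => (x.1, φ x.2), by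
    rintro ⟨x, s⟩ ⟨y, t⟩ h
    rcases cylinder_adj_iff.1 h with ⟨h', rfl⟩ | ⟨e, h'⟩
    · exact Or.inr (Or.inl ⟨h', rfl⟩)
    · have e : x = y := e
      subst e
      rcases hφ s t h' with h | h
      · exact Or.inl (Prod.ext rfl h)
      · exact Or.inr (Or.inr ⟨rfl, h⟩)⟩

/-- The collapse to level 3 and the identity are joined by two one-edge homotopies through `m`;
since level 3 is a section of the projection, two-out-of-six applies. -/
theorem bigradedPathHomologyIsos_cylinderProj (R : Type w) [CommRing R] :
    bigradedPathHomologyIsos R (cylinderProj X) := by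
  -- `m` pushes level 0 to 2 and level 1 to 4 and fixes the rest. Its image lies in the levels 2, 3,
  -- 4, each equal to 3 or the target of an edge from 3.
  let m : cylinder X ⟶ cylinder X := cylinderMap X ![2, 4, 2, 3, 4] (by decide)
  have h1 : ∀ x, Hom.toFun (𝟙 (cylinder X)) x = m.toFun x ∨
      (cylinder X).Adj (Hom.toFun (𝟙 (cylinder X)) x) (m.toFun x) := by
    rintro ⟨x, s⟩
    have : s = (![2, 4, 2, 3, 4] : Fin 5 → Fin 5) s ∨
        intervalAdj s ((![2, 4, 2, 3, 4] : Fin 5 → Fin 5) s) := by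
      revert s
      decide
    exact this.imp (fun h => Prod.ext rfl h) fun h => Or.inr ⟨rfl, h⟩
  have h2 : ∀ x, (cylinderProj X ≫ cylinderIncl X 3).toFun x = m.toFun x ∨
      (cylinder X).Adj ((cylinderProj X ≫ cylinderIncl X 3).toFun x) (m.toFun x) := by
    rintro ⟨x, s⟩
    have : 3 = (![2, 4, 2, 3, 4] : Fin 5 → Fin 5) s ∨
        intervalAdj 3 ((![2, 4, 2, 3, 4] : Fin 5 → Fin 5) s) := by
      revert s
      decide
    exact this.imp (fun h => Prod.ext rfl h) fun h => Or.inr ⟨rfl, h⟩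
  have h3 : bigradedPathHomologyIsos R (cylinderProj X ≫ cylinderIncl X 3) := fun k l => by
    rw [bigradedPathHomologyMap_eq_of_adj h2, ← bigradedPathHomologyMap_eq_of_adj h1]
    exact bigradedPathHomologyIsos_id R _ k l
  refine (bigradedPathHomologyIsos_two_of_six R (h := cylinderProj X) h3 ?_).1
  rw [cylinderIncl_proj]
  exact bigradedPathHomologyIsos_id R X

theorem exists_cylinder_factorization (R : Type w) [CommRing R] (c : BinaryCofan X X)
    (hc : IsColimit c) :
    ∃ (Z : DirGraph.{u}) (i : c.pt ⟶ Z) (p : Z ⟶ X), cofibrations i ∧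
      bigradedPathHomologyIsos R p ∧ i ≫ p = hc.desc (BinaryCofan.mk (𝟙 X) (𝟙 X)) := by
  let i : c.pt ⟶ cylinder X := hc.desc (BinaryCofan.mk (cylinderIncl X 0) (cylinderIncl X 1))
  have hl : c.inl ≫ i = cylinderIncl X 0 := hc.fac _ ⟨WalkingPair.left⟩
  have hr : c.inr ≫ i = cylinderIncl X 1 := hc.fac _ ⟨WalkingPair.right⟩
  refine ⟨cylinder X, i, cylinderProj X, ?_, bigradedPathHomologyIsos_cylinderProj R, ?_⟩
  · refine cofibrations_of_ends i c.inl c.inr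
      (fun x => congrArg (fun f : X ⟶ cylinder X => f.toFun x) hl)
      (fun x => congrArg (fun f : X ⟶ cylinder X => f.toFun x) hr) fun d => ?_
    obtain ⟨⟨j⟩, x, hx⟩ := exists_vertex_of_isColimit hc d
    cases j with
    | left => exact Or.inl ⟨x, hx⟩
    | right => exact Or.inr ⟨x, hx⟩
  · refine BinaryCofan.IsColimit.hom_ext hc ?_ ?_
    · have e : (c.inl ≫ i) ≫ cylinderProj X = 𝟙 X :=
        (congrArg (fun f : X ⟶ cylinder X => f ≫ cylinderProj X) hl).trans (cylinderIncl_proj 0)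
      exact ((Category.assoc _ _ _).symm.trans e).trans
        (hc.fac (BinaryCofan.mk (𝟙 X) (𝟙 X)) ⟨WalkingPair.left⟩).symm
    · have e : (c.inr ≫ i) ≫ cylinderProj X = 𝟙 X :=
        (congrArg (fun f : X ⟶ cylinder X => f ≫ cylinderProj X) hr).trans (cylinderIncl_proj 1)
      exact ((Category.assoc _ _ _).symm.trans e).trans
        (hc.fac (BinaryCofan.mk (𝟙 X) (𝟙 X)) ⟨WalkingPair.right⟩).symm

end Cylinder

/-! ### The cofibration category -/

section Main

variable (R : Type w) [CommRing R]

instance cofibrations_isMultiplicative : cofibrations.{u}.IsMultiplicative where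
  id_mem X := cofibrations_of_iso (Iso.refl X)
  comp_mem _ _ := cofibrations_comp

instance acyclic_isMultiplicative :
    (cofibrations ⊓ bigradedPathHomologyIsos.{w, u} R).IsMultiplicative where
  id_mem X := ⟨cofibrations_of_iso (Iso.refl X), bigradedPathHomologyIsos_id R X⟩
  comp_mem _ _ hf hg := ⟨cofibrations_comp hf.1 hg.1, bigradedPathHomologyIsos_comp R hf.2 hg.2⟩

instance cofibrations_respectsIso : cofibrations.{u}.RespectsIso :=
  MorphismProperty.RespectsIso.mk _ (fun e _ hf => cofibrations_comp (cofibrations_of_iso e) hf)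
    fun e _ hf => cofibrations_comp hf (cofibrations_of_iso e)

instance acyclic_respectsIso :
    (cofibrations ⊓ bigradedPathHomologyIsos.{w, u} R).RespectsIso :=
  MorphismProperty.RespectsIso.mk _
    (fun e _ hf => ⟨cofibrations_comp (cofibrations_of_iso e) hf.1,
      bigradedPathHomologyIsos_comp R (bigradedPathHomologyIsos_of_iso R e) hf.2⟩)
    fun e _ hf => ⟨cofibrations_comp hf.1 (cofibrations_of_iso e),
      bigradedPathHomologyIsos_comp R hf.2 (bigradedPathHomologyIsos_of_iso R e)⟩

theorem isCofibrationCategory :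
    IsCofibrationCategory DirGraph.{u} (bigradedPathHomologyIsos R) cofibrations where
  cof_comp _ _ _ _ _ := cofibrations_comp
  weq_comp _ _ _ _ _ := bigradedPathHomologyIsos_comp R
  id_mem X := ⟨cofibrations_of_iso (Iso.refl X), bigradedPathHomologyIsos_id R X⟩
  two_of_six _ _ _ _ f g h hfg hgh := by
    obtain ⟨h1, h2, h3⟩ := bigradedPathHomologyIsos_two_of_six R hfg hgh
    exact ⟨h1, h2, h3, bigradedPathHomologyIsos_comp R h1 hgh⟩
  hasInitial := inferInstance
  cofibrant I hI X := by
    have := isEmpty_of_isInitial hI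
    exact cofibrations_of_isEmpty _
  hasPushout _ _ _ _ _ _ := inferInstance
  cof_pushout _ _ _ _ _ _ _ _ := cofibrations_pushout
  acyclic_pushout _ _ _ _ _ _ _ _ sq hi :=
    ⟨cofibrations_pushout sq hi.1, bigradedPathHomologyIsos_pushout R sq hi.1 hi.2⟩
  codiagonal _ c hc := exists_cylinder_factorization R c hc
  hasCoproducts := fun _ => inferInstance
  cof_transfinite := isStableUnderTransfiniteComposition_of_colimits
    fun _ _ _ _ hc hF j => cofibrations_chain_ι hc hF j
  acyclic_transfinite := isStableUnderTransfiniteComposition_of_colimits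
    fun _ _ _ _ hc hF j => ⟨cofibrations_chain_ι hc (fun i j f => (hF i j f).1) j,
      bigradedPathHomologyIsos_chain_ι hc (fun i j f => (hF i j f).1)
        (fun i j f => (hF i j f).2) j⟩

end Main

end DirGraph

theorem mainTheorem3 (R : Type w) [CommRing R] [IsDomain R] [IsPrincipalIdealRing R] :
    IsCofibrationCategory DirGraph.{u}
      (DirGraph.bigradedPathHomologyIsos R) DirGraph.cofibrations ∧
    DirGraph.bigradedPathHomologyIsos.{w, u} R ≤ DirGraph.pathHomologyIsos R :=
  ⟨DirGraph.isCofibrationCategory R, DirGraph.bigradedPathHomologyIsos_le_pathHomologyIsos R⟩
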